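/- **Theorem (xy-connectivity given an x–y path).** *Setting.* Let $G=(V,E)$ be a connected $n$-vertex graph of diameter $D$ without cut vertices, whose vertices have distinct IDs of $O(\log n)$ bits, and let $T$ be a BFS tree of $G$ with root $s$. Write $T_v$ for the subtree of $T$ at $v$ and $\pi(u,v)$ for tree paths. Every non-leaf vertex has one heavy child, a child with a largest subtree (ties broken arbitrarily); all other vertices (including $s$) are light, and a tree edge is heavy or light according to its lower endpoint. $\mathsf{LD}(x)$ is the set of vertices $v$ such that $\pi(s,v)$ contains a light edge from $x$ to a child of $x$. The extended ID of $v$ is its ID together with its compressed path: the list of the light vertices on $\pi(s,v)$, each with the number of heavy vertices following it before the next light vertex (or the end). Let $V_x=V(T_x)\setminus\{x\}$, let $\mathcal C_x$ be the set of connected components of $G[V_x]$, and let $C_{x,v}\in\mathcal C_x$ be the component of $v\in V_x$; the component-ID of $C\in\mathcal C_x$ is the largest ID of a child of $x$ in $C$. For every $x\ne s$ and $C\in\mathcal C_x$ fix an arbitrary edge $(u_C,v_C)$ of $G$ with $v_C\in C$ and $x\notin\pi(s,u_C)$, and put $\pi_x(s,C)=\pi(s,u_C)\circ(u_C,v_C)$;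 its compressed form consists of the extended IDs of $u_C$ and $v_C$. Vertices $x,y$ are independent if neither is an ancestor of the other in $T$; then $$\mathsf{LDS}(x,y)=\{v\in\mathsf{LD}(x) : y\in\pi_x(s,C_{x,v})\}.$$ *Initial knowledge.* A sketching scheme is a random seed of $\widetilde O(1)$ bits with a function that, given the seed, maps the extended IDs of the endpoints of an edge to a vector of $\widetilde O(1)$ bits; the sketch of a vertex is the XOR over its incident edges, that of a vertex set the XOR over its vertices. Each vertex $v$ knows $n$, the depth of $T$, the seed, the sketches of $v$, $V(T_v)$ and $V$, $|V(T_v)|$, and the following. 1. Its public information: its extended ID, its path $\pi(s,v)$ (all vertices are given by extended IDs) and, for each proper ancestor $x$, the component-ID of $C_{x,v}$ and (if $x\neq s$) the compressed form of $\pi_x(s,C_{x,v})$, and also the whole path if $v\in\mathsf{LD}(x)$. 2. The public information of each of its neighbours. 3. For each child $c$ of $v$: its extended ID, $|V(T_c)|$, the sketch of $V(T_c)$, the component-ID of $C_{v,c}$ and, if $v\ne s$, the path $\pi_v(s,C_{v,c})$ and the compressed form of $\pi_z(s,C_{z,z'})$ for every tree edge $(z,z')$ of $\pi_v(s,C_{v,c})$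 with $z\neq s$ ($z$ the parent of $z'$), where only light edges $(z,z')$ are included if $C_{v,c}$ contains the heavy child of $v$. 4. If $v$ lies on the given $x$–$y$ path $\Pi_{x,y}$: the extended IDs of $x$, of $y$ and of its predecessor and successor on $\Pi_{x,y}$. *Claim.* For all constants $c$ (for the success probability), $K$ and $\gamma$ there are a sketching scheme and a randomized algorithm in the synchronous CONGEST model (messages of $O(\log n)$ bits, private random coins), such that the following holds for all $G$, IDs in $\{0,\dots,n^{\gamma}-1\}$, $T$, heavy children and edges $(u_C,v_C)$ as above, every independent pair $x,y$, and every simple $x$–$y$ path $\Pi_{x,y}$ in $G$ of length at most $K D$. The algorithm, started from this initial knowledge, runs for $\widetilde O(D)$ rounds; the total number of messages sent through any edge is $\widetilde O(1)$; and messages are sent only along edges of $\Pi_{x,y}$ and edges incident to $\mathsf{LDS}(x,y)\cup\mathsf{LDS}(y,x)$ (these three bounds hold for every outcome of the randomness). At the end, with probability at least $1-n^{-c}$ over the seed and the coins, both $x$ and $y$ know whether $G\setminus\{x,y\}$ is connected. Here $\widetilde O(f)$ means at most $A f\lceil\log_2 n\rceil^{B}$, where $B$ is an absolute constant and $A$ (also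 the constant in the message size) depends only on $c,K,\gamma$. -/

import Mathlib

/-! Distributed (CONGEST) connectivity of a network after the removal of two vertices. -/

namespace CutPair

/-! ### The network and its BFS tree -/

/-- A connected network whose vertices carry distinct numerical IDs, together with a BFS tree `T`
of it, rooted at the vertex `root` and given by its parent function. -/
structure RootedNetwork (V : Type*) where
  graph : SimpleGraph V
  connected : graph.Connected
  ident : V → ℕ
  ident_injective : Function.Injective ident
  root : V
  parent : V → V
  parent_root : parent root = root
  parent_adj : ∀ v, v ≠ root → graph.Adj (parent v) v
  dist_parent : ∀ v, v ≠ root → graph.dist root v = graph.dist root (parent v) + 1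

namespace RootedNetwork

variable {V : Type*} (N : RootedNetwork V)

/-- `u` is a tree ancestor of `v` (every vertex is an ancestor of itself). -/
def IsAncestor (u v : V) : Prop := ∃ k : ℕ, N.parent^[k] v = u

/-- `c` is a tree child of `v`. -/
def IsChild (v c : V) : Prop := c ≠ N.root ∧ N.parent c = v

/-- `x` and `y` are independent: neither is a tree ancestor of the other. -/
def Independent (x y : V) : Prop := ¬ N.IsAncestor x y ∧ ¬ N.IsAncestor y x

/-- The vertex set of the subtree `T_v`. -/
def subtree (v : V) : Set V := {w | N.IsAncestor v w}

/-- `V_x`, the set of proper tree descendants of `x`. -/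
def below (x : V) : Set V := N.subtree x \ {x}

/-- The tree path `π(s, v)` from the root `s` to `v`, listed from the root. -/
noncomputable def rootPath (v : V) : List V :=
  ((List.range (N.graph.dist N.root v + 1)).map fun k => N.parent^[k] v).reverse

/-- The depth of the BFS tree. -/
noncomputable def depth [Fintype V] : ℕ := Finset.univ.sup fun v => N.graph.dist N.root v

/-- `C_{x,v}`, the connected component of `v` in the induced graph `G[V_x]`
(empty if `v` does not lie in `V_x`). -/
def comp (x v : V) : Set V :=
  {w | ∃ (hv : v ∈ N.below x) (hw : w ∈ N.below x),
    (N.graph.induce (N.below x)).Reachable ⟨v, hv⟩ ⟨w, hw⟩}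

open Classical in
/-- The component-ID of `C_{x,v}`: the largest ID of a tree child of `x` inside it. -/
noncomputable def compID [Fintype V] (x v : V) : ℕ :=
  (Finset.univ.filter fun c => N.IsChild x c ∧ c ∈ N.comp x v).sup N.ident

end RootedNetwork

/-! ### Heavy-light decomposition -/

/-- A choice of a heavy child, i.e. a child with a largest subtree, of every non-leaf vertex
(ties are broken arbitrarily; the value at a leaf is irrelevant). -/
structure HeavyLight {V : Type*} [Fintype V] (N : RootedNetwork V) where
  heavyChild : V → V
  isChild : ∀ v c, N.IsChild v c → N.IsChild v (heavyChild v)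
  maximal : ∀ v c, N.IsChild v c → (N.subtree c).ncard ≤ (N.subtree (heavyChild v)).ncard

/-- A compressed root-to-vertex path: the IDs of the light vertices of the path in order, each with
the number of heavy vertices that follow it before the next light vertex (or the end). -/
abbrev CompressedPath := List (ℕ × ℕ)

/-- The ID of a vertex, extended by the compressed path of the vertex. -/
structure ExtID where
  id : ℕ
  anc : CompressedPath

namespace HeavyLight

variable {V : Type*} [Fintype V] {N : RootedNetwork V} (H : HeavyLight N)

/-- `v` is a heavy vertex (the heavy child of its parent); all others, e.g. the root, are light. -/
def IsHeavy (v : V) : Prop := v ≠ N.root ∧ H.heavyChild (N.parent v) = v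

/-- `LD(x)`: the vertices `v` such that `π(s, v)` contains a light edge from `x` to a child. -/
def LD (x : V) : Set V :=
  {v | ∃ c, N.IsChild x c ∧ c ≠ H.heavyChild x ∧ N.IsAncestor c v}

open Classical in
/-- One step of the compression; the list is kept in reverse order. -/
noncomputable def compressStep (acc : CompressedPath) (v : V) : CompressedPath :=
  if H.IsHeavy v then
    match acc with
    | [] => []
    | (a, k) :: rest => (a, k + 1) :: rest
  else (N.ident v, 0) :: acc

/-- The compressed path `π*(s, v)`. -/
noncomputable def compressed (v : V) : CompressedPath :=
  ((N.rootPath v).foldl H.compressStep []).reverse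

/-- The extended ID of a vertex. -/
noncomputable def ext (v : V) : ExtID := ⟨N.ident v, H.compressed v⟩

end HeavyLight

/-! ### Connectivity trees and sensitive light descendants -/

/-- For every vertex `x` other than the root and every component `C` of `G[V_x]`, an edge
`(u_C, v_C)` of the graph with `v_C ∈ C` such that `x` does not lie on `π(s, u_C)`.  It is
recorded as `out x v = u_C`, `inn x v = v_C` for the vertices `v ∈ C`.  The connectivity tree of
`x` is the union of the paths `π_x(s, C) = π(s, u_C) ∘ (u_C, v_C)`. -/
structure ConnectivityTrees {V : Type*} (N : RootedNetwork V) where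
  out : V → V → V
  inn : V → V → V
  out_congr : ∀ x v w, w ∈ N.comp x v → out x w = out x v
  inn_congr : ∀ x v w, w ∈ N.comp x v → inn x w = inn x v
  adj : ∀ x v, x ≠ N.root → v ∈ N.below x → N.graph.Adj (out x v) (inn x v)
  inn_mem : ∀ x v, x ≠ N.root → v ∈ N.below x → inn x v ∈ N.comp x v
  not_mem_out : ∀ x v, x ≠ N.root → v ∈ N.below x → x ∉ N.rootPath (out x v)

/-- The path `π_x(s, C_{x,v})`, listed from the root. -/
noncomputable def ConnectivityTrees.path {V : Type*} {N : RootedNetwork V}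
    (C : ConnectivityTrees N) (x v : V) : List V :=
  N.rootPath (C.out x v) ++ [C.inn x v]

/-- `LDS(x, y)`: the light descendants of `x` that lie in a `y`-sensitive component of
`G[V_x]`. -/
def LDS {V : Type*} [Fintype V] {N : RootedNetwork V} (H : HeavyLight N)
    (C : ConnectivityTrees N) (x y : V) : Set V :=
  {v | v ∈ H.LD x ∧ y ∈ C.path x v}

/-! ### Linear graph sketches -/

/-- A linear sketching scheme: a random seed of `seedLen` bits assigns to every edge, given by the
extended IDs of its endpoints, a bit vector of length `len`.  Sketches of vertices and of sets of
vertices are obtained by XOR. -/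
structure SketchScheme where
  seedLen : ℕ
  len : ℕ
  edge : (Fin seedLen → Bool) → Sym2 ExtID → (Fin len → ZMod 2)

namespace SketchScheme

variable {V : Type*} [Fintype V] {N : RootedNetwork V}

open Classical in
/-- The sketch of a vertex: the XOR over its incident edges. -/
noncomputable def vertex (S : SketchScheme) (H : HeavyLight N) (seed : Fin S.seedLen → Bool)
    (v : V) : Fin S.len → ZMod 2 :=
  ∑ u ∈ Finset.univ.filter (fun u => N.graph.Adj v u), S.edge seed s(H.ext v, H.ext u)

open Classical in
/-- The sketch of a set of vertices: the XOR over its vertices. -/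
noncomputable def onSet (S : SketchScheme) (H : HeavyLight N) (seed : Fin S.seedLen → Bool)
    (A : Set V) : Fin S.len → ZMod 2 :=
  ∑ v ∈ Finset.univ.filter (fun v => v ∈ A), S.vertex H seed v

end SketchScheme

/-! ### What a vertex knows at the start -/

/-- What a vertex `u` knows about a proper ancestor `x`: the extended ID of `x`, the component-ID
of `C = C_{x,u}`, and, if `x` is not the root, the compressed form of `π_x(s, C)` (that is, the
extended IDs of `u_C` and `v_C`), and the whole path `π_x(s, C)` if `x` is a light ancestor. -/
structure AncestorInfo where
  ancestor : ExtID
  compID : ℕ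
  compressedPath : Option (ExtID × ExtID)
  fullPath : Option (List ExtID)

/-- What a vertex knows about itself and has told its neighbours: its extended ID, its tree path
from the root, and its information on its proper ancestors, from the root downwards. -/
structure PublicInfo where
  me : ExtID
  treePath : List ExtID
  ancestors : List AncestorInfo

/-- What a vertex `x` knows about a child `c`: extended ID, subtree size, subtree sketch, the
component-ID of `C = C_{x,c}`, and, if `x` is not the root, the path `π_x(s, C)` and triples
consisting of `y`, `y'` and the compressed form of `π_y(s, C_{y,y'})` for tree edges `(y, y')`
of `π_x(s, C)`. -/
structure ChildInfo (S : SketchScheme) where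
  me : ExtID
  size : ℕ
  sketch : Fin S.len → ZMod 2
  compID : ℕ
  path : Option (List ExtID)
  sensitivity : List (ExtID × ExtID × (ExtID × ExtID))

/-- What a vertex of the given `x`-`y` path knows about it: the extended IDs of `x` and `y`, and
those of the preceding and of the following vertex of the path. -/
structure ChannelInfo where
  x : ExtID
  y : ExtID
  prev : Option ExtID
  next : Option ExtID

/-- The initial knowledge of a vertex; `channel` is `none` off the given path. -/
structure LocalInput (S : SketchScheme) where
  depth : ℕ
  self : PublicInfo
  neighbours : Set PublicInfo
  size : ℕ
  children : Set (ChildInfo S)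
  seed : Fin S.seedLen → Bool
  sketchSelf : Fin S.len → ZMod 2
  sketchSubtree : Fin S.len → ZMod 2
  sketchAll : Fin S.len → ZMod 2
  channel : Option ChannelInfo

section Knowledge

variable {V : Type*} [Fintype V] {N : RootedNetwork V} (H : HeavyLight N)
  (C : ConnectivityTrees N)

/-- The compressed form of `π_x(s, C_{x,v})`. -/
noncomputable def compressedConnPath (x v : V) : ExtID × ExtID :=
  (H.ext (C.out x v), H.ext (C.inn x v))

open Classical in
noncomputable def ancestorInfo (u x : V) : AncestorInfo where
  ancestor := H.ext x
  compID := N.compID x u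
  compressedPath := if x = N.root then none else some (compressedConnPath H C x u)
  fullPath := if x ≠ N.root ∧ u ∈ H.LD x then some ((C.path x u).map H.ext) else none

noncomputable def publicInfo (u : V) : PublicInfo where
  me := H.ext u
  treePath := (N.rootPath u).map H.ext
  ancestors := (N.rootPath u).dropLast.map (ancestorInfo H C u)

/-- The edges of the tree path `π(s, v)`, directed away from the root. -/
noncomputable def rootPathEdges (N : RootedNetwork V) (v : V) : List (V × V) :=
  (N.rootPath v).zip (N.rootPath v).tail

open Classical in
/-- The tree edges `(y, y')` of `π_x(s, C_{x,c})`, `y` not the root, for which `x` knows the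
compressed form of `π_y(s, C_{y,y'})`: all of them if `C_{x,c}` does not contain the heavy child
of `x`, and only the light ones otherwise. -/
noncomputable def sensitivityEdges (x c : V) : List (V × V) :=
  (rootPathEdges N (C.out x c)).filter fun e =>
    e.1 ≠ N.root ∧ (H.heavyChild x ∈ N.comp x c → ¬ H.IsHeavy e.2)

open Classical in
noncomputable def childInfo (S : SketchScheme) (seed : Fin S.seedLen → Bool) (x c : V) :
    ChildInfo S where
  me := H.ext c
  size := (N.subtree c).ncard
  sketch := S.onSet H seed (N.subtree c)
  compID := N.compID x c
  path := if x = N.root then none else some ((C.path x c).map H.ext)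
  sensitivity := if x = N.root then [] else
    (sensitivityEdges H C x c).map fun e =>
      (H.ext e.1, H.ext e.2, compressedConnPath H C e.1 e.2)

open Classical in
noncomputable def channelInfo {x y : V} (p : N.graph.Walk x y) (v : V) : Option ChannelInfo :=
  if v ∈ p.support then
    let i := p.support.idxOf v
    some
      { x := H.ext x
        y := H.ext y
        prev := if i = 0 then none else some (H.ext (p.getVert (i - 1)))
        next := if i = p.length then none else some (H.ext (p.getVert (i + 1))) }
  else none

/-- The initial knowledge of the vertex `v` for a given random seed and a given path. -/
noncomputable def localInput (S : SketchScheme) (seed : Fin S.seedLen → Bool) {x y : V}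
    (p : N.graph.Walk x y) (v : V) : LocalInput S where
  depth := N.depth
  self := publicInfo H C v
  neighbours := publicInfo H C '' {u | N.graph.Adj v u}
  size := (N.subtree v).ncard
  children := childInfo H C S seed v '' {c | N.IsChild v c}
  seed := seed
  sketchSelf := S.vertex H seed v
  sketchSubtree := S.onSet H seed (N.subtree v)
  sketchAll := S.onSet H seed Set.univ
  channel := channelInfo H p v

end Knowledge

/-! ### The CONGEST model -/

/-- A synchronous message passing algorithm with local inputs in `I`.  Every vertex runs the same
program, has `coinLen` private random bits, addresses its neighbours by their IDs, may send a bit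
string (or nothing) to each neighbour in each round, and then updates its state according to the
messages that arrive.  Local computation is free. -/
structure Algorithm (I : Type) where
  coinLen : ℕ
  State : Type
  init : I → (Fin coinLen → Bool) → State
  send : State → ℕ → Option (List Bool)
  receive : State → (ℕ → Option (List Bool)) → State
  output : State → Option Bool

namespace Algorithm

variable {I : Type} (P : Algorithm I) {V : Type*} (N : RootedNetwork V)

open Classical in
/-- The messages that arrive at `v`, indexed by the ID of the sender, if the vertices are in the
states `st`. -/
noncomputable def inbox (st : V → P.State) (v : V) (i : ℕ) : Option (List Bool) :=
  if h : ∃ w, N.graph.Adj w v ∧ N.ident w = i then P.send (st h.choose) (N.ident v) else none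

/-- The state of every vertex after `t` rounds. -/
noncomputable def stateAt (inp : V → I) (coins : V → Fin P.coinLen → Bool) : ℕ → V → P.State
  | 0 => fun v => P.init (inp v) (coins v)
  | t + 1 => fun v => P.receive (stateAt inp coins t v) (P.inbox N (stateAt inp coins t) v)

/-- The message that `u` sends to its neighbour `v` in round `t + 1`. -/
noncomputable def message (inp : V → I) (coins : V → Fin P.coinLen → Bool) (t : ℕ) (u v : V) :
    Option (List Bool) :=
  P.send (P.stateAt N inp coins t u) (N.ident v)

/-- The number of messages that `u` sends to its neighbour `v` in the first `R` rounds. -/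
noncomputable def messageCount (inp : V → I) (coins : V → Fin P.coinLen → Bool) (R : ℕ)
    (u v : V) : ℕ :=
  {t : ℕ | t < R ∧ P.message N inp coins t u v ≠ none}.ncard

end Algorithm

/-- The final state `st` of a vertex reports correctly whether `G ∖ {x, y}` is connected. -/
def Knows {I : Type} (P : Algorithm I) {V : Type*} (G : SimpleGraph V) (x y : V)
    (st : P.State) : Prop :=
  ∃ b : Bool, P.output st = some b ∧ (b = true ↔ (G.induce ({x, y}ᶜ : Set V)).Connected)

end CutPair

/-! Regions. Delete `x` and `y`. A component `C` of the proper descendants of `x` whose path `π_x(s,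
C)` avoids `y` stays joined to the root, and symmetrically for `y`; so does every vertex outside
both subtrees. Only the sensitive components are in doubt. On each side at most one of them contains
the heavy child. All others consist of vertices of `LDS(x, y) ∪ LDS(y, x)`, so all their incident
edges may be used; these are the active components. The two heavy ones stay silent, since they need
not lie in these sets.

Merging. The root region is labelled `0`, the vertices `x` and `y` are labelled `⊤`, and each
sensitive component carries its component-ID. The labels `0`, `⊤` and those of the two heavy
components are special and never change. In a Borůvka phase every other class points to its
least-labelled neighbouring class, and classes whose pointer orbits agree eventually are merged. A
class that is neither special nor isolated doubles its guaranteed size (`Labelling.step`). After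
`⌈log₂ n⌉` phases any remaining nonspecial class is therefore cut off from the root. If there is
none, at most three classes besides `{x, y}` are left, and connectivity means that at most three
cuts are nonempty (`Labelling.reachable_iff`).

Running the phases. Both ends of the path must carry out the same merging, each with only its own
components at hand. A phase takes three slots, each a broadcast down the active subtrees, one
exchange with all neighbours and a convergecast of minima. Adjacent active vertices below the same
end lie in one component (`active_adj`), so an edge between active vertices of different labels
always joins the two sides. Hence the labels whose pointers an end learns are closed under the
pointer map (`known_closed`), and this suffices for both ends to compute the true merged labels
(`tracks_phase`).

Testing the cuts. The edge of code `k` has sketch `α ^ k` for a random `α` in the field with `2 ^ m`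
elements. A nonempty edge set yields a nonzero polynomial of small degree, which has few roots
(`exists_fingerprint`). Each end adds the subtree sketches of its children in a class and the
sketches of its own edges into the class. The sum of the two contributions is the sketch of the cut
in `G ∖ {x, y}` (`classSketch_add`), so one exchange along the given path decides.

Correctness of the distributed program is a fixed-point argument: the contents of all messages are
defined globally, and `Setting.sendMsg_content` checks that they obey the local sending rule. By
`stateAt_ofSend` they are then what is sent. -/

namespace CutPair

namespace RootedNetwork

variable {V : Type*} (N : RootedNetwork V)

/-! ### Ancestors and root paths -/

/-- The depth of a vertex in the BFS tree. -/
noncomputable def level (v : V) : ℕ := N.graph.dist N.root v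

lemma level_root : N.level N.root = 0 := by simp [level]

lemma level_eq_zero {v : V} : N.level v = 0 ↔ v = N.root := by
  rw [level, N.connected.dist_eq_zero_iff]; exact eq_comm

lemma level_parent {v : V} (h : v ≠ N.root) : N.level v = N.level (N.parent v) + 1 :=
  N.dist_parent v h

/-- The root is its own parent, so iterating past it agrees with truncated subtraction. -/
lemma level_iterate (v : V) (k : ℕ) : N.level (N.parent^[k] v) = N.level v - k := by
  induction k with
  | zero => simp
  | succ k ih =>
    rw [Function.iterate_succ_apply']
    by_cases h : N.parent^[k] v = N.root
    · rw [h] at ih ⊢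
      rw [N.parent_root, N.level_root] at *
      omega
    · have := N.level_parent h
      omega

lemma iterate_level (v : V) : N.parent^[N.level v] v = N.root := by
  rw [← N.level_eq_zero, level_iterate, Nat.sub_self]

lemma IsAncestor.refl (v : V) : N.IsAncestor v v := ⟨0, rfl⟩

variable {N}

lemma IsAncestor.trans {u v w : V} (h : N.IsAncestor u v) (h' : N.IsAncestor v w) :
    N.IsAncestor u w := by
  obtain ⟨k, rfl⟩ := h
  obtain ⟨l, rfl⟩ := h'
  exact ⟨k + l, by rw [Function.iterate_add_apply]⟩

lemma IsAncestor.level_le {u v : V} (h : N.IsAncestor u v) : N.level u ≤ N.level v := by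
  obtain ⟨k, rfl⟩ := h
  rw [level_iterate]; omega

/-- The number of steps in `IsAncestor` is not unique when `u` is the root; the difference of levels
is a canonical choice, and overshooting changes nothing. -/
lemma IsAncestor.iterate_eq {u v : V} (h : N.IsAncestor u v) :
    N.parent^[N.level v - N.level u] v = u := by
  obtain ⟨k, rfl⟩ := h
  rw [level_iterate]
  rcases le_total k (N.level v) with hk | hk
  · congr 1; omega
  · have : N.level v - (N.level v - k) = N.level v := by omega
    rw [this, iterate_level]
    symm
    rw [← N.level_eq_zero, level_iterate]; omega

lemma IsAncestor.eq_of_level {u v : V} (h : N.IsAncestor u v) (h' : N.level u = N.level v) :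
    u = v := by
  have := h.iterate_eq
  rw [h', Nat.sub_self] at this
  exact this.symm

lemma IsAncestor.total {u v w : V} (h : N.IsAncestor u w) (h' : N.IsAncestor v w) :
    N.IsAncestor u v ∨ N.IsAncestor v u := by
  obtain ⟨k, rfl⟩ := h
  obtain ⟨l, rfl⟩ := h'
  rcases le_total k l with hk | hk
  · right; exact ⟨l - k, by rw [← Function.iterate_add_apply]; congr 1; omega⟩
  · left; exact ⟨k - l, by rw [← Function.iterate_add_apply]; congr 1; omega⟩

lemma root_isAncestor (v : V) : N.IsAncestor N.root v := ⟨_, N.iterate_level v⟩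

lemma mem_rootPath {u v : V} : u ∈ N.rootPath v ↔ N.IsAncestor u v := by
  simp only [rootPath, List.mem_reverse, List.mem_map, List.mem_range]
  constructor
  · rintro ⟨k, -, rfl⟩; exact ⟨k, rfl⟩
  · intro h
    exact ⟨_, by change _ < N.level v + 1; omega, h.iterate_eq⟩

lemma length_rootPath (v : V) : (N.rootPath v).length = N.level v + 1 := by
  simp [rootPath, level]

lemma reverse_rootPath (v : V) :
    (N.rootPath v).reverse = v :: (List.range (N.level v)).map fun k => N.parent^[k + 1] v := by
  rw [rootPath, List.reverse_reverse, List.range_succ_eq_map]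
  simp [level, Function.comp_def]

lemma rootPath_eq_append (v : V) : N.rootPath v = (N.rootPath v).dropLast ++ [v] := by
  have h := congrArg List.reverse (N.reverse_rootPath v)
  rw [List.reverse_reverse, List.reverse_cons] at h
  rw [h, List.dropLast_concat]

lemma mem_dropLast_rootPath {u v : V} :
    u ∈ (N.rootPath v).dropLast ↔ N.IsAncestor u v ∧ u ≠ v := by
  have h := congrArg List.reverse (N.reverse_rootPath v)
  rw [List.reverse_reverse, List.reverse_cons] at h
  rw [h, List.dropLast_concat]
  simp only [List.mem_reverse, List.mem_map, List.mem_range]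
  constructor
  · rintro ⟨k, hk, rfl⟩
    refine ⟨⟨_, rfl⟩, fun he => ?_⟩
    have := N.level_iterate v (k + 1)
    rw [he] at this; omega
  · rintro ⟨ha, hne⟩
    have hl := ha.level_le
    have : N.level u ≠ N.level v := fun he => hne (ha.eq_of_level he)
    refine ⟨N.level v - N.level u - 1, by omega, ?_⟩
    conv_rhs => rw [← ha.iterate_eq]
    congr 1; omega

lemma reverse_rootPath_getElem_one {v : V} (h : v ≠ N.root) :
    (N.rootPath v).reverse[1]? = some (N.parent v) := by
  rw [reverse_rootPath]
  have := N.level_parent h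
  simp only [List.getElem?_cons_succ, List.getElem?_map]
  rw [List.getElem?_range (by omega)]; rfl

lemma IsChild.adj {v c : V} (h : N.IsChild v c) : N.graph.Adj v c := by
  have := N.parent_adj c h.1
  rwa [h.2] at this

lemma IsChild.level {v c : V} (h : N.IsChild v c) : N.level c = N.level v + 1 := by
  rw [N.level_parent h.1, h.2]

lemma IsChild.isAncestor {v c : V} (h : N.IsChild v c) : N.IsAncestor v c := ⟨1, h.2⟩

lemma IsChild.ne {v c : V} (h : N.IsChild v c) : c ≠ v := fun e => by
  have := h.level; rw [e] at this; omega

lemma isAncestor_iff_parent {u v : V} (hv : v ≠ N.root) :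
    N.IsAncestor u v ↔ u = v ∨ N.IsAncestor u (N.parent v) := by
  constructor
  · rintro ⟨k, hk⟩
    cases k with
    | zero => left; exact hk.symm
    | succ k => right; exact ⟨k, by rwa [Function.iterate_succ_apply] at hk⟩
  · rintro (rfl | h)
    · exact IsAncestor.refl N _
    · exact h.trans ⟨1, rfl⟩

lemma isAncestor_root {u : V} (h : N.IsAncestor u N.root) : u = N.root := by
  rw [← N.level_eq_zero]
  have := h.level_le
  rw [N.level_root] at this; omega

lemma IsChild.mem_below {v c : V} (h : N.IsChild v c) : c ∈ N.below v :=
  ⟨h.isAncestor, h.ne⟩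

lemma ne_root_of_mem_below {a v : V} (h : v ∈ N.below a) : v ≠ N.root := by
  rintro rfl
  exact h.2 (isAncestor_root h.1).symm

lemma parent_of_mem_below {a v : V} (h : v ∈ N.below a) :
    N.parent v = a ∨ N.parent v ∈ N.below a := by
  rcases (isAncestor_iff_parent (ne_root_of_mem_below h)).1 h.1 with h' | h'
  · exact absurd h'.symm h.2
  · by_cases e : N.parent v = a
    · exact Or.inl e
    · exact Or.inr ⟨h', e⟩

lemma isChild_parent {v : V} (h : v ≠ N.root) : N.IsChild (N.parent v) v := ⟨h, rfl⟩

lemma exists_child_of_isAncestor {a v : V} (h : N.IsAncestor a v) :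
    v = a ∨ ∃ c, N.IsChild a c ∧ N.IsAncestor c v := by
  obtain ⟨k, rfl⟩ := h
  induction k with
  | zero => exact Or.inl rfl
  | succ k ih =>
    rcases ih with h | ⟨c, hc, h⟩
    · rw [Function.iterate_succ_apply', ← h]
      by_cases hv : v = N.root
      · left; rw [hv, N.parent_root]
      · right; exact ⟨v, isChild_parent hv, IsAncestor.refl N v⟩
    · rw [Function.iterate_succ_apply']
      by_cases hv : N.parent^[k] v = N.root
      · rw [hv, N.parent_root]
        right; rw [hv] at hc; exact ⟨c, hc, h⟩
      · right; exact ⟨_, isChild_parent hv, ⟨k, rfl⟩⟩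

lemma mem_subtree_iff {a v : V} :
    v ∈ N.subtree a ↔ v = a ∨ ∃ c, N.IsChild a c ∧ v ∈ N.subtree c := by
  constructor
  · exact exists_child_of_isAncestor
  · rintro (rfl | ⟨c, hc, h⟩)
    · exact IsAncestor.refl N _
    · exact hc.isAncestor.trans h

lemma mem_below_iff {a v : V} : v ∈ N.below a ↔ ∃ c, N.IsChild a c ∧ v ∈ N.subtree c := by
  constructor
  · rintro ⟨h, hne⟩
    exact (mem_subtree_iff.1 h).resolve_left hne
  · rintro ⟨c, hc, h⟩
    refine ⟨hc.isAncestor.trans h, fun e => ?_⟩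
    have h1 := IsAncestor.level_le h
    have h2 := hc.level
    have e' : v = a := e
    rw [e'] at h1; omega

lemma child_unique {a c c' v : V} (hc : N.IsChild a c) (hc' : N.IsChild a c')
    (h : N.IsAncestor c v) (h' : N.IsAncestor c' v) : c = c' := by
  have := h.iterate_eq
  rw [hc.level, ← hc'.level, h'.iterate_eq] at this
  exact this.symm

/-! ### Components of the subtrees -/

lemma mem_comp_self {a v : V} (h : v ∈ N.below a) : v ∈ N.comp a v := ⟨h, h, .refl _⟩

lemma comp_subset_below {a v w : V} (h : w ∈ N.comp a v) : w ∈ N.below a := h.2.1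

lemma mem_comp_symm {a v w : V} (h : w ∈ N.comp a v) : v ∈ N.comp a w := by
  obtain ⟨hv, hw, h⟩ := h
  exact ⟨hw, hv, h.symm⟩

lemma mem_comp_trans {a u v w : V} (h : v ∈ N.comp a u) (h' : w ∈ N.comp a v) :
    w ∈ N.comp a u := by
  obtain ⟨hv, hw, h⟩ := h
  obtain ⟨hv', hw', h'⟩ := h'
  exact ⟨hv, hw', h.trans h'⟩

lemma comp_eq {a v w : V} (h : w ∈ N.comp a v) : N.comp a w = N.comp a v := by
  ext u
  exact ⟨mem_comp_trans h, mem_comp_trans (mem_comp_symm h)⟩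

lemma mem_comp_of_adj {a v w : V} (hv : v ∈ N.below a) (hw : w ∈ N.below a)
    (h : N.graph.Adj v w) : w ∈ N.comp a v :=
  ⟨hv, hw, SimpleGraph.Adj.reachable (by exact h)⟩

/-- The tree path from `v` down to `w` moves away from `a`, so all of it lies strictly below `a`.
Components are thus unions of whole child subtrees. -/
lemma mem_comp_of_isAncestor {a v w : V} (hv : v ∈ N.below a) (h : N.IsAncestor v w) :
    w ∈ N.comp a v := by
  obtain ⟨k, hk⟩ := h
  induction k generalizing w with
  | zero => obtain rfl : w = v := hk; exact mem_comp_self hv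
  | succ k ih =>
    rw [Function.iterate_succ_apply] at hk
    have h1 := ih hk
    by_cases hw : w = N.root
    · rw [hw, N.parent_root] at h1; rwa [hw]
    · have hwb : w ∈ N.below a := by
        have hp := isChild_parent hw
        refine ⟨IsAncestor.trans (comp_subset_below h1).1 hp.isAncestor, ?_⟩
        rintro rfl
        have := IsAncestor.level_le (comp_subset_below h1).1
        rw [hp.level] at this; omega
      exact mem_comp_trans h1 (mem_comp_of_adj (comp_subset_below h1) hwb (N.parent_adj w hw))

lemma exists_child_comp {a v : V} (h : v ∈ N.below a) :
    ∃ c, N.IsChild a c ∧ N.IsAncestor c v ∧ v ∈ N.comp a c := by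
  obtain ⟨c, hc, h⟩ := mem_below_iff.1 h
  exact ⟨c, hc, h, mem_comp_of_isAncestor hc.mem_below h⟩

/-! ### Component-IDs, and the depth against the diameter. -/

section Fintype

variable [Fintype V]

/-- Every component contains the child of `a` above any of its vertices, so the maximum is attained
at an actual child. This is why component-IDs separate components, both below one vertex and below
different vertices. -/
lemma exists_compID {a v : V} (h : v ∈ N.below a) :
    ∃ c, N.IsChild a c ∧ c ∈ N.comp a v ∧ N.compID a v = N.ident c := by
  classical
  obtain ⟨c, hc, -, hv⟩ := exists_child_comp h
  have hne : (Finset.univ.filter fun c => N.IsChild a c ∧ c ∈ N.comp a v).Nonempty :=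
    ⟨c, by simp [hc, mem_comp_symm hv]⟩
  obtain ⟨d, hd, h⟩ := Finset.exists_mem_eq_sup _ hne N.ident
  simp only [Finset.mem_filter, Finset.mem_univ, true_and] at hd
  refine ⟨d, hd.1, hd.2, ?_⟩
  rw [← h, compID]

lemma compID_congr {a v w : V} (h : w ∈ N.comp a v) : N.compID a w = N.compID a v := by
  have e := comp_eq h
  unfold compID
  rw [e]

lemma compID_eq_iff {a v w : V} (hv : v ∈ N.below a) (hw : w ∈ N.below a) :
    N.compID a v = N.compID a w ↔ w ∈ N.comp a v := by
  refine ⟨fun h => ?_, fun h => (compID_congr h).symm⟩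
  obtain ⟨c, -, hc, h1⟩ := exists_compID hv
  obtain ⟨d, -, hd, h2⟩ := exists_compID hw
  rw [h1, h2] at h
  rw [← N.ident_injective h] at hd
  exact mem_comp_trans hc (mem_comp_symm hd)

/-- A common value would be the ID of a single vertex with two different parents. -/
lemma compID_ne {a b v w : V} (hab : a ≠ b) (hv : v ∈ N.below a) (hw : w ∈ N.below b) :
    N.compID a v ≠ N.compID b w := by
  intro h
  obtain ⟨c, hc, -, h1⟩ := exists_compID hv
  obtain ⟨d, hd, -, h2⟩ := exists_compID hw
  rw [h1, h2] at h
  have := N.ident_injective h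
  subst this
  exact hab (hc.2.symm.trans hd.2)

lemma compID_lt {a v : V} {B : ℕ} (hB : ∀ v, N.ident v < B) (h : v ∈ N.below a) :
    N.compID a v < B := by
  obtain ⟨c, -, -, h1⟩ := exists_compID h
  rw [h1]; exact hB c

lemma level_le_depth (v : V) : N.level v ≤ N.depth := by
  unfold depth
  exact Finset.le_sup (f := fun v => N.graph.dist N.root v) (Finset.mem_univ v)

lemma dist_le_diam (u v : V) : N.graph.dist u v ≤ N.graph.diam := by
  classical
  have : Nonempty V := ⟨u⟩
  refine SimpleGraph.dist_le_diam ?_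
  exact SimpleGraph.connected_iff_ediam_ne_top.1 N.connected

lemma depth_le_diam : N.depth ≤ N.graph.diam :=
  Finset.sup_le fun v _ => dist_le_diam _ v

/-- Any two vertices are joined through the root. The vertices know the depth but not the diameter,
so the schedule has to rest on this bound. -/
lemma diam_le_depth : N.graph.diam ≤ 2 * N.depth := by
  classical
  have : Nonempty V := ⟨N.root⟩
  obtain ⟨u, v, h⟩ := N.graph.exists_dist_eq_diam
  have h1 := N.connected.dist_triangle (u := u) (v := N.root) (w := v)
  have h2 := level_le_depth (N := N) u
  have h3 := level_le_depth (N := N) v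
  rw [level] at h2 h3
  rw [SimpleGraph.dist_comm] at h2
  omega

end Fintype

/-! ### Independent pairs -/

lemma Independent.symm {x y : V} (h : N.Independent x y) : N.Independent y x := ⟨h.2, h.1⟩

lemma Independent.ne {x y : V} (h : N.Independent x y) : x ≠ y := by
  rintro rfl; exact h.1 (IsAncestor.refl N _)

lemma Independent.ne_root {x y : V} (h : N.Independent x y) : x ≠ N.root := by
  rintro rfl; exact h.1 (root_isAncestor y)

lemma Independent.disjoint {x y v : V} (h : N.Independent x y) (hx : N.IsAncestor x v)
    (hy : N.IsAncestor y v) : False := by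
  rcases hx.total hy with h' | h'
  · exact h.1 h'
  · exact h.2 h'

end RootedNetwork

/-! ### Recognizing light vertices -/

namespace HeavyLight

variable {V : Type*} [Fintype V] {N : RootedNetwork V} (H : HeavyLight N)

lemma ext_injective : Function.Injective H.ext := fun _ _ h =>
  N.ident_injective (congrArg ExtID.id h)

/-- The last compression step either opens a new entry for a light `v` or increments a counter,
which cannot leave a count of `0`. So an extended ID alone reveals whether its vertex is heavy. -/
lemma getLast_compressed (v : V) :
    (H.compressed v).getLast? = some (N.ident v, 0) ↔ ¬ H.IsHeavy v := by
  classical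
  rw [compressed, N.rootPath_eq_append, List.foldl_append, List.getLast?_reverse]
  simp only [List.foldl_cons, List.foldl_nil]
  rw [compressStep.eq_def]
  split_ifs with h
  · simp only [h, not_true, iff_false]
    generalize List.foldl H.compressStep [] (N.rootPath v).dropLast = l
    cases l <;> simp
  · simp [h]

lemma isHeavy_iff {a c : V} (h : N.IsChild a c) : H.IsHeavy c ↔ c = H.heavyChild a := by
  rw [IsHeavy, h.2]
  exact ⟨fun h => h.2.symm, fun e => ⟨h.1, e.symm⟩⟩

end HeavyLight

end CutPair

namespace CutPair

/-! ### Merging labelled classes of a graph in Borůvka phases -/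

section Boruvka

open Filter

variable {V F : Type*} [CompleteLinearOrder F]

/-- The eventual representative of `L` under iteration of `f`: the least element that the orbit of
`L` visits infinitely often. -/
noncomputable def eventualRep (f : F → F) (L : F) : F :=
  sInf {M | ∃ᶠ i in atTop, f^[i] L = M}

/-- Otherwise each of the finitely many values would be avoided from some index on, hence all of
them simultaneously. Choosing the least recurrent value spares any analysis of pointer cycles. -/
lemma exists_iterate_eq_eventualRep [Finite F] (f : F → F) (L : F) :
    ∃ i, f^[i] L = eventualRep f L := by
  have hne : {M | ∃ᶠ i in atTop, f^[i] L = M}.Nonempty := by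
    by_contra h
    rw [Set.not_nonempty_iff_eq_empty] at h
    have h' : ∀ M, ∀ᶠ i in atTop, f^[i] L ≠ M := fun M => by
      have : M ∉ {M | ∃ᶠ i in atTop, f^[i] L = M} := by rw [h]; exact Set.notMem_empty _
      simpa [Filter.not_frequently] using this
    obtain ⟨i, hi⟩ := (eventually_all.2 h').exists
    exact hi _ rfl
  have := hne.csInf_mem (Set.toFinite _)
  exact (this : ∃ᶠ i in atTop, f^[i] L = _).exists

lemma eventualRep_apply (f : F → F) (L : F) : eventualRep f (f L) = eventualRep f L := by
  unfold eventualRep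
  congr 1
  ext M
  simp only [Set.mem_ofPred_eq, ← Function.iterate_succ_apply, frequently_atTop]
  constructor
  · intro h a
    obtain ⟨b, hb, h⟩ := h a
    exact ⟨b + 1, by omega, h⟩
  · intro h a
    obtain ⟨b, hb, h⟩ := h (a + 1)
    obtain ⟨b, rfl⟩ : ∃ c, b = c + 1 := ⟨b - 1, by omega⟩
    exact ⟨b, by omega, h⟩

lemma eventualRep_of_fixed [Finite F] {f : F → F} {L : F} (h : f L = L) :
    eventualRep f L = L := by
  obtain ⟨i, hi⟩ := exists_iterate_eq_eventualRep f L
  rw [← hi, Function.iterate_fixed h]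

/-- An end of the path knows the pointer map only on part of the labels; as that part is closed
under the map, the orbits and their representatives are still the right ones. -/
lemma eventualRep_congr {f f' : F → F} {D : Set F} (hf : ∀ L ∈ D, f L = f' L)
    (hD : ∀ L ∈ D, f L ∈ D) {L : F} (hL : L ∈ D) : eventualRep f L = eventualRep f' L := by
  have key : ∀ i, f^[i] L ∈ D ∧ f'^[i] L = f^[i] L := by
    intro i
    induction i with
    | zero => exact ⟨hL, rfl⟩
    | succ i ih =>
      rw [Function.iterate_succ_apply', Function.iterate_succ_apply', ih.2]
      exact ⟨hD _ ih.1, (hf _ ih.1).symm⟩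
  simp only [eventualRep, fun i => (key i).2]

variable (G : SimpleGraph V)

/-- The least label, other than `L`, of a neighbour of the class of `L`. -/
noncomputable def minOther (l : V → F) (L : F) : F :=
  sInf {M | ∃ v w, G.Adj v w ∧ l v = L ∧ l w = M ∧ M ≠ L}

open Classical in
/-- The label to which the class of `L` is merged next; special labels stay. -/
noncomputable def pointer (Sp : Set F) (l : V → F) (L : F) : F :=
  if L ∈ Sp then L else if minOther G l L = ⊤ then L else minOther G l L

/-- The relabelling of the initial labels `l` after `t` Borůvka phases. -/
noncomputable def merge (Sp : Set F) (l : V → F) : ℕ → F → F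
  | 0 => id
  | t + 1 => eventualRep (pointer G Sp (merge Sp l t ∘ l)) ∘ merge Sp l t

/-- The subgraph of the edges whose endpoints have the same label. -/
def sameLabel (l : V → F) : SimpleGraph V where
  Adj v w := G.Adj v w ∧ l v = l w
  symm := ⟨fun _ _ h => ⟨h.1.symm, h.2.symm⟩⟩
  loopless := ⟨fun _ h => h.1.ne rfl⟩

lemma sameLabel_le (l : V → F) : sameLabel G l ≤ G := fun _ _ h => h.1

lemma sameLabel_mono (l : V → F) (g : F → F) : sameLabel G l ≤ sameLabel G (g ∘ l) :=
  fun _ _ h => ⟨h.1, congrArg g h.2⟩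

variable {G} {Sp : Set F} {l : V → F}

lemma label_eq_of_reachable {v w : V} (h : (sameLabel G l).Reachable v w) : l v = l w := by
  obtain ⟨p⟩ := h
  induction p with
  | nil => rfl
  | cons h _ ih => exact h.2.trans ih

lemma minOther_le {v w : V} (h : G.Adj v w) (hne : l w ≠ l v) : minOther G l (l v) ≤ l w :=
  sInf_le ⟨v, w, h, rfl, rfl, hne⟩

lemma exists_minOther [Finite F] {L : F} (h : minOther G l L ≠ ⊤) :
    ∃ v w, G.Adj v w ∧ l v = L ∧ l w = minOther G l L ∧ minOther G l L ≠ L := by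
  refine Set.Nonempty.csInf_mem (s := {M | ∃ v w, G.Adj v w ∧ l v = L ∧ l w = M ∧ M ≠ L})
    ?_ (Set.toFinite _)
  rw [Set.nonempty_iff_ne_empty]
  intro he
  exact h (by rw [minOther, he, sInf_empty])

lemma pointer_special {L : F} (h : L ∈ Sp) : pointer G Sp l L = L := by simp [pointer, h]

/-- A pointer that moves is realised by an edge, because the infimum of a nonempty finite set of
labels is attained. -/
lemma exists_pointer [Finite F] {L : F} (h : pointer G Sp l L ≠ L) :
    ∃ v w, G.Adj v w ∧ l v = L ∧ l w = pointer G Sp l L := by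
  unfold pointer at h ⊢
  split_ifs at h ⊢ with h1 h2
  · exact absurd rfl h
  · exact absurd rfl h
  · obtain ⟨v, w, h3, h4, h5, -⟩ := exists_minOther h2
    exact ⟨v, w, h3, h4, h5⟩

lemma pointer_ne {v w : V} (h : G.Adj v w) (hne : l w ≠ l v) (hSp : l v ∉ Sp) (hw : l w ≠ ⊤)
    [Finite F] : pointer G Sp l (l v) ≠ l v := by
  have h1 : minOther G l (l v) ≠ ⊤ := fun e => by
    have := minOther_le (l := l) h hne
    rw [e, top_le_iff] at this
    exact hw this
  obtain ⟨_, _, -, -, -, h2⟩ := exists_minOther h1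
  simp only [pointer, hSp, h1, if_false]
  exact h2

/-- The invariants of the Borůvka phases. -/
structure Labelling (G : SimpleGraph V) (Sp : Set F) (l : V → F) (t : ℕ) : Prop where
  top_mem : ⊤ ∈ Sp
  isolated : ∀ v w, G.Adj v w → l v ≠ ⊤
  connected : ∀ v w, l v = l w → l v ≠ ⊤ → (sameLabel G l).Reachable v w
  large : ∀ v, l v ∉ Sp →
    (∀ w, G.Reachable v w → l w = l v) ∨ 2 ^ t ≤ {w | l w = l v}.ncard

lemma exists_boundary_adj {v w : V} (h : G.Reachable v w) {A : Set V} (hv : v ∈ A) (hw : w ∉ A) :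
    ∃ a b, G.Reachable v a ∧ G.Adj a b ∧ a ∈ A ∧ b ∉ A := by
  obtain ⟨p⟩ := h
  induction p with
  | nil => exact absurd hv hw
  | @cons u u' w h p ih =>
    by_cases hu : u' ∈ A
    · obtain ⟨a, b, h1, h2⟩ := ih hu hw
      exact ⟨a, b, h.reachable.trans h1, h2⟩
    · exact ⟨u, u', .refl _, h, hv, hu⟩

/-- Each pointer jump crosses one edge after a walk inside the old class. All labels of an orbit
have the same representative, so the whole route stays inside the merged class. -/
lemma Labelling.exists_iterate [Finite F] {t : ℕ} (h : Labelling G Sp l t) (v : V) (hv : l v ≠ ⊤)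
    (i : ℕ) : ∃ w, l w = (pointer G Sp l)^[i] (l v) ∧ l w ≠ ⊤ ∧
      (sameLabel G (eventualRep (pointer G Sp l) ∘ l)).Reachable v w := by
  induction i with
  | zero => exact ⟨v, rfl, hv, .refl _⟩
  | succ i ih =>
    obtain ⟨w, h1, h2, h3⟩ := ih
    rw [Function.iterate_succ_apply', ← h1]
    by_cases hp : pointer G Sp l (l w) = l w
    · exact ⟨w, hp.symm, h2, h3⟩
    · obtain ⟨a, b, hab, ha, hb⟩ := exists_pointer hp
      refine ⟨b, hb, h.isolated b a hab.symm, h3.trans ?_⟩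
      have h4 := (h.connected w a ha.symm h2).mono
        (sameLabel_mono G l (eventualRep (pointer G Sp l)))
      refine h4.trans (SimpleGraph.Adj.reachable ⟨hab, ?_⟩)
      simp only [Function.comp_apply]
      rw [ha, hb, eventualRep_apply]

lemma Labelling.step_ne_top [Finite F] {t : ℕ} (h : Labelling G Sp l t) {v : V} (hv : l v ≠ ⊤) :
    eventualRep (pointer G Sp l) (l v) ≠ ⊤ := by
  obtain ⟨i, hi⟩ := exists_iterate_eq_eventualRep (pointer G Sp l) (l v)
  obtain ⟨w, h1, h2, -⟩ := h.exists_iterate v hv i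
  rw [← hi, ← h1]; exact h2

/-- Two vertices with equal representatives can both be routed to a class carrying that label, which
gives connectedness. For the size, a class with an outgoing edge points to another class; if the
result is not special, neither of the two is special nor isolated, so each has at least `2 ^ t`
vertices. -/
lemma Labelling.step [Finite V] [Finite F] {t : ℕ} (h : Labelling G Sp l t) :
    Labelling G Sp (eventualRep (pointer G Sp l) ∘ l) (t + 1) := by
  set f := pointer G Sp l with hf
  have hspec : ∀ L ∈ Sp, eventualRep f L = L := fun L hL =>
    eventualRep_of_fixed (pointer_special hL)
  have htop : ∀ v, l v ≠ ⊤ → eventualRep f (l v) ≠ ⊤ := fun v => h.step_ne_top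
  have htop' : ∀ v, eventualRep f (l v) ≠ ⊤ → l v ≠ ⊤ := by
    intro v hv e
    exact hv (by rw [e, hspec ⊤ h.top_mem])
  refine ⟨h.top_mem, fun v w hvw => htop v (h.isolated v w hvw), ?_, ?_⟩
  · intro v w hvw hv
    simp only [Function.comp_apply] at hvw hv
    have hw : eventualRep f (l w) ≠ ⊤ := hvw ▸ hv
    obtain ⟨i, hi⟩ := exists_iterate_eq_eventualRep f (l v)
    obtain ⟨j, hj⟩ := exists_iterate_eq_eventualRep f (l w)
    obtain ⟨v', h1, h2, h3⟩ := h.exists_iterate v (htop' v hv) i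
    obtain ⟨w', h4, h5, h6⟩ := h.exists_iterate w (htop' w hw) j
    have h7 : l v' = l w' := by rw [h1, h4, hi, hj, hvw]
    exact h3.trans (((h.connected _ _ h7 h2).mono (sameLabel_mono G l _)).trans h6.symm)
  · intro v hv
    simp only [Function.comp_apply] at hv ⊢
    have hlv : l v ∉ Sp := fun hs => hv (by rw [hspec _ hs]; exact hs)
    by_cases hA : ∀ w, G.Reachable v w → l w = l v
    · left; intro w hw; rw [hA w hw]
    right
    push Not at hA
    obtain ⟨w, hw, hne⟩ := hA
    obtain ⟨a, b, -, hab, ha, hb⟩ := exists_boundary_adj (A := {u | l u = l v}) hw rfl hne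
    simp only [Set.mem_ofPred_eq] at ha hb
    have hp : f (l v) ≠ l v := by
      rw [← ha]
      exact pointer_ne hab (by rwa [ha]) (by rwa [ha]) (h.isolated b a hab.symm)
    obtain ⟨a', b', hab', ha', hb'⟩ := exists_pointer hp
    have hb'' : l b' = f (l v) := hb'
    have hrep : eventualRep f (l b') = eventualRep f (l v) := by rw [hb'', eventualRep_apply]
    -- Special labels are fixed points, so a special target would make the merged label special.
    have hbs : l b' ∉ Sp := fun hs => hv (by rw [← hrep, hspec _ hs]; exact hs)
    have c1 : 2 ^ t ≤ {w | l w = l v}.ncard := by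
      refine (h.large v hlv).resolve_left fun hc => ?_
      exact hne (hc w hw)
    have c2 : 2 ^ t ≤ {w | l w = l b'}.ncard := by
      refine (h.large b' hbs).resolve_left fun hc => ?_
      have := hc a' hab'.symm.reachable
      rw [ha', hb''] at this
      exact hp this.symm
    have hdisj : Disjoint {w | l w = l v} {w | l w = l b'} := by
      rw [Set.disjoint_left]
      intro u hu hu'
      simp only [Set.mem_ofPred_eq] at hu hu'
      exact hp (by rw [← hb'', ← hu', hu])
    calc 2 ^ (t + 1) ≤ {w | l w = l v}.ncard + {w | l w = l b'}.ncard := by rw [pow_succ]; omega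
      _ = ({w | l w = l v} ∪ {w | l w = l b'}).ncard := (Set.ncard_union_eq hdisj).symm
      _ ≤ _ := by
        refine Set.ncard_le_ncard ?_ (Set.toFinite _)
        rintro u (hu | hu) <;> simp only [Set.mem_ofPred_eq] at hu ⊢ <;> rw [hu]
        exact hrep

lemma Labelling.merge [Finite V] [Finite F] (h : Labelling G Sp l 0) (t : ℕ) :
    Labelling G Sp (merge G Sp l t ∘ l) t := by
  induction t with
  | zero => exact h
  | succ t ih => exact ih.step

lemma Labelling.merge_ne_top [Finite V] [Finite F] (h : Labelling G Sp l 0) (t : ℕ) {v : V}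
    (hv : l v ≠ ⊤) : CutPair.merge G Sp l t (l v) ≠ ⊤ := by
  induction t with
  | zero => exact hv
  | succ t ih => exact (h.merge t).step_ne_top ih

lemma merge_special [Finite F] {L : F} (h : L ∈ Sp) (t : ℕ) : merge G Sp l t L = L := by
  induction t with
  | zero => rfl
  | succ t ih =>
    simp only [CutPair.merge, Function.comp_apply]
    rw [ih, eventualRep_of_fixed (pointer_special h)]

/-- The edges that leave the vertex set `A`. -/
def Leaves (G : SimpleGraph V) (A : Set V) : Prop := ∃ v w, G.Adj v w ∧ v ∈ A ∧ w ∉ A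

/-- Connectivity after the last phase: the vertices not labelled `⊤` are mutually reachable iff
only special labels are left and no union of special classes is isolated. -/
lemma Labelling.reachable_iff [Finite V] [Finite F] {t : ℕ} (h : Labelling G Sp l t)
    (hV : Nat.card V ≤ 2 ^ t) (hV' : ∃ v, l v = ⊤) {o L₁ L₂ : F} (ho : o ∈ Sp) (ho' : o ≠ ⊤)
    (hSp : ∀ L ∈ Sp, L = o ∨ L = ⊤ ∨ L = L₁ ∨ L = L₂)
    (h1' : L₁ ≠ ⊤) (h2' : L₂ ≠ ⊤)
    {r : V} (hr : l r = o) (e1 : ∃ v, l v = L₁) (e2 : ∃ v, l v = L₂) :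
    (∀ v, l v ≠ ⊤ → G.Reachable r v) ↔
      (∀ v, l v ∈ Sp) ∧ (L₁ ≠ o → Leaves G {v | l v = L₁}) ∧ (L₂ ≠ o → Leaves G {v | l v = L₂}) ∧
        (L₁ ≠ o → L₂ ≠ o → Leaves G {v | l v = L₁ ∨ l v = L₂}) := by
  constructor
  · intro hc
    have key : ∀ A : Set V, r ∉ A → (∃ v ∈ A, l v ≠ ⊤) → Leaves G A := by
      rintro A hA ⟨v, hv, hv'⟩
      obtain ⟨a, b, -, hab, ha, hb⟩ := exists_boundary_adj (hc v hv').symm hv hA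
      exact ⟨a, b, hab, ha, hb⟩
    refine ⟨fun v => ?_, fun hne => ?_, fun hne => ?_, fun hne hne' => ?_⟩
    · by_contra hv
      rcases h.large v hv with hc' | hc'
      · have hvt : l v ≠ ⊤ := fun e => hv (e ▸ h.top_mem)
        have := hc' r (hc v hvt).symm
        rw [hr] at this
        exact hv (this ▸ ho)
      · obtain ⟨u, hu⟩ := hV'
        have : {w | l w = l v} ⊂ Set.univ := by
          refine Set.ssubset_univ_iff.2 fun e => ?_
          have : u ∈ {w | l w = l v} := by rw [e]; trivial
          exact hv (by rw [← (this : l u = l v), hu]; exact h.top_mem)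
        have := Set.ncard_lt_ncard this
        rw [Set.ncard_univ] at this
        omega
    · obtain ⟨v, hv⟩ := e1
      exact key _ (fun e => hne ((e : l r = _).symm.trans hr)) ⟨v, hv, hv ▸ h1'⟩
    · obtain ⟨v, hv⟩ := e2
      exact key _ (fun e => hne ((e : l r = _).symm.trans hr)) ⟨v, hv, hv ▸ h2'⟩
    · obtain ⟨v, hv⟩ := e1
      refine key _ ?_ ⟨v, Or.inl hv, hv ▸ h1'⟩
      rintro (e | e)
      · exact hne (e.symm.trans hr)
      · exact hne' (e.symm.trans hr)
  · rintro ⟨hall, c1, c2, c12⟩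
    have hR : ∀ v, l v = o → G.Reachable r v := fun v hv =>
      (h.connected r v (hr.trans hv.symm) (hr ▸ ho')).mono (sameLabel_le G l)
    have cls : ∀ v w, l v = l w → l v ≠ ⊤ → G.Reachable r v → G.Reachable r w :=
      fun v w hvw hv hrv => hrv.trans ((h.connected v w hvw hv).mono (sameLabel_le G l))
    have lab : ∀ v, l v ≠ ⊤ → l v = o ∨ l v = L₁ ∨ l v = L₂ := fun v hv => by
      rcases hSp _ (hall v) with e | e | e | e
      · exact Or.inl e
      · exact absurd e hv
      · exact Or.inr (Or.inl e)
      · exact Or.inr (Or.inr e)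
    -- The class of `M` touches that of `o` directly, or it touches that of `M'`. In the latter case
    -- an edge leaving the union must end in the class of `o`. Stated for both orders of the two
    -- labels.
    have main : ∀ (M M' : F), (M ≠ o → Leaves G {v | l v = M}) →
        (M ≠ o → M' ≠ o → Leaves G {v | l v = M ∨ l v = M'}) →
        (M' ≠ o → Leaves G {v | l v = M'}) → (∀ v, l v ≠ ⊤ → l v = o ∨ l v = M ∨ l v = M') →
        ∀ v, l v = M → M ≠ ⊤ → M' ≠ ⊤ → G.Reachable r v := by
      intro M M' c1 c12 c2 lab v hv hM hM'
      by_cases hMo : M = o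
      · exact hR v (hv.trans hMo)
      obtain ⟨a, b, hab, ha, hb⟩ := c1 hMo
      have ha' : l a = M := ha
      have fin : ∀ a b, G.Adj a b → l a = M → G.Reachable r b → G.Reachable r v :=
        fun a b hab ha hb => cls a v (ha.trans hv.symm) (ha ▸ hM) (hb.trans hab.symm.reachable)
      rcases lab b (h.isolated b a hab.symm) with e | e | e
      · exact fin a b hab ha (hR b e)
      · exact absurd e hb
      · by_cases hMo' : M' = o
        · exact fin a b hab ha (hR b (e.trans hMo'))
        obtain ⟨a', b', hab', ha', hb'⟩ := c12 hMo hMo'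
        have hob : l b' = o := (lab b' (h.isolated b' a' hab'.symm)).resolve_right hb'
        rcases ha' with ha' | ha'
        · exact fin a' b' hab' ha' (hR b' hob)
        · refine fin a b hab ha (cls a' b (ha'.trans e.symm) (ha' ▸ hM') ?_)
          exact (hR b' hob).trans hab'.symm.reachable
    intro v hv
    rcases lab v hv with e | e | e
    · exact hR v e
    · exact main L₁ L₂ c1 c12 c2 lab v e h1' h2'
    · refine main L₂ L₁ c2 (fun a b => ?_) c1 (fun v hv => ?_) v e h2' h1'
      · have := c12 b a
        simpa only [or_comm] using this
      · rcases lab v hv with e | e | e <;> simp [e]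

end Boruvka

end CutPair

namespace CutPair

/-! ### Algorithms with typed messages -/

section Typed

/-- An algorithm given by its sending function: what is sent to the neighbour of a given ID depends
on the input, the time and the messages received so far (indexed by time and sender). -/
noncomputable def ofSend {I M : Type} (enc : M → List Bool)
    (snd : I → ℕ → (ℕ → ℕ → Option M) → ℕ → Option M)
    (out : I → (ℕ → ℕ → Option M) → Option Bool) : Algorithm I where
  coinLen := 0
  State := I × ℕ × (ℕ → ℕ → Option M)
  init i _ := (i, 0, fun _ _ => none)
  send st j := (snd st.1 st.2.1 st.2.2 j).map enc
  receive st ib := (st.1, st.2.1 + 1, Function.update st.2.2 st.2.1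
    fun j => (ib j).bind (Function.partialInv enc))
  output st := out st.1 st.2.2

variable {V : Type*} (N : RootedNetwork V)

open Classical in
/-- The messages with contents `μ t u v` that have reached `v` before time `t`. -/
noncomputable def received {M : Type} (μ : ℕ → V → V → Option M) (t : ℕ) (v : V) (i j : ℕ) :
    Option M :=
  if i < t then
    if h : ∃ w, N.graph.Adj w v ∧ N.ident w = j then μ i h.choose v else none
  else none

variable {N}

lemma received_ident {M : Type} (μ : ℕ → V → V → Option M) {t i : ℕ} (hi : i < t) {v w : V}
    (h : N.graph.Adj w v) : received N μ t v i (N.ident w) = μ i w v := by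
  have hex : ∃ w', N.graph.Adj w' v ∧ N.ident w' = N.ident w := ⟨w, h, rfl⟩
  simp only [received, hi, if_true, hex, dif_pos]
  rw [N.ident_injective hex.choose_spec.2]

variable {I M : Type} {enc : M → List Bool} {snd : I → ℕ → (ℕ → ℕ → Option M) → ℕ → Option M}
  {out : I → (ℕ → ℕ → Option M) → Option Bool}

/-- If the contents `μ` are consistent with the sending function, then they are what is sent. -/
lemma stateAt_ofSend (henc : Function.Injective enc) (inp : V → I)
    (coins : V → Fin (ofSend enc snd out).coinLen → Bool) (μ : ℕ → V → V → Option M)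
    (h : ∀ t u v, N.graph.Adj u v →
      snd (inp u) t (received N μ t u) (N.ident v) = μ t u v) (t : ℕ) (v : V) :
    (ofSend enc snd out).stateAt N inp coins t v = (inp v, t, received N μ t v) := by
  induction t generalizing v with
  | zero =>
    simp only [Algorithm.stateAt, ofSend]
    congr 2
  | succ t ih =>
    simp only [Algorithm.stateAt]
    have hs : (ofSend enc snd out).stateAt N inp coins t =
        fun v => (inp v, t, received N μ t v) := funext ih
    rw [hs]
    change (inp v, t + 1, Function.update (received N μ t v) t _) = _
    congr 2
    funext i j
    by_cases hi : i = t
    · subst hi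
      rw [Function.update_self]
      unfold Algorithm.inbox received
      simp only [Nat.lt_succ_self, if_true]
      split_ifs with hex
      · change Option.bind (Option.map enc (snd (inp hex.choose) i (received N μ i hex.choose)
          (N.ident v))) _ = _
        rw [h i _ v hex.choose_spec.1]
        cases μ i hex.choose v with
        | none => rfl
        | some m => simp [Function.partialInv_left henc]
      · rfl
    · rw [Function.update_of_ne hi]
      unfold received
      have : i < t + 1 ↔ i < t := by omega
      simp only [this]

lemma message_ofSend (henc : Function.Injective enc) (inp : V → I)
    (coins : V → Fin (ofSend enc snd out).coinLen → Bool) (μ : ℕ → V → V → Option M)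
    (h : ∀ t u v, N.graph.Adj u v →
      snd (inp u) t (received N μ t u) (N.ident v) = μ t u v) (t : ℕ) {u v : V}
    (huv : N.graph.Adj u v) :
    (ofSend enc snd out).message N inp coins t u v = (μ t u v).map enc := by
  unfold Algorithm.message
  rw [stateAt_ofSend henc inp coins μ h]
  change Option.map enc (snd (inp u) t (received N μ t u) (N.ident v)) = _
  rw [h t u v huv]

lemma exists_encoding (M : Type) [Fintype M] {k : ℕ} (h : Fintype.card M ≤ 2 ^ k) :
    ∃ enc : M → List Bool, Function.Injective enc ∧ ∀ m, (enc m).length = k := by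
  classical
  have : Nonempty (M ↪ (Fin k → Bool)) := by
    rw [Function.Embedding.nonempty_iff_card_le]
    simpa using h
  obtain ⟨e⟩ := this
  exact ⟨fun m => List.ofFn (e m), fun a b hab => e.injective (List.ofFn_injective hab), by simp⟩

end Typed

end CutPair

namespace CutPair

/-! ### The algorithm -/

/-- Labels: `0` for the vertices connected to the root, the last value for removed vertices, and
the values between for component-IDs. -/
abbrev Label (B : ℕ) : Type := Fin (B + 2)

/-- The label of a component-ID, or the encoding of an ID, below `B`. -/
def lab (B k : ℕ) : Label B := ⟨min (k + 1) B, by omega⟩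

/-- The shift by one in `lab` reserves `0`, and the cap at `B` reserves `⊤`; below `B` the cap has
no effect. -/
lemma lab_inj {B k l : ℕ} (hk : k < B) (hl : l < B) (h : lab B k = lab B l) : k = l := by
  have := congrArg Fin.val h
  simp only [lab] at this
  omega

lemma lab_ne_zero {B k : ℕ} (hk : k < B) : lab B k ≠ 0 := by
  intro h
  have := congrArg Fin.val h
  simp [lab] at this
  omega

lemma lab_ne_top (B k : ℕ) : lab B k ≠ ⊤ := by
  intro h
  have := congrArg Fin.val h
  simp [lab, Fin.top_eq_last] at this
  omega

lemma zero_ne_top (B : ℕ) : (0 : Label B) ≠ ⊤ := by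
  intro h
  have := congrArg Fin.val h
  simp [Fin.top_eq_last] at this

/-- Messages: seven labels and two sketches, not all of them in use. -/
abbrev Msg (B m : ℕ) : Type := (Fin 7 → Label B) × (Fin 2 → Fin m → ZMod 2)

namespace Msg

variable {B m : ℕ} (d : Msg B m)

/-- The ID of the sending end `x` or `y` in a downward message. -/
def hubID : Label B := d.1 0
/-- The ID of the other end. -/
def otherID : Label B := d.1 1
/-- The label of the sensitive heavy component of the sending end. -/
def hubHeavy : Label B := d.1 2
/-- The label of the sensitive heavy component of the other end. -/
def otherHeavy : Label B := d.1 3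
/-- The current label of the component. -/
def label : Label B := d.1 4
/-- The label whose value the component asks for. -/
def query : Label B := d.1 5
/-- The value of the label of the component. -/
def val : Label B := d.1 6
/-- The pair of minima in an upward message. -/
def pair : Label B × Label B := (d.1 0, d.1 1)

/-- An upward message. -/
def up (m : ℕ) (q : Label B × Label B) : Msg B m := (![q.1, q.2, 0, 0, 0, 0, 0], 0)

@[simp] lemma pair_up (q : Label B × Label B) : (up m q).pair = q := rfl

end Msg

/-- What an end of the given path remembers. -/
structure HubState (B m : ℕ) where
  /-- the current labels of the components, by their initial labels -/
  tab : Label B → Label B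
  query : Label B → Label B
  val : Label B → Label B
  /-- the messages heard from the neighbours -/
  heard : ℕ → Option (Msg B m)
  /-- the last message of the other end -/
  summary : Msg B m

/-! ### The local rules: labels of neighbours, updates at the ends, schedule of a slot. -/

section Local

variable {S : SketchScheme} (B : ℕ) (inp : LocalInput S)

/-- The vertex is an end of the given path. -/
def IsHub : Prop := ∃ ci, inp.channel = some ci ∧ (ci.prev = none ∨ ci.next = none)

open Classical in
noncomputable def otherID : ℕ :=
  (inp.channel.map fun ci => if ci.prev = none then ci.y.id else ci.x.id).getD 0

/-- The neighbour of an end of the given path on this path. -/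
noncomputable def portID : ℕ :=
  ((inp.channel.bind fun ci => ci.prev <|> ci.next).map ExtID.id).getD 0

def levelOf : ℕ := inp.self.treePath.length - 1

def parentID : ℕ := ((inp.self.treePath.reverse[1]?).map ExtID.id).getD 0

def IsChildID (j : ℕ) : Prop := ∃ ci ∈ inp.children, ci.me.id = j

/-- The component of the child is sensitive to the other end. -/
def SensitiveChild (ci : ChildInfo S) : Prop :=
  ∃ l, ci.path = some l ∧ ∃ e ∈ l, e.id = otherID inp

open Classical in
/-- The label of the component of the heavy child if it is sensitive, and `0` otherwise. -/
noncomputable def heavyLabel : Label B :=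
  if h : ∃ ci ∈ inp.children, SensitiveChild inp ci ∧ ci.me.anc.getLast? ≠ some (ci.me.id, 0) then
    lab B h.choose.compID
  else 0

/-- The component of the heavy child is excluded even when sensitive, since sending inside it could
use edges that are not permitted. -/
def ActiveChild (ci : ChildInfo S) : Prop :=
  SensitiveChild inp ci ∧ lab B ci.compID ≠ heavyLabel B inp

variable {B}

open Classical in
/-- The label of a neighbour, according to its public information and what it has sent. -/
noncomputable def neighbourLabel {m : ℕ} (ida idb hla hlb : Label B) (rcv : ℕ → Option (Msg B m))
    (q : PublicInfo) : Label B :=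
  if lab B q.me.id = ida ∨ lab B q.me.id = idb then ⊤
  else ((rcv q.me.id).map Msg.label).getD <|
    if ∃ ai ∈ q.ancestors, (lab B ai.ancestor.id = ida ∨ lab B ai.ancestor.id = idb) ∧
      lab B ai.compID = hla then hla
    else if ∃ ai ∈ q.ancestors, (lab B ai.ancestor.id = ida ∨ lab B ai.ancestor.id = idb) ∧
      lab B ai.compID = hlb then hlb
    else 0

variable (d : Msg B S.len) (st : HubState B S.len) (rcv ups : ℕ → Option (Msg B S.len))

open Classical in
/-- The least label among the neighbours that differs from the own label, and the least value of
a neighbour with the label asked for. -/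
noncomputable def localPair : Label B × Label B :=
  (⨅ q ∈ inp.neighbours,
    let L := neighbourLabel d.hubID d.otherID d.hubHeavy d.otherHeavy rcv q
    if L = d.label then ⊤ else L,
   ⨅ q ∈ inp.neighbours,
    ((rcv q.me.id).map fun m => if m.label = d.query then m.val else ⊤).getD ⊤)

/-- The minimum of the local pairs of a subtree. -/
noncomputable def subtreePair : Label B × Label B :=
  localPair inp d rcv ⊓ ⨅ ci ∈ inp.children, ((ups ci.me.id).map Msg.pair).getD ⊤

/-- The labels that are never merged into others. -/
def specialLabels : Set (Label B) := {0, ⊤, heavyLabel B inp, st.summary.1 0}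

/-- The message to the components with initial label `L`. -/
noncomputable def downMsg (L : Label B) : Msg B S.len :=
  (![lab B inp.self.me.id, lab B (otherID inp), heavyLabel B inp, st.summary.1 0, st.tab L,
    st.query (st.tab L), st.val (st.tab L)], 0)

open Classical in
/-- The part of the sketch of the class `U` that an end of the path can compute. -/
noncomputable def classSketch (U : Label B) : Fin S.len → ZMod 2 :=
  if U = 0 then 0 else
    (∑ᶠ ci ∈ {ci ∈ inp.children | SensitiveChild inp ci ∧ st.tab (lab B ci.compID) = U},
      ci.sketch) +
    ∑ᶠ q ∈ {q ∈ inp.neighbours | neighbourLabel (lab B inp.self.me.id) (lab B (otherID inp))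
      (heavyLabel B inp) (st.summary.1 0) st.heard q = U}, S.edge inp.seed s(inp.self.me, q.me)

open Classical in
/-- The message to the other end. -/
noncomputable def summaryMsg : Msg B S.len :=
  (![heavyLabel B inp,
    if ∃ ci ∈ inp.children, ActiveChild B inp ci ∧
      st.tab (lab B ci.compID) ∉ specialLabels inp st then ⊤ else 0, 0, 0, 0, 0, 0],
    ![classSketch inp st (heavyLabel B inp), classSketch inp st (st.summary.1 0)])

open Classical in
/-- The minimum of the reports on the components whose current label is mapped to `L`. -/
noncomputable def reportInf (π : Label B × Label B → Label B) (g : Label B → Label B)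
    (L : Label B) : Label B :=
  ⨅ ci ∈ inp.children, if ActiveChild B inp ci ∧ g (st.tab (lab B ci.compID)) = L then
    ((ups ci.me.id).map fun m => π m.pair).getD ⊤ else ⊤

open Classical in
/-- The pointers of the classes that contain a component of this end. -/
noncomputable def ownPointer (L : Label B) : Label B :=
  if L ∈ specialLabels inp st then L
  else if st.val L ⊓ reportInf inp st ups Prod.snd id L = ⊤ then L
  else st.val L ⊓ reportInf inp st ups Prod.snd id L

open Classical in
/-- The pointers of the classes that contain a component of this end or are pointed to by such a
class. -/
noncomputable def knownPointer (L : Label B) : Label B :=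
  if L ∈ specialLabels inp st then L
  else if ∃ ci ∈ inp.children, ActiveChild B inp ci ∧ st.tab (lab B ci.compID) = L then st.val L
  else if reportInf inp st ups Prod.snd st.val L = ⊤ then L
  else reportInf inp st ups Prod.snd st.val L

/-- The update after a slot, for `T` phases of three slots each after the first slot. -/
noncomputable def updateHub (T s : ℕ) (msg : Msg B S.len) : HubState B S.len :=
  if 1 ≤ s ∧ s ≤ 3 * T then
    if s % 3 = 1 then
      -- First slot of a phase: the least other label next to the own part of each class. The query
      -- `id` then asks neighbours of the same class for their value.
      ⟨st.tab, id, reportInf inp st ups Prod.fst id, rcv, msg⟩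
    else if s % 3 = 2 then
      -- Second slot: the minima of both sides are combined to pointers. The next query asks the
      -- class pointed to for its own pointer.
      ⟨st.tab, ownPointer inp st ups, ownPointer inp st ups, rcv, msg⟩
    -- Third slot: the pointers of the target classes are known as well, and the labels are merged.
    else ⟨eventualRep (knownPointer inp st ups) ∘ st.tab, st.query, st.val, rcv, msg⟩
  else ⟨st.tab, st.query, st.val, rcv, msg⟩

noncomputable def initialHub (B m : ℕ) : HubState B m := ⟨id, id, id, fun _ => none, 0⟩

/-- The first round of a slot that is used on the given path. -/
def pathRound (D : ℕ) : ℕ := 2 * D + 3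

/-- Rounds `0, …, D` go down, round `D + 1` is the exchange, rounds `D + 2, …, 2 * D + 2` go up. The
remaining `2 * K * D + 1` rounds suffice for the given path, since the diameter is at most `2 * D`.
-/
def slotLength (K D : ℕ) : ℕ := 2 * D + 4 + 2 * K * D

variable (K T : ℕ) (h : ℕ → ℕ → Option (Msg B S.len))

open Classical in
noncomputable def fromChildren (t j : ℕ) : Option (Msg B S.len) :=
  if IsChildID inp j then h t j else none

open Classical in
/-- The message of the other end that arrives in a slot. -/
noncomputable def arrival (s : ℕ) : Msg B S.len :=
  if hm : ∃ m r, pathRound inp.depth ≤ r ∧ r < slotLength K inp.depth ∧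
      h (s * slotLength K inp.depth + r) (portID inp) = some m then hm.choose else 0

/-- The state of an end of the given path at the beginning of a slot. -/
noncomputable def hubState : ℕ → HubState B S.len
  | 0 => initialHub B S.len
  | s + 1 => updateHub inp (hubState s) (h (s * slotLength K inp.depth + (inp.depth + 1)))
      (fromChildren inp h (s * slotLength K inp.depth + (2 * inp.depth + 1 - levelOf inp)))
      T s (arrival inp K h s)

/-- The downward message received in a slot. -/
noncomputable def fromParent (s : ℕ) : Option (Msg B S.len) :=
  if levelOf inp = 0 then none
  else h (s * slotLength K inp.depth + (levelOf inp - 1)) (parentID inp)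

-- The ends originate the downward messages, and every other vertex forwards what its parent sent
-- one round earlier. Components that are not active therefore stay silent.
open Classical in
noncomputable def sendDown (s r j : ℕ) : Option (Msg B S.len) :=
  if r = levelOf inp ∧ IsChildID inp j then
    if IsHub inp then
      if hc : ∃ ci ∈ inp.children, ci.me.id = j ∧ ActiveChild B inp ci then
        some (downMsg inp (hubState inp K T h s) (lab B hc.choose.compID))
      else none
    else fromParent inp K h s
  else none

noncomputable def sendUp (s r j : ℕ) : Option (Msg B S.len) :=
  if r = 2 * inp.depth + 2 - levelOf inp ∧ j = parentID inp then
    (fromParent inp K h s).map fun d => Msg.up S.len (subtreePair inp d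
      (h (s * slotLength K inp.depth + (inp.depth + 1)))
      (fromChildren inp h (s * slotLength K inp.depth + (2 * inp.depth + 1 - levelOf inp))))
  else none

open Classical in
noncomputable def sendAlong (s r j : ℕ) : Option (Msg B S.len) :=
  if IsHub inp then
    if r = pathRound inp.depth ∧ j = portID inp then
      some (summaryMsg inp (hubState inp K T h s))
    else none
  -- The round before still belongs to the upward phase, so what arrived then must not be forwarded
  -- along the path.
  else if r = pathRound inp.depth then none
  else inp.channel.bind fun ci => ci.prev.bind fun p => ci.next.bind fun q =>
    if j = q.id then h (s * slotLength K inp.depth + (r - 1)) p.id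
    else if j = p.id then h (s * slotLength K inp.depth + (r - 1)) q.id
    else none

/-- The message sent in round `r` of slot `s`. -/
noncomputable def sendSlot (s r j : ℕ) : Option (Msg B S.len) :=
  if r ≤ inp.depth then sendDown inp K T h s r j
  else if r = inp.depth + 1 then fromParent inp K h s
  else if r < pathRound inp.depth then sendUp inp K h s r j
  else sendAlong inp K T h s r j

noncomputable def sendMsg (t j : ℕ) : Option (Msg B S.len) :=
  sendSlot inp K T h (t / slotLength K inp.depth) (t % slotLength K inp.depth) j

open Classical in
/-- The decision at the end. -/
noncomputable def decision (mine theirs : Msg B S.len) : Bool :=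
  decide (mine.1 1 = 0 ∧ theirs.1 1 = 0 ∧
    (mine.1 0 ≠ 0 → mine.2 0 + theirs.2 1 ≠ 0) ∧
    (theirs.1 0 ≠ 0 → mine.2 1 + theirs.2 0 ≠ 0) ∧
    (mine.1 0 ≠ 0 → theirs.1 0 ≠ 0 → (mine.2 0 + theirs.2 1) + (mine.2 1 + theirs.2 0) ≠ 0))

/-- Slot `0` exchanges the heavy labels, slots `1, …, 3 * T` run the phases, slot `3 * T + 1`
announces the final labels to the neighbours, and slot `3 * T + 2` exchanges the sketches. The own
summary is recomputed from the state in which it was sent. -/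
noncomputable def outputBit : Option Bool :=
  some (decision (summaryMsg inp (hubState inp K T h (3 * T + 2)))
    (hubState inp K T h (3 * T + 3)).summary)

end Local

end CutPair

namespace CutPair

open RootedNetwork

/-! ### Sensitive and active components -/

section Sensitive

variable {V : Type*} [Fintype V] {N : RootedNetwork V} (B : ℕ) (H : HeavyLight N)
  (C : ConnectivityTrees N)

/-- `v` lies in a `b`-sensitive component of `G[V_a]`. -/
def Sensitive (a b v : V) : Prop := v ∈ N.below a ∧ b ∈ C.path a v

open Classical in
/-- The label of the component of the heavy child of `a` if it is `b`-sensitive. -/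
noncomputable def heavyCompLabel (a b : V) : Label B :=
  if N.IsChild a (H.heavyChild a) ∧ b ∈ C.path a (H.heavyChild a) then
    lab B (N.compID a (H.heavyChild a)) else 0

/-- `v` lies in a `b`-sensitive component of `G[V_a]` without the heavy child of `a`. -/
def Active (a b v : V) : Prop :=
  Sensitive C a b v ∧ lab B (N.compID a v) ≠ heavyCompLabel B H C a b

variable {B H C}

lemma path_congr {a v w : V} (h : w ∈ N.comp a v) : C.path a w = C.path a v := by
  unfold ConnectivityTrees.path
  rw [C.out_congr a v w h, C.inn_congr a v w h]

lemma Sensitive.congr {a b v w : V} (h : Sensitive C a b v) (hw : w ∈ N.comp a v) :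
    Sensitive C a b w :=
  ⟨comp_subset_below hw, by rw [path_congr hw]; exact h.2⟩

lemma Active.congr {a b v w : V} (h : Active B H C a b v) (hw : w ∈ N.comp a v) :
    Active B H C a b w :=
  ⟨h.1.congr hw, by rw [compID_congr hw]; exact h.2⟩

/-- If the child of `a` above `v` were the heavy one, the component of `v` would carry the heavy
label. So the path to `v` leaves `a` through a light edge. -/
lemma Active.mem_LDS {a b v : V} (h : Active B H C a b v) : v ∈ LDS H C a b := by
  obtain ⟨c, hc, hcv, hv⟩ := exists_child_comp h.1.1
  refine ⟨⟨c, hc, ?_, hcv⟩, h.1.2⟩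
  rintro rfl
  apply h.2
  rw [heavyCompLabel, if_pos ⟨hc, by rw [← path_congr hv]; exact h.1.2⟩, compID_congr hv]

end Sensitive

/-! ### Reading the initial knowledge -/

section Reading

variable {V : Type*} [Fintype V] {N : RootedNetwork V} {B : ℕ} {H : HeavyLight N}
  {C : ConnectivityTrees N} {S : SketchScheme} {seed : Fin S.seedLen → Bool} {x y : V}
  {p : N.graph.Walk x y}

lemma depth_localInput (v : V) : (localInput H C S seed p v).depth = N.depth := rfl

lemma levelOf_localInput (v : V) : levelOf (localInput H C S seed p v) = N.level v := by
  simp [levelOf, localInput, publicInfo, length_rootPath]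

lemma parentID_localInput {v : V} (h : v ≠ N.root) :
    parentID (localInput H C S seed p v) = N.ident (N.parent v) := by
  simp only [parentID, localInput, publicInfo, ← List.map_reverse, List.getElem?_map,
    reverse_rootPath_getElem_one h]
  rfl

lemma exists_mem_children {v : V} {Q : ChildInfo S → Prop} :
    (∃ ci ∈ (localInput H C S seed p v).children, Q ci) ↔
      ∃ c, N.IsChild v c ∧ Q (childInfo H C S seed v c) := by
  simp [localInput]

lemma isChildID_localInput {v : V} {j : ℕ} :
    IsChildID (localInput H C S seed p v) j ↔ ∃ c, N.IsChild v c ∧ N.ident c = j :=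
  exists_mem_children

lemma isChildID_ident {v w : V} :
    IsChildID (localInput H C S seed p v) (N.ident w) ↔ N.IsChild v w := by
  rw [isChildID_localInput]
  constructor
  · rintro ⟨c, hc, h⟩; rwa [← N.ident_injective h]
  · exact fun h => ⟨w, h, rfl⟩

lemma channel_getVert (hp : p.IsPath) {i : ℕ} (hi : i ≤ p.length) :
    (localInput H C S seed p (p.getVert i)).channel =
      some ⟨H.ext x, H.ext y, if i = 0 then none else some (H.ext (p.getVert (i - 1))),
        if i = p.length then none else some (H.ext (p.getVert (i + 1)))⟩ := by
  classical
  have hidx : p.support.idxOf (p.getVert i) = i := by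
    have hlt : i < p.support.length := by simp; omega
    have : p.getVert i = p.support[i] := by
      rw [SimpleGraph.Walk.support_getElem_eq_getVert]
    rw [this]
    exact hp.support_nodup.idxOf_getElem i hlt
  simp only [localInput, channelInfo, SimpleGraph.Walk.getVert_mem_support, if_true]
  have : @List.idxOf V (@instBEqOfDecidableEq V fun a b => Classical.propDecidable (a = b))
      (p.getVert i) p.support = i := by
    convert hidx
  rw [this]

lemma channel_of_notMem {v : V} (h : v ∉ p.support) :
    (localInput H C S seed p v).channel = none := by
  simp [localInput, channelInfo, h]

lemma exists_getVert {v : V} (h : v ∈ p.support) : ∃ i ≤ p.length, p.getVert i = v := by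
  obtain ⟨i, h1, h2⟩ := SimpleGraph.Walk.mem_support_iff_exists_getVert.1 h
  exact ⟨i, h2, h1⟩

/-- `a` and `b` are the two ends of the path in some order. -/
def Ends (x y a b : V) : Prop := (a = x ∧ b = y) ∨ (a = y ∧ b = x)

lemma Ends.symm {x y a b : V} (h : Ends x y a b) : Ends x y b a := by
  rcases h with ⟨rfl, rfl⟩ | ⟨rfl, rfl⟩
  · exact Or.inr ⟨rfl, rfl⟩
  · exact Or.inl ⟨rfl, rfl⟩

lemma Ends.independent {x y a b : V} (h : Ends x y a b) (hxy : N.Independent x y) :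
    N.Independent a b := by
  rcases h with ⟨rfl, rfl⟩ | ⟨rfl, rfl⟩
  exacts [hxy, hxy.symm]

lemma isHub_localInput (hp : p.IsPath) {v : V} :
    IsHub (localInput H C S seed p v) ↔ v = x ∨ v = y := by
  constructor
  · rintro ⟨ci, h, h'⟩
    by_cases hv : v ∈ p.support
    · obtain ⟨i, hi, rfl⟩ := exists_getVert hv
      rw [channel_getVert hp hi] at h
      obtain rfl := Option.some.inj h
      rcases h' with h' | h'
      · left
        have : i = 0 := by by_contra h0; simp [h0] at h'
        rw [this]; simp
      · right
        have : i = p.length := by by_contra h0; simp [h0] at h'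
        rw [this]; simp
    · rw [channel_of_notMem hv] at h
      exact absurd h (by simp)
  · rintro (rfl | rfl)
    · have := channel_getVert (H := H) (C := C) (S := S) (seed := seed) hp (Nat.zero_le _)
      rw [p.getVert_zero] at this
      exact ⟨_, this, by simp⟩
    · have := channel_getVert (H := H) (C := C) (S := S) (seed := seed) hp le_rfl
      rw [p.getVert_length] at this
      exact ⟨_, this, by simp⟩

lemma length_pos_of_ne (hxy : x ≠ y) : 0 < p.length := by
  rcases Nat.eq_zero_or_pos p.length with h | h
  · exact absurd (SimpleGraph.Walk.eq_of_length_eq_zero h) hxy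
  · exact h

lemma otherID_localInput (hp : p.IsPath) (hxy : x ≠ y) {a b : V} (h : Ends x y a b) :
    otherID (localInput H C S seed p a) = N.ident b := by
  rcases h with ⟨rfl, rfl⟩ | ⟨rfl, rfl⟩
  · have := channel_getVert (H := H) (C := C) (S := S) (seed := seed) hp (Nat.zero_le _)
    rw [p.getVert_zero] at this
    simp [otherID, this, HeavyLight.ext]
  · have := channel_getVert (H := H) (C := C) (S := S) (seed := seed) hp le_rfl
    rw [p.getVert_length] at this
    have h0 := (length_pos_of_ne (p := p) hxy).ne'
    simp [otherID, this, HeavyLight.ext, h0]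

lemma portID_left (hp : p.IsPath) (hxy : x ≠ y) :
    portID (localInput H C S seed p x) = N.ident (p.getVert 1) := by
  have := channel_getVert (H := H) (C := C) (S := S) (seed := seed) hp (Nat.zero_le _)
  rw [p.getVert_zero] at this
  have h0 := (length_pos_of_ne (p := p) hxy).ne
  simp [portID, this, HeavyLight.ext, h0]

lemma portID_right (hp : p.IsPath) (hxy : x ≠ y) :
    portID (localInput H C S seed p y) = N.ident (p.getVert (p.length - 1)) := by
  have := channel_getVert (H := H) (C := C) (S := S) (seed := seed) hp le_rfl
  rw [p.getVert_length] at this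
  have h0 := (length_pos_of_ne (p := p) hxy).ne'
  simp [portID, this, HeavyLight.ext, h0]

lemma sensitiveChild_localInput (hp : p.IsPath) (hxy : N.Independent x y) {a b c : V}
    (h : Ends x y a b) (hc : N.IsChild a c) :
    SensitiveChild (localInput H C S seed p a) (childInfo H C S seed a c) ↔
      Sensitive C a b c := by
  have hr := (h.independent hxy).ne_root
  simp only [SensitiveChild, childInfo, hr, if_false, Option.some.injEq,
    otherID_localInput hp hxy.ne h, Sensitive]
  constructor
  · rintro ⟨l, rfl, e, he, h⟩
    obtain ⟨w, hw, rfl⟩ := List.mem_map.1 he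
    rw [← N.ident_injective h]
    exact ⟨hc.mem_below, hw⟩
  · rintro ⟨-, hb⟩
    exact ⟨_, rfl, _, List.mem_map_of_mem hb, rfl⟩

/-- Only one child of `a` is heavy, so the choice among the children's records is forced. -/
lemma heavyLabel_localInput (hp : p.IsPath) (hxy : N.Independent x y) {a b : V}
    (h : Ends x y a b) :
    heavyLabel B (localInput H C S seed p a) = heavyCompLabel B H C a b := by
  classical
  have key : ∀ c, N.IsChild a c →
      ((childInfo H C S seed a c).me.anc.getLast? ≠ some ((childInfo H C S seed a c).me.id, 0) ↔
        c = H.heavyChild a) := by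
    intro c hc
    rw [← H.isHeavy_iff hc, ← not_iff_not, not_not]
    exact H.getLast_compressed c
  unfold heavyLabel
  by_cases hh : N.IsChild a (H.heavyChild a) ∧ b ∈ C.path a (H.heavyChild a)
  · have hex : ∃ ci ∈ (localInput H C S seed p a).children,
        SensitiveChild (localInput H C S seed p a) ci ∧
          ci.me.anc.getLast? ≠ some (ci.me.id, 0) := by
      rw [exists_mem_children]
      exact ⟨_, hh.1, (sensitiveChild_localInput hp hxy h hh.1).2 ⟨hh.1.mem_below, hh.2⟩,
        (key _ hh.1).2 rfl⟩
    rw [dif_pos hex]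
    obtain ⟨⟨c, hc, hc'⟩, h2, h3⟩ := hex.choose_spec
    rw [← hc'] at h3 ⊢
    have := (key c hc).1 h3
    subst this
    rw [heavyCompLabel, if_pos hh]
    rfl
  · rw [dif_neg, heavyCompLabel, if_neg hh]
    rw [exists_mem_children]
    rintro ⟨c, hc, h2, h3⟩
    obtain rfl := (key c hc).1 h3
    exact hh ⟨hc, ((sensitiveChild_localInput hp hxy h hc).1 h2).2⟩

lemma activeChild_localInput (hp : p.IsPath) (hxy : N.Independent x y) {a b c : V}
    (h : Ends x y a b) (hc : N.IsChild a c) :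
    ActiveChild B (localInput H C S seed p a) (childInfo H C S seed a c) ↔
      Active B H C a b c := by
  unfold ActiveChild Active
  rw [sensitiveChild_localInput hp hxy h hc, heavyLabel_localInput hp hxy h]
  rfl

end Reading

end CutPair

namespace CutPair

open RootedNetwork

/-! ### The messages of an execution -/

/-- The data of an execution of the algorithm. -/
structure Setting (V : Type*) [Fintype V] (S : SketchScheme) (B K T : ℕ) where
  N : RootedNetwork V
  H : HeavyLight N
  C : ConnectivityTrees N
  seed : Fin S.seedLen → Bool
  x : V
  y : V
  ind : N.Independent x y
  p : N.graph.Walk x y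
  isPath : p.IsPath
  ident_lt : ∀ v, N.ident v < B
  length_le : p.length ≤ 2 * K * N.depth

namespace Setting

variable {V : Type*} [Fintype V] {S : SketchScheme} {B K T : ℕ} (I : Setting V S B K T)

noncomputable def inp (v : V) : LocalInput S := localInput I.H I.C S I.seed I.p v

/-- `v` takes part in the communication within the trees. -/
def Act (v : V) : Prop := Active B I.H I.C I.x I.y v ∨ Active B I.H I.C I.y I.x v

open Classical in
noncomputable def other (a : V) : V := if a = I.x then I.y else I.x

variable (st : V → HubState B S.len)

open Classical in
/-- The downward message of the component of `v`. -/
noncomputable def down (v : V) : Msg B S.len :=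
  if Active B I.H I.C I.x I.y v then downMsg (I.inp I.x) (st I.x) (lab B (I.N.compID I.x v))
  else downMsg (I.inp I.y) (st I.y) (lab B (I.N.compID I.y v))

open Classical in
noncomputable def down? (v : V) : Option (Msg B S.len) := if I.Act v then some (I.down st v) else none

open Classical in
/-- What `v` hears from its neighbours in the exchange round. -/
noncomputable def exchange (v : V) (j : ℕ) : Option (Msg B S.len) :=
  if h : ∃ w, I.N.graph.Adj w v ∧ I.N.ident w = j then I.down? st h.choose else none

noncomputable def locals (v : V) : Label B × Label B :=
  localPair (I.inp v) (I.down st v) (I.exchange st v)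

noncomputable def aggregate (v : V) : Label B × Label B := ⨅ w ∈ I.N.subtree v, I.locals st w

open Classical in
noncomputable def up? (v : V) : Option (Msg B S.len) :=
  if I.Act v then some (Msg.up S.len (I.aggregate st v)) else none

open Classical in
noncomputable def ups (a : V) (j : ℕ) : Option (Msg B S.len) :=
  if h : ∃ c, I.N.IsChild a c ∧ I.N.ident c = j then I.up? st h.choose else none

/-- The effect of slot `s` on the states of the ends of the path. -/
noncomputable def step (s : ℕ) (a : V) : HubState B S.len :=
  updateHub (I.inp a) (st a) (I.exchange st a) (I.ups st a) T s
    (summaryMsg (I.inp (I.other a)) (st (I.other a)))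

/-- The states of the ends of the path at the beginning of each slot. -/
noncomputable def hub : ℕ → V → HubState B S.len
  | 0 => fun _ => initialHub B S.len
  | s + 1 => I.step (hub s) s

open Classical in
/-- The message from `u` to `v` along the given path, `i` rounds after the first such message of
the slot. -/
noncomputable def along (i : ℕ) (u v : V) : Option (Msg B S.len) :=
  if i < I.p.length ∧ u = I.p.getVert i ∧ v = I.p.getVert (i + 1) then
    some (summaryMsg (I.inp I.x) (st I.x))
  else if i < I.p.length ∧ u = I.p.getVert (I.p.length - i) ∧
      v = I.p.getVert (I.p.length - i - 1) then
    some (summaryMsg (I.inp I.y) (st I.y))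
  else none

open Classical in
/-- The message from `u` to `v` in round `r` of a slot. -/
noncomputable def slot (r : ℕ) (u v : V) : Option (Msg B S.len) :=
  if r ≤ I.N.depth then if r = I.N.level u ∧ I.N.IsChild u v then I.down? st v else none
  else if r = I.N.depth + 1 then I.down? st u
  else if r < pathRound I.N.depth then
    if r = 2 * I.N.depth + 2 - I.N.level u ∧ v = I.N.parent u then I.up? st u else none
  else I.along st (r - pathRound I.N.depth) u v

/-- The message from `u` to `v` at time `t`. -/
noncomputable def content (t : ℕ) (u v : V) : Option (Msg B S.len) :=
  I.slot (I.hub (t / slotLength K I.N.depth)) (t % slotLength K I.N.depth) u v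

open Classical in
noncomputable def inbox (r : ℕ) (v : V) (j : ℕ) : Option (Msg B S.len) :=
  if h : ∃ w, I.N.graph.Adj w v ∧ I.N.ident w = j then I.slot st r h.choose v else none

/-! ### The globally defined contents obey the local program. -/

variable {I}

lemma other_eq {a b : V} (h : Ends I.x I.y a b) : I.other a = b := by
  rcases h with ⟨rfl, rfl⟩ | ⟨rfl, rfl⟩
  · simp [other]
  · simp [other, I.ind.ne.symm]

lemma slotLength_eq : slotLength K I.N.depth = pathRound I.N.depth + 1 + 2 * K * I.N.depth := by
  simp only [slotLength, pathRound]

lemma received_content {t s r : ℕ} (hr : r < slotLength K I.N.depth)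
    (ht : s * slotLength K I.N.depth + r < t) (v : V) :
    received I.N I.content t v (s * slotLength K I.N.depth + r) = I.inbox (I.hub s) r v := by
  funext j
  have hd : (s * slotLength K I.N.depth + r) / slotLength K I.N.depth = s := by
    rw [mul_comm, Nat.mul_add_div (by omega), Nat.div_eq_of_lt hr, add_zero]
  have hm : (s * slotLength K I.N.depth + r) % slotLength K I.N.depth = r := by
    rw [mul_comm, Nat.mul_add_mod, Nat.mod_eq_of_lt hr]
  unfold received inbox content
  rw [if_pos ht]
  simp only [hd, hm]
  congr

lemma inbox_ident {r : ℕ} {v w : V} (h : I.N.graph.Adj w v) :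
    I.inbox st r v (I.N.ident w) = I.slot st r w v := by
  have hex : ∃ w', I.N.graph.Adj w' v ∧ I.N.ident w' = I.N.ident w := ⟨w, h, rfl⟩
  rw [inbox, dif_pos hex, I.N.ident_injective hex.choose_spec.2]

lemma exchange_ident {v w : V} (h : I.N.graph.Adj w v) :
    I.exchange st v (I.N.ident w) = I.down? st w := by
  have hex : ∃ w', I.N.graph.Adj w' v ∧ I.N.ident w' = I.N.ident w := ⟨w, h, rfl⟩
  rw [exchange, dif_pos hex, I.N.ident_injective hex.choose_spec.2]

lemma ups_ident {a c : V} (h : I.N.IsChild a c) : I.ups st a (I.N.ident c) = I.up? st c := by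
  have hex : ∃ w', I.N.IsChild a w' ∧ I.N.ident w' = I.N.ident c := ⟨c, h, rfl⟩
  rw [ups, dif_pos hex, I.N.ident_injective hex.choose_spec.2]

lemma act_iff {a b : V} (h : Ends I.x I.y a b) (v : V) :
    I.Act v ↔ Active B I.H I.C a b v ∨ Active B I.H I.C b a v := by
  rcases h with ⟨rfl, rfl⟩ | ⟨rfl, rfl⟩
  exacts [Iff.rfl, or_comm]

lemma not_active_of_isAncestor {a b v : V} (h : Ends I.x I.y a b) (hv : I.N.IsAncestor b v) :
    ¬ Active B I.H I.C a b v := fun ha =>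
  (h.independent I.ind).disjoint ha.1.1.1 hv

lemma down_eq {a b v : V} (h : Ends I.x I.y a b) (hv : Active B I.H I.C a b v) :
    I.down st v = downMsg (I.inp a) (st a) (lab B (I.N.compID a v)) := by
  rcases h with ⟨rfl, rfl⟩ | ⟨rfl, rfl⟩
  · rw [down, if_pos hv]
  · rw [down, if_neg (not_active_of_isAncestor (Or.inl ⟨rfl, rfl⟩) hv.1.1.1)]

lemma down?_eq {a b v : V} (h : Ends I.x I.y a b) (hv : Active B I.H I.C a b v) :
    I.down? st v = some (downMsg (I.inp a) (st a) (lab B (I.N.compID a v))) := by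
  rw [down?, if_pos ((act_iff h v).2 (Or.inl hv)), down_eq st h hv]

lemma Act.ends {v : V} (h : I.Act v) : ∃ a b, Ends I.x I.y a b ∧ Active B I.H I.C a b v := by
  rcases h with h | h
  · exact ⟨_, _, Or.inl ⟨rfl, rfl⟩, h⟩
  · exact ⟨_, _, Or.inr ⟨rfl, rfl⟩, h⟩

lemma Act.ne_root {v : V} (h : I.Act v) : v ≠ I.N.root := by
  obtain ⟨a, b, -, h⟩ := h.ends
  exact ne_root_of_mem_below h.1.1

lemma not_act_end {a b : V} (h : Ends I.x I.y a b) : ¬ I.Act a := by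
  rw [act_iff h]
  rintro (h' | h')
  · exact h'.1.1.2 rfl
  · exact (h.independent I.ind).2 h'.1.1.1

/-- Away from the two ends a tree edge never leaves a component. Hence forwarding to all children
reaches exactly the active components, and all children of an active vertex report back. -/
lemma act_congr {u v : V} (h : I.N.IsChild u v) (hx : u ≠ I.x) (hy : u ≠ I.y) :
    I.Act u ↔ I.Act v := by
  have key : ∀ a b, u ≠ a → (Active B I.H I.C a b u ↔ Active B I.H I.C a b v) := by
    intro a b ha
    constructor
    · intro h'
      exact h'.congr (mem_comp_of_isAncestor h'.1.1 h.isAncestor)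
    · intro h'
      have hu : u ∈ I.N.below a := by
        have := parent_of_mem_below h'.1.1
        rw [h.2] at this
        exact this.resolve_left ha
      exact h'.congr (mem_comp_symm (mem_comp_of_isAncestor hu h.isAncestor))
  unfold Act
  rw [key _ _ hx, key _ _ hy]

lemma down?_congr {u v : V} (h : I.N.IsChild u v) (hx : u ≠ I.x) (hy : u ≠ I.y) :
    I.down? st u = I.down? st v := by
  by_cases hu : I.Act u
  · obtain ⟨a, b, hab, hu⟩ := hu.ends
    have hc := mem_comp_of_isAncestor hu.1.1 h.isAncestor
    rw [down?_eq st hab hu, down?_eq st hab (hu.congr hc), compID_congr hc]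
  · have hv := (act_congr h hx hy).not.1 hu
    rw [down?, if_neg hu, down?, if_neg hv]

lemma inbox_exchange (v : V) : I.inbox st (I.N.depth + 1) v = I.exchange st v := by
  funext j
  unfold inbox exchange slot
  simp

lemma inbox_children {v c : V} (h : I.N.IsChild v c) :
    I.inbox st (2 * I.N.depth + 1 - I.N.level v) v (I.N.ident c) = I.up? st c := by
  rw [inbox_ident st h.adj.symm, slot]
  have h1 := h.level
  have h2 := level_le_depth (N := I.N) c
  rw [if_neg (by omega), if_neg (by omega), if_pos (by simp only [pathRound]; omega),
    if_pos ⟨by omega, h.2.symm⟩]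

lemma fromChildren_inbox {t s : ℕ} (v : V)
    (ht : s * slotLength K I.N.depth + (2 * I.N.depth + 1 - I.N.level v) < t) :
    fromChildren (I.inp v) (received I.N I.content t v)
      (s * slotLength K I.N.depth + (2 * I.N.depth + 1 - I.N.level v)) = I.ups (I.hub s) v := by
  funext j
  rw [fromChildren, received_content (by simp only [slotLength]; omega) ht]
  by_cases hj : IsChildID (I.inp v) j
  · rw [if_pos hj]
    obtain ⟨c, hc, rfl⟩ := isChildID_localInput.1 hj
    rw [inbox_children _ hc, ups_ident _ hc]
  · rw [if_neg hj, ups, dif_neg]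
    exact fun h => hj (isChildID_localInput.2 h)

/-- The parent speaks in the round equal to its own level, one before that of `v`. The root hears
nothing, which is right because it is never active. -/
lemma fromParent_content {t s : ℕ} (v : V)
    (ht : s * slotLength K I.N.depth + I.N.level v ≤ t) :
    fromParent (I.inp v) K (received I.N I.content t v) s = I.down? (I.hub s) v := by
  unfold fromParent
  rw [inp, levelOf_localInput]
  by_cases hv : v = I.N.root
  · rw [if_pos (I.N.level_eq_zero.2 hv), down?, if_neg]
    exact fun h => h.ne_root hv
  · have hl := I.N.level_parent hv
    have hd := level_le_depth (N := I.N) v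
    rw [if_neg (by omega), parentID_localInput hv, depth_localInput,
      received_content (by simp only [slotLength]; omega) (by omega),
      inbox_ident _ (isChild_parent hv).adj, slot, if_pos (by omega),
      if_pos ⟨by omega, isChild_parent hv⟩]

lemma along_getVert {i k l : ℕ} (hk : k ≤ I.p.length) (hl : l ≤ I.p.length) :
    I.along st i (I.p.getVert k) (I.p.getVert l) =
      if i < I.p.length ∧ k = i ∧ l = i + 1 then some (summaryMsg (I.inp I.x) (st I.x))
      else if i < I.p.length ∧ k = I.p.length - i ∧ l = I.p.length - i - 1 then
        some (summaryMsg (I.inp I.y) (st I.y))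
      else none := by
  have inj : ∀ {m n}, m ≤ I.p.length → n ≤ I.p.length →
      (I.p.getVert m = I.p.getVert n ↔ m = n) := fun hm hn =>
    ⟨fun h => I.isPath.getVert_injOn hm hn h, fun h => by rw [h]⟩
  unfold along
  congr 1
  · refine propext (and_congr_right fun hi => ?_)
    rw [inj hk (by omega), inj hl (by omega)]
  · congr 1
    refine propext (and_congr_right fun hi => ?_)
    rw [inj hk (by omega), inj hl (by omega)]

lemma length_pos : 0 < I.p.length := length_pos_of_ne I.ind.ne

/-- Within a slot only one message enters an end through its path edge in the rounds reserved for
the path, after `I.p.length - 1` relays. So the message selected by choice is the right one. -/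
lemma arrival_content {t s : ℕ} {a b : V} (h : Ends I.x I.y a b)
    (ht : (s + 1) * slotLength K I.N.depth ≤ t) :
    arrival (I.inp a) K (received I.N I.content t a) s = summaryMsg (I.inp b) (I.hub s b) := by
  have hL := I.slotLength_eq
  have hpos := I.length_pos
  have hle := I.length_le
  have hadd := Nat.succ_mul s (slotLength K I.N.depth)
  have key : ∀ r, pathRound I.N.depth ≤ r → r < slotLength K I.N.depth →
      received I.N I.content t a (s * slotLength K I.N.depth + r) (portID (I.inp a)) =
        if r = pathRound I.N.depth + I.p.length - 1 then
          some (summaryMsg (I.inp b) (I.hub s b)) else none := by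
    intro r hr hr'
    rw [received_content hr' (by rw [Nat.succ_eq_add_one] at hadd; omega)]
    have hslot : ∀ u v, I.slot (I.hub s) r u v =
        I.along (I.hub s) (r - pathRound I.N.depth) u v := by
      intro u v
      have hr0 : 2 * I.N.depth + 3 ≤ r := hr
      unfold slot
      rw [if_neg (by omega), if_neg (by omega), if_neg (by omega)]
    rcases h with ⟨rfl, rfl⟩ | ⟨rfl, rfl⟩
    · have hadj : I.N.graph.Adj (I.p.getVert 1) I.x := by
        have := I.p.adj_getVert_succ hpos
        rw [I.p.getVert_zero] at this
        exact this.symm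
      rw [inp, portID_left I.isPath I.ind.ne, inbox_ident _ hadj, hslot]
      have := along_getVert (I := I) (I.hub s) (i := r - pathRound I.N.depth) (k := 1) (l := 0)
        hpos (Nat.zero_le _)
      rw [I.p.getVert_zero] at this
      rw [this, if_neg (by omega)]
      congr 1
      exact propext ⟨fun h => by omega, fun h => by omega⟩
    · have hadj : I.N.graph.Adj (I.p.getVert (I.p.length - 1)) I.y := by
        have := I.p.adj_getVert_succ (i := I.p.length - 1) (by omega)
        rwa [Nat.sub_add_cancel hpos, I.p.getVert_length] at this
      rw [inp, portID_right I.isPath I.ind.ne, inbox_ident _ hadj, hslot]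
      have := along_getVert (I := I) (I.hub s) (i := r - pathRound I.N.depth)
        (k := I.p.length - 1) (l := I.p.length) (by omega) le_rfl
      rw [I.p.getVert_length] at this
      rw [this]
      by_cases hrr : r = pathRound I.N.depth + I.p.length - 1
      · rw [if_pos (by omega), if_pos hrr]
      · rw [if_neg (by omega), if_neg (by omega), if_neg hrr]
  unfold arrival
  have hex : ∃ m r, pathRound (I.inp a).depth ≤ r ∧ r < slotLength K (I.inp a).depth ∧
      received I.N I.content t a (s * slotLength K (I.inp a).depth + r) (portID (I.inp a)) =
        some m := by
    refine ⟨_, pathRound I.N.depth + I.p.length - 1, ?_, ?_, (key _ (by omega) (by omega)).trans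
      (if_pos rfl)⟩
    · change pathRound I.N.depth ≤ _; omega
    · change _ < slotLength K I.N.depth; omega
  rw [dif_pos hex]
  obtain ⟨r, h1, h2, h3⟩ := hex.choose_spec
  have h4 := (key r h1 h2).symm.trans h3
  split_ifs at h4
  exact (Option.some.inj h4).symm

lemma hubState_content {t s : ℕ} {a b : V} (h : Ends I.x I.y a b)
    (ht : s * slotLength K I.N.depth ≤ t) :
    hubState (I.inp a) K T (received I.N I.content t a) s = I.hub s a := by
  induction s with
  | zero => rfl
  | succ s ih =>
    have hadd := Nat.succ_mul s (slotLength K I.N.depth)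
    rw [Nat.succ_eq_add_one] at hadd
    have hL : slotLength K I.N.depth = 2 * I.N.depth + 4 + 2 * K * I.N.depth := rfl
    rw [hubState, ih (by omega), hub, step, arrival_content h ht, other_eq h]
    have h1 := fromChildren_inbox (I := I) (t := t) (s := s) a (by omega)
    have h2 := received_content (I := I) (t := t) (s := s) (r := I.N.depth + 1) (by omega)
      (by omega) a
    rw [inbox_exchange] at h2
    have h3 : levelOf (I.inp a) = I.N.level a := levelOf_localInput a
    have h4 : (I.inp a).depth = I.N.depth := rfl
    rw [h3, h4, h1, h2]

lemma iInf_children {α : Type*} [CompleteLattice α] (v : V) (f : ChildInfo S → α) :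
    ⨅ ci ∈ (I.inp v).children, f ci =
      ⨅ c, ⨅ _ : I.N.IsChild v c, f (childInfo I.H I.C S I.seed v c) := by
  simp only [inp, localInput, iInf_image]
  rfl

lemma iInf_neighbours {α : Type*} [CompleteLattice α] (v : V) (f : PublicInfo → α) :
    ⨅ q ∈ (I.inp v).neighbours, f q =
      ⨅ w, ⨅ _ : I.N.graph.Adj v w, f (publicInfo I.H I.C w) := by
  simp only [inp, localInput, iInf_image]
  rfl

/-- An active vertex is not an end, so all its children are active and have reported the minima of
their subtrees. -/
lemma subtreePair_eq {v : V} (hv : I.Act v) :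
    subtreePair (I.inp v) (I.down st v) (I.exchange st v) (I.ups st v) = I.aggregate st v := by
  have hx : v ≠ I.x := fun e => not_act_end (I := I) (Or.inl ⟨rfl, rfl⟩) (e ▸ hv)
  have hy : v ≠ I.y := fun e => not_act_end (I := I) (Or.inr ⟨rfl, rfl⟩) (e ▸ hv)
  rw [subtreePair, iInf_children]
  have h1 : ∀ c, I.N.IsChild v c →
      ((I.ups st v (childInfo I.H I.C S I.seed v c).me.id).map Msg.pair).getD ⊤ =
        I.aggregate st c := by
    intro c hc
    change ((I.ups st v (I.N.ident c)).map Msg.pair).getD ⊤ = _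
    rw [ups_ident _ hc, up?, if_pos ((act_congr hc hx hy).1 hv)]
    simp
  change I.locals st v ⊓ _ = _
  apply le_antisymm
  · refine le_iInf₂ fun w hw => ?_
    rcases mem_subtree_iff.1 hw with rfl | ⟨c, hc, hw⟩
    · exact inf_le_left
    · refine inf_le_right.trans ((iInf₂_le c hc).trans ?_)
      rw [h1 c hc]
      exact iInf₂_le w hw
  · refine le_inf (iInf₂_le v (IsAncestor.refl _ v)) (le_iInf₂ fun c hc => ?_)
    rw [h1 c hc]
    exact le_iInf₂ fun w hw => iInf₂_le w (hc.isAncestor.trans hw)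

open Classical in
lemma sendDown_content {t s r : ℕ} (ht : t = s * slotLength K I.N.depth + r) {u v : V} :
    sendDown (I.inp u) K T (received I.N I.content t u) s r (I.N.ident v) =
      if r = I.N.level u ∧ I.N.IsChild u v then I.down? (I.hub s) v else none := by
  unfold sendDown
  have h3 : levelOf (I.inp u) = I.N.level u := levelOf_localInput u
  have h4 : IsChildID (I.inp u) (I.N.ident v) ↔ I.N.IsChild u v := isChildID_ident
  rw [h3, h4]
  by_cases hc : r = I.N.level u ∧ I.N.IsChild u v
  swap
  · rw [if_neg hc, if_neg hc]
  rw [if_pos hc, if_pos hc]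
  have h5 : IsHub (I.inp u) ↔ u = I.x ∨ u = I.y := isHub_localInput I.isPath
  by_cases hu : u = I.x ∨ u = I.y
  · rw [if_pos (h5.2 hu)]
    obtain ⟨b, hub⟩ : ∃ b, Ends I.x I.y u b := by
      rcases hu with h | h
      · exact ⟨_, Or.inl ⟨h, rfl⟩⟩
      · exact ⟨_, Or.inr ⟨h, rfl⟩⟩
    rw [hubState_content hub (by omega)]
    have key : ∀ c, I.N.IsChild u c → (ActiveChild B (I.inp u) (childInfo I.H I.C S I.seed u c) ↔
      Active B I.H I.C u b c) := fun c hc => activeChild_localInput I.isPath I.ind hub hc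
    by_cases hv : Active B I.H I.C u b v
    · have hex : ∃ ci ∈ (I.inp u).children, ci.me.id = I.N.ident v ∧ ActiveChild B (I.inp u) ci :=
        exists_mem_children.2 ⟨v, hc.2, rfl, (key v hc.2).2 hv⟩
      rw [dif_pos hex, down?_eq _ hub hv]
      obtain ⟨⟨c, hc', h6⟩, h7, -⟩ := hex.choose_spec
      rw [← h6] at h7 ⊢
      obtain rfl : c = v := I.N.ident_injective h7
      rfl
    · rw [dif_neg, down?, if_neg]
      · rw [act_iff hub, not_or]
        exact ⟨hv, not_active_of_isAncestor hub.symm hc.2.isAncestor⟩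
      · intro hex
        obtain ⟨c, hc', h6, h7⟩ := exists_mem_children.1 hex
        obtain rfl : c = v := I.N.ident_injective h6
        exact hv ((key c hc').1 h7)
  · rw [if_neg (h5.not.2 hu), fromParent_content _ (by omega)]
    rw [not_or] at hu
    exact down?_congr _ hc.2 hu.1 hu.2

open Classical in
lemma sendUp_content {t s r : ℕ} (ht : t = s * slotLength K I.N.depth + r)
    (hr : I.N.depth + 2 ≤ r) {u v : V} :
    sendUp (I.inp u) K (received I.N I.content t u) s r (I.N.ident v) =
      if r = 2 * I.N.depth + 2 - I.N.level u ∧ v = I.N.parent u then I.up? (I.hub s) u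
      else none := by
  unfold sendUp
  have h3 : levelOf (I.inp u) = I.N.level u := levelOf_localInput u
  have h4 : (I.inp u).depth = I.N.depth := rfl
  rw [h3, h4]
  have hl := level_le_depth (N := I.N) u
  by_cases hr' : r = 2 * I.N.depth + 2 - I.N.level u
  swap
  · rw [if_neg (fun h => hr' h.1), if_neg (fun h => hr' h.1)]
  rw [fromParent_content _ (by omega)]
  by_cases hu : I.Act u
  · have hid : I.N.ident v = parentID (I.inp u) ↔ v = I.N.parent u := by
      rw [inp, parentID_localInput hu.ne_root]
      exact I.N.ident_injective.eq_iff
    have hL : slotLength K I.N.depth = 2 * I.N.depth + 4 + 2 * K * I.N.depth := rfl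
    simp only [hid]
    rw [fromChildren_inbox _ (by omega), received_content (by omega) (by omega),
      inbox_exchange, down?, if_pos hu, Option.map_some, subtreePair_eq _ hu, up?, if_pos hu]
  · rw [down?, if_neg hu, up?, if_neg hu]
    simp

lemma along_of_notMem {i : ℕ} {u v : V} (hu : u ∉ I.p.support) : I.along st i u v = none := by
  unfold along
  rw [if_neg, if_neg]
  · rintro ⟨-, rfl, -⟩; exact hu (I.p.getVert_mem_support _)
  · rintro ⟨-, rfl, -⟩; exact hu (I.p.getVert_mem_support _)

lemma along_eq_none {i k : ℕ} {v : V} (hk : k ≤ I.p.length)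
    (h1 : v ≠ I.p.getVert (k + 1)) (h2 : 0 < k → v ≠ I.p.getVert (k - 1)) :
    I.along st i (I.p.getVert k) v = none := by
  have inj : ∀ {m n}, m ≤ I.p.length → n ≤ I.p.length →
      I.p.getVert m = I.p.getVert n → m = n := fun hm hn h => I.isPath.getVert_injOn hm hn h
  unfold along
  rw [if_neg, if_neg]
  · rintro ⟨hi, h, h'⟩
    have := inj hk (by omega) h
    subst this
    exact h2 (by omega) h'
  · rintro ⟨hi, h, h'⟩
    have := inj hk (by omega) h
    subst this
    exact h1 h'

/-- Two messages run along the path in opposite directions. They may be at the same inner vertex at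
the same time, but they came from different neighbours and leave over different edges. -/
lemma sendAlong_content {t s r : ℕ} (ht : t = s * slotLength K I.N.depth + r)
    (hr : pathRound I.N.depth ≤ r) (hr' : r < slotLength K I.N.depth) {u v : V} :
    sendAlong (I.inp u) K T (received I.N I.content t u) s r (I.N.ident v) =
      I.along (I.hub s) (r - pathRound I.N.depth) u v := by
  have hpos := I.length_pos
  have inj : ∀ {m n}, m ≤ I.p.length → n ≤ I.p.length →
      I.p.getVert m = I.p.getVert n → m = n := fun hm hn h => I.isPath.getVert_injOn hm hn h
  have h4 : (I.inp u).depth = I.N.depth := rfl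
  have h5 : IsHub (I.inp u) ↔ u = I.x ∨ u = I.y := isHub_localInput I.isPath
  have idj : ∀ v w, I.N.ident v = I.N.ident w ↔ v = w := fun v w => I.N.ident_injective.eq_iff
  unfold sendAlong
  rw [h4]
  by_cases hux : u = I.x
  · subst hux
    rw [if_pos (h5.2 (Or.inl rfl)), hubState_content (Or.inl ⟨rfl, rfl⟩) (by omega)]
    have h6 : I.N.ident v = portID (I.inp I.x) ↔ v = I.p.getVert 1 := by
      rw [inp, portID_left I.isPath I.ind.ne, idj]
    by_cases hv : v = I.p.getVert 1
    · have := along_getVert (I := I) (I.hub s) (i := r - pathRound I.N.depth) (k := 0) (l := 1)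
        (Nat.zero_le _) hpos
      rw [I.p.getVert_zero] at this
      by_cases hrr : r = pathRound I.N.depth
      · rw [if_pos ⟨hrr, h6.2 hv⟩, hv, this, if_pos (by omega)]
      · rw [if_neg (fun h => hrr h.1), hv, this, if_neg (by omega), if_neg (by omega)]
    · rw [if_neg (fun h => hv (h6.1 h.2))]
      have := along_eq_none (I := I) (I.hub s) (i := r - pathRound I.N.depth) (Nat.zero_le _) hv
        (by simp)
      rw [I.p.getVert_zero] at this
      exact this.symm
  by_cases huy : u = I.y
  · subst huy
    rw [if_pos (h5.2 (Or.inr rfl)), hubState_content (Or.inr ⟨rfl, rfl⟩) (by omega)]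
    have h6 : I.N.ident v = portID (I.inp I.y) ↔ v = I.p.getVert (I.p.length - 1) := by
      rw [inp, portID_right I.isPath I.ind.ne, idj]
    by_cases hv : v = I.p.getVert (I.p.length - 1)
    · have := along_getVert (I := I) (I.hub s) (i := r - pathRound I.N.depth) (k := I.p.length)
        (l := I.p.length - 1) le_rfl (by omega)
      rw [I.p.getVert_length] at this
      by_cases hrr : r = pathRound I.N.depth
      · rw [if_pos ⟨hrr, h6.2 hv⟩, hv, this, if_neg (by omega), if_pos (by omega)]
      · rw [if_neg (fun h => hrr h.1), hv, this, if_neg (by omega), if_neg (by omega)]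
    · rw [if_neg (fun h => hv (h6.1 h.2))]
      unfold along
      rw [if_neg, if_neg]
      · rintro ⟨hi, h, h'⟩
        have h := inj le_rfl (by omega) ((I.p.getVert_length).trans h)
        apply hv
        rw [h']
        congr 1
        omega
      · rintro ⟨hi, h, -⟩
        have := inj le_rfl hi.le ((I.p.getVert_length).trans h)
        omega
  rw [if_neg (h5.not.2 (by tauto))]
  by_cases hu : u ∈ I.p.support
  swap
  · have : (I.inp u).channel = none := channel_of_notMem hu
    rw [along_of_notMem _ hu, this]
    simp
  obtain ⟨k, hk, rfl⟩ := exists_getVert hu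
  have hk0 : k ≠ 0 := by
    rintro rfl; exact hux I.p.getVert_zero
  have hkl : k ≠ I.p.length := by
    rintro rfl; exact huy I.p.getVert_length
  have hch : (I.inp (I.p.getVert k)).channel = _ := channel_getVert I.isPath hk
  simp only [hch, hk0, hkl, if_false, Option.bind_some, HeavyLight.ext]
  have hadj1 : I.N.graph.Adj (I.p.getVert (k - 1)) (I.p.getVert k) := by
    have := I.p.adj_getVert_succ (i := k - 1) (by omega)
    rwa [Nat.sub_add_cancel (by omega)] at this
  have hadj2 : I.N.graph.Adj (I.p.getVert (k + 1)) (I.p.getVert k) :=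
    (I.p.adj_getVert_succ (i := k) (by omega)).symm
  by_cases hrr : r = pathRound I.N.depth
  · rw [if_pos hrr]
    symm
    unfold along
    rw [if_neg, if_neg]
    · rintro ⟨hi, h, -⟩
      have := inj hk (by omega) h
      omega
    · rintro ⟨hi, h, -⟩
      have := inj hk (by omega) h
      omega
  rw [if_neg hrr]
  have hslot : ∀ u v, I.slot (I.hub s) (r - 1) u v =
      I.along (I.hub s) (r - 1 - pathRound I.N.depth) u v := by
    intro u v
    have hr0 : 2 * I.N.depth + 3 ≤ r := hr
    have hr1 : r ≠ 2 * I.N.depth + 3 := hrr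
    unfold slot
    rw [if_neg (by omega), if_neg (by omega), if_neg (by omega)]
  rw [received_content (by omega) (by omega), inbox_ident _ hadj1, inbox_ident _ hadj2, hslot,
    hslot, along_getVert _ (by omega) hk, along_getVert _ (by omega) hk]
  by_cases hv1 : v = I.p.getVert (k + 1)
  · rw [if_pos ((idj _ _).2 hv1), hv1, along_getVert _ hk (by omega)]
    by_cases hki : k = r - pathRound I.N.depth
    · rw [if_pos (by omega), if_pos (by omega)]
    · rw [if_neg (by omega), if_neg (by omega), if_neg (by omega), if_neg (by omega)]
  · rw [if_neg ((idj _ _).not.2 hv1)]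
    by_cases hv2 : v = I.p.getVert (k - 1)
    · rw [if_pos ((idj _ _).2 hv2), hv2, along_getVert _ hk (by omega), if_neg (by omega)]
      by_cases hki : k = I.p.length - (r - pathRound I.N.depth)
      · rw [if_pos (by omega), if_neg (by omega), if_pos (by omega)]
      · rw [if_neg (by omega), if_neg (by omega), if_neg (by omega)]
    · rw [if_neg ((idj _ _).not.2 hv2), along_eq_none _ hk hv1 fun _ => hv2]

/-- The contents are consistent with the sending function. -/
lemma sendMsg_content (t : ℕ) (u v : V) :
    sendMsg (I.inp u) K T (received I.N I.content t u) t (I.N.ident v) = I.content t u v := by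
  have h4 : (I.inp u).depth = I.N.depth := rfl
  have hL : slotLength K I.N.depth = 2 * I.N.depth + 4 + 2 * K * I.N.depth := rfl
  have hr' : t % slotLength K I.N.depth < slotLength K I.N.depth := Nat.mod_lt _ (by omega)
  have ht : t = t / slotLength K I.N.depth * slotLength K I.N.depth +
      t % slotLength K I.N.depth := by
    rw [mul_comm]; exact (Nat.div_add_mod _ _).symm
  change sendSlot (I.inp u) K T (received I.N I.content t u) (t / slotLength K I.N.depth)
    (t % slotLength K I.N.depth) (I.N.ident v) = I.slot (I.hub (t / slotLength K I.N.depth))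
    (t % slotLength K I.N.depth) u v
  generalize t % slotLength K I.N.depth = r at *
  generalize t / slotLength K I.N.depth = s at *
  have hlu := level_le_depth (N := I.N) u
  unfold sendSlot slot
  rw [h4]
  by_cases h1 : r ≤ I.N.depth
  · rw [if_pos h1, if_pos h1, sendDown_content ht]
  rw [if_neg h1, if_neg h1]
  by_cases h2 : r = I.N.depth + 1
  · rw [if_pos h2, if_pos h2, fromParent_content _ (by omega)]
  rw [if_neg h2, if_neg h2]
  by_cases h3 : r < pathRound I.N.depth
  · rw [if_pos h3, if_pos h3, sendUp_content ht (by omega)]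
  rw [if_neg h3, if_neg h3, sendAlong_content ht (by omega) hr']

end Setting

end CutPair

namespace CutPair

open RootedNetwork

namespace Setting

variable {V : Type*} [Fintype V] {S : SketchScheme} {B K T : ℕ} (I : Setting V S B K T)

/-! ### The labels of the regions -/

open Classical in
/-- The initial label of a vertex. -/
noncomputable def label0 (v : V) : Label B :=
  if v = I.x ∨ v = I.y then ⊤
  else if Sensitive I.C I.x I.y v then lab B (I.N.compID I.x v)
  else if Sensitive I.C I.y I.x v then lab B (I.N.compID I.y v)
  else 0

/-- The labels of the regions in which no communication takes place. -/
def special : Set (Label B) :=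
  {0, ⊤, heavyCompLabel B I.H I.C I.x I.y, heavyCompLabel B I.H I.C I.y I.x}

/-- The graph without the edges at `x` and `y`. -/
def rest : SimpleGraph V where
  Adj v w := I.N.graph.Adj v w ∧ (v ≠ I.x ∧ v ≠ I.y) ∧ (w ≠ I.x ∧ w ≠ I.y)
  symm := ⟨fun _ _ h => ⟨h.1.symm, h.2.2, h.2.1⟩⟩
  loopless := ⟨fun _ h => h.1.ne rfl⟩

variable {I}

lemma ends_or {v a b : V} (h : Ends I.x I.y a b) : v = I.x ∨ v = I.y ↔ v = a ∨ v = b := by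
  rcases h with ⟨rfl, rfl⟩ | ⟨rfl, rfl⟩
  exacts [Iff.rfl, or_comm]

lemma special_eq {a b : V} (h : Ends I.x I.y a b) :
    I.special = {0, ⊤, heavyCompLabel B I.H I.C a b, heavyCompLabel B I.H I.C b a} := by
  rcases h with ⟨rfl, rfl⟩ | ⟨rfl, rfl⟩
  · rfl
  · unfold special
    ext L
    simp only [Set.mem_insert_iff, Set.mem_singleton_iff]
    tauto

lemma label0_end {a b : V} (h : Ends I.x I.y a b) : I.label0 a = ⊤ := by
  rw [label0, if_pos ((ends_or h).2 (Or.inl rfl))]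

lemma not_sensitive {a b v : V} (h : Ends I.x I.y a b) (hv : I.N.IsAncestor b v) :
    ¬ Sensitive I.C a b v := fun ha => (h.independent I.ind).disjoint ha.1.1 hv

lemma Sensitive.not_end {a b v : V} (h : Ends I.x I.y a b) (hv : Sensitive I.C a b v) :
    ¬ (v = I.x ∨ v = I.y) := by
  rw [ends_or h]
  rintro (rfl | rfl)
  · exact hv.1.2 rfl
  · exact not_sensitive h (IsAncestor.refl _ _) hv

lemma label0_sensitive {a b v : V} (h : Ends I.x I.y a b) (hv : Sensitive I.C a b v) :
    I.label0 v = lab B (I.N.compID a v) := by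
  rw [label0, if_neg (Sensitive.not_end h hv)]
  rcases h with ⟨rfl, rfl⟩ | ⟨rfl, rfl⟩
  · rw [if_pos hv]
  · rw [if_neg (not_sensitive (Or.inl ⟨rfl, rfl⟩) hv.1.1), if_pos hv]

lemma label0_eq_zero {a b v : V} (h : Ends I.x I.y a b) (hv : ¬ (v = I.x ∨ v = I.y))
    (h1 : ¬ Sensitive I.C a b v) (h2 : ¬ Sensitive I.C b a v) : I.label0 v = 0 := by
  rw [label0, if_neg hv]
  rcases h with ⟨rfl, rfl⟩ | ⟨rfl, rfl⟩
  · rw [if_neg h1, if_neg h2]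
  · rw [if_neg h2, if_neg h1]

lemma heavyCompLabel_spec {a b : V} (h : heavyCompLabel B I.H I.C a b ≠ 0) :
    ∃ c, Sensitive I.C a b c ∧ heavyCompLabel B I.H I.C a b = lab B (I.N.compID a c) := by
  unfold heavyCompLabel at h ⊢
  split_ifs at h ⊢ with hc
  · exact ⟨_, ⟨hc.1.mem_below, hc.2⟩, rfl⟩
  · exact absurd rfl h

lemma lab_compID_ne_zero {a v : V} (h : v ∈ I.N.below a) : lab B (I.N.compID a v) ≠ 0 :=
  lab_ne_zero (compID_lt I.ident_lt h)

lemma mem_comp_of_lab {a v w : V} (hv : v ∈ I.N.below a) (hw : w ∈ I.N.below a)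
    (h : lab B (I.N.compID a v) = lab B (I.N.compID a w)) : w ∈ I.N.comp a v :=
  (compID_eq_iff hv hw).1 (lab_inj (compID_lt I.ident_lt hv) (compID_lt I.ident_lt hw) h)

lemma lab_compID_ne {a b v w : V} (hab : a ≠ b) (hv : v ∈ I.N.below a) (hw : w ∈ I.N.below b) :
    lab B (I.N.compID a v) ≠ lab B (I.N.compID b w) := fun h =>
  compID_ne hab hv hw (lab_inj (compID_lt I.ident_lt hv) (compID_lt I.ident_lt hw) h)

lemma lab_ne_heavyCompLabel {a b v : V} (h : Ends I.x I.y a b) (hv : v ∈ I.N.below a) :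
    lab B (I.N.compID a v) ≠ heavyCompLabel B I.H I.C b a := by
  intro he
  have h0 : heavyCompLabel B I.H I.C b a ≠ 0 := by
    rw [← he]; exact lab_compID_ne_zero hv
  obtain ⟨c, hc, hc'⟩ := heavyCompLabel_spec h0
  exact lab_compID_ne (h.independent I.ind).ne hv hc.1 (he.trans hc')

lemma sensitive_of_lab_eq {a b v : V} (hv : v ∈ I.N.below a)
    (he : lab B (I.N.compID a v) = heavyCompLabel B I.H I.C a b) : Sensitive I.C a b v := by
  have h0 : heavyCompLabel B I.H I.C a b ≠ 0 := by
    rw [← he]; exact lab_compID_ne_zero hv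
  obtain ⟨c, hc, hc'⟩ := heavyCompLabel_spec h0
  exact hc.congr (mem_comp_of_lab hc.1 hv (hc'.symm.trans he.symm))

lemma heavyCompLabel_ne_top {a b : V} : heavyCompLabel B I.H I.C a b ≠ ⊤ := by
  unfold heavyCompLabel
  split_ifs
  exacts [lab_ne_top _ _, zero_ne_top _]

lemma heavyCompLabel_ne {a b : V} (h : Ends I.x I.y a b)
    (h0 : heavyCompLabel B I.H I.C a b ≠ 0) :
    heavyCompLabel B I.H I.C a b ≠ heavyCompLabel B I.H I.C b a := by
  obtain ⟨c, hc, hc'⟩ := heavyCompLabel_spec h0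
  rw [hc']
  exact lab_ne_heavyCompLabel h hc.1

/-- Component-IDs of different components differ, also between the two sides, so a heavy label marks
nothing but the heavy component itself. -/
lemma act_iff_label0 {v : V} : I.Act v ↔ I.label0 v ∉ I.special := by
  constructor
  · intro hv
    obtain ⟨a, b, h, hv⟩ := hv.ends
    rw [label0_sensitive h hv.1, special_eq h]
    simp only [Set.mem_insert_iff, Set.mem_singleton_iff, not_or]
    exact ⟨lab_compID_ne_zero hv.1.1, lab_ne_top _ _, hv.2, lab_ne_heavyCompLabel h hv.1.1⟩
  · intro hv
    by_cases he : v = I.x ∨ v = I.y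
    · rw [label0, if_pos he] at hv
      exact absurd (by simp [special]) hv
    have key : ∀ a b, Ends I.x I.y a b → Sensitive I.C a b v → I.Act v := by
      intro a b h hs
      refine (act_iff h v).2 (Or.inl ⟨hs, fun he => hv ?_⟩)
      rw [label0_sensitive h hs, he, special_eq h]
      simp
    by_contra hna
    have h1 : ¬ Sensitive I.C I.x I.y v := fun hs => hna (key _ _ (Or.inl ⟨rfl, rfl⟩) hs)
    have h2 : ¬ Sensitive I.C I.y I.x v := fun hs => hna (key _ _ (Or.inr ⟨rfl, rfl⟩) hs)
    rw [label0_eq_zero (Or.inl ⟨rfl, rfl⟩) he h1 h2] at hv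
    exact hv (by simp [special])

lemma zero_mem_special : (0 : Label B) ∈ I.special := by simp [special]

lemma top_mem_special : (⊤ : Label B) ∈ I.special := by simp [special]

lemma heavy_mem_special {a b : V} (h : Ends I.x I.y a b) :
    heavyCompLabel B I.H I.C a b ∈ I.special := by
  rw [special_eq h]; simp

lemma label0_ne_top {v : V} : I.label0 v ≠ ⊤ ↔ v ≠ I.x ∧ v ≠ I.y := by
  rw [← not_or]
  refine not_congr ⟨fun h => ?_, fun h => by rw [label0, if_pos h]⟩
  by_contra he
  rw [label0, if_neg he] at h
  split_ifs at h
  exacts [lab_ne_top _ _ h, lab_ne_top _ _ h, zero_ne_top _ h]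

lemma below_not_end {a b v : V} (h : Ends I.x I.y a b) (hv : v ∈ I.N.below a) :
    v ≠ I.x ∧ v ≠ I.y := by
  rw [← not_or, ends_or h, not_or]
  exact ⟨hv.2, fun e => (h.independent I.ind).1 (e ▸ hv.1)⟩

lemma label0_comp {a b v w : V} (h : Ends I.x I.y a b) (hw : w ∈ I.N.comp a v) :
    I.label0 w = I.label0 v := by
  by_cases hs : Sensitive I.C a b v
  · rw [label0_sensitive h hs, label0_sensitive h (hs.congr hw), compID_congr hw]
  · have hb := comp_subset_below hw
    have hb' := hw.1
    rw [label0_eq_zero h (not_or.2 (below_not_end h hb)) (fun h' => hs (h'.congr (mem_comp_symm hw)))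
      (not_sensitive h.symm hb.1),
      label0_eq_zero h (not_or.2 (below_not_end h hb')) hs (not_sensitive h.symm hb'.1)]

lemma rest_reachable_comp {a b v w : V} (h : Ends I.x I.y a b) (hw : w ∈ I.N.comp a v) :
    (sameLabel I.rest I.label0).Reachable v w := by
  obtain ⟨hv, hw, ⟨q⟩⟩ := hw
  have key : ∀ (s t : I.N.below a) (q : (I.N.graph.induce (I.N.below a)).Walk s t),
      (sameLabel I.rest I.label0).Reachable s.1 t.1 := by
    intro s t q
    induction q with
    | nil => exact .refl _
    | @cons s s' t hadj q ih =>
      refine SimpleGraph.Reachable.trans (SimpleGraph.Adj.reachable ?_) ih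
      have hadj' : I.N.graph.Adj s.1 s'.1 := hadj
      exact ⟨⟨hadj', below_not_end h s.2, below_not_end h s'.2⟩,
        (label0_comp h (mem_comp_of_adj s.2 s'.2 hadj')).symm⟩
  exact key _ _ q

/-- The tree path from the root to `v` avoids both subtrees and is labelled `0` throughout. -/
lemma rest_reachable_root_tree {v : V} (hx : ¬ I.N.IsAncestor I.x v)
    (hy : ¬ I.N.IsAncestor I.y v) : (sameLabel I.rest I.label0).Reachable I.N.root v := by
  have lab0 : ∀ v, ¬ I.N.IsAncestor I.x v → ¬ I.N.IsAncestor I.y v → I.label0 v = 0 := by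
    intro v hx hy
    refine label0_eq_zero (Or.inl ⟨rfl, rfl⟩) ?_ (fun h => hx h.1.1) (fun h => hy h.1.1)
    rintro (rfl | rfl)
    exacts [hx (IsAncestor.refl _ _), hy (IsAncestor.refl _ _)]
  have ne : ∀ v, ¬ I.N.IsAncestor I.x v → ¬ I.N.IsAncestor I.y v → v ≠ I.x ∧ v ≠ I.y := by
    intro v hx hy
    constructor
    · rintro rfl; exact hx (IsAncestor.refl _ _)
    · rintro rfl; exact hy (IsAncestor.refl _ _)
  induction h : I.N.level v generalizing v with
  | zero => rw [I.N.level_eq_zero.1 h]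
  | succ n ih =>
    have hv : v ≠ I.N.root := by
      rintro rfl; rw [I.N.level_root] at h; omega
    have hc := isChild_parent hv
    have hx' : ¬ I.N.IsAncestor I.x (I.N.parent v) := fun h' => hx (h'.trans hc.isAncestor)
    have hy' : ¬ I.N.IsAncestor I.y (I.N.parent v) := fun h' => hy (h'.trans hc.isAncestor)
    refine (ih hx' hy' (by have := hc.level; omega)).trans (SimpleGraph.Adj.reachable ?_)
    exact ⟨⟨hc.adj, ne _ hx' hy', ne _ hx hy⟩, by rw [lab0 _ hx hy, lab0 _ hx' hy']⟩

lemma label0_root : I.label0 I.N.root = 0 := by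
  have h := I.ind
  refine label0_eq_zero (Or.inl ⟨rfl, rfl⟩) ?_ (fun h => ne_root_of_mem_below h.1 rfl)
    (fun h => ne_root_of_mem_below h.1 rfl)
  rintro (h' | h')
  exacts [h.ne_root h'.symm, h.symm.ne_root h'.symm]

/-- Below an end, label `0` means that the component is not sensitive. Its connectivity path starts
with a tree path outside both subtrees and then enters the component by one edge, so it survives the
removal of `x` and `y`. -/
lemma rest_reachable_root {v : V} (hv : I.label0 v = 0) :
    (sameLabel I.rest I.label0).Reachable I.N.root v := by
  have hne := label0_ne_top.1 (hv ▸ zero_ne_top B)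
  have key : ∀ a b, Ends I.x I.y a b → I.N.IsAncestor a v → v ≠ a →
      (sameLabel I.rest I.label0).Reachable I.N.root v := by
    intro a b h ha hva
    have hb : v ∈ I.N.below a := ⟨ha, hva⟩
    have hr := (h.independent I.ind).ne_root
    have hns : ¬ Sensitive I.C a b v := by
      intro hs
      rw [label0_sensitive h hs] at hv
      exact lab_compID_ne_zero hb hv
    have hb' : b ∉ I.C.path a v := fun h' => hns ⟨hb, h'⟩
    have hinn := I.C.inn_mem a v hr hb
    have hadj := I.C.adj a v hr hb
    have ha1 : ¬ I.N.IsAncestor a (I.C.out a v) := fun h' =>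
      I.C.not_mem_out a v hr hb (mem_rootPath.2 h')
    have hb1 : ¬ I.N.IsAncestor b (I.C.out a v) := fun h' =>
      hb' (List.mem_append_left _ (mem_rootPath.2 h'))
    have hxy : ¬ I.N.IsAncestor I.x (I.C.out a v) ∧ ¬ I.N.IsAncestor I.y (I.C.out a v) := by
      rcases h with ⟨rfl, rfl⟩ | ⟨rfl, rfl⟩
      exacts [⟨ha1, hb1⟩, ⟨hb1, ha1⟩]
    have h1 := rest_reachable_root_tree hxy.1 hxy.2
    have hl : I.label0 (I.C.out a v) = 0 := by
      rw [← label_eq_of_reachable h1, label0_root]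
    refine (h1.trans (SimpleGraph.Adj.reachable ?_)).trans
      (rest_reachable_comp h (mem_comp_symm hinn))
    exact ⟨⟨hadj, label0_ne_top.1 (hl ▸ zero_ne_top B),
      below_not_end h (comp_subset_below hinn)⟩, by rw [hl, label0_comp h hinn, hv]⟩
  by_cases hx : I.N.IsAncestor I.x v
  · exact key _ _ (Or.inl ⟨rfl, rfl⟩) hx hne.1
  by_cases hy : I.N.IsAncestor I.y v
  · exact key _ _ (Or.inr ⟨rfl, rfl⟩) hy hne.2
  exact rest_reachable_root_tree hx hy

lemma exists_sensitive {v : V} (h : I.label0 v ≠ ⊤) (h0 : I.label0 v ≠ 0) :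
    ∃ a b, Ends I.x I.y a b ∧ Sensitive I.C a b v := by
  by_contra hcon
  push Not at hcon
  refine h0 (label0_eq_zero (Or.inl ⟨rfl, rfl⟩) (not_or.2 (label0_ne_top.1 h)) ?_ ?_)
  · exact hcon _ _ (Or.inl ⟨rfl, rfl⟩)
  · exact hcon _ _ (Or.inr ⟨rfl, rfl⟩)

lemma labelling0 : Labelling I.rest I.special I.label0 0 where
  top_mem := top_mem_special
  isolated v w h := label0_ne_top.2 h.2.1
  connected := by
    intro v w hvw hv
    by_cases h0 : I.label0 v = 0
    · exact (rest_reachable_root h0).symm.trans (rest_reachable_root (hvw ▸ h0))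
    · obtain ⟨a, b, h, hs⟩ := exists_sensitive hv h0
      obtain ⟨a', b', h', hs'⟩ := exists_sensitive (hvw ▸ hv) (hvw ▸ h0)
      have e := hvw
      rw [label0_sensitive h hs, label0_sensitive h' hs'] at e
      obtain rfl : a = a' := by
        by_contra hne
        exact lab_compID_ne hne hs.1 hs'.1 e
      exact rest_reachable_comp h (mem_comp_of_lab hs.1 hs'.1 e)
  large v _ := by
    right
    rw [pow_zero, Nat.one_le_iff_ne_zero, ← Nat.pos_iff_ne_zero, Set.ncard_pos (Set.toFinite _)]
    exact ⟨v, rfl⟩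

end Setting

end CutPair

namespace CutPair

open RootedNetwork

namespace Setting

variable {V : Type*} [Fintype V] {S : SketchScheme} {B K T : ℕ} (I : Setting V S B K T)

/-! ### What the ends of the path know -/

/-- The ends know each other's heavy components, and the current labels `l` of their own. -/
structure Tracks (st : V → HubState B S.len) (l : V → Label B) : Prop where
  summary : ∀ a b, Ends I.x I.y a b → (st a).summary.1 0 = heavyCompLabel B I.H I.C b a
  tab : ∀ a b, Ends I.x I.y a b → ∀ v, Sensitive I.C a b v →
    (st a).tab (lab B (I.N.compID a v)) = l v

/-- Labels that arise from the initial ones by merging. -/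
structure Merged (l : V → Label B) (t : ℕ) : Prop where
  labelling : Labelling I.rest I.special l t
  inactive : ∀ v, ¬ I.Act v → l v = I.label0 v
  comp : ∀ a b, Ends I.x I.y a b → ∀ v w, w ∈ I.N.comp a v → l w = l v

variable {I} {st : V → HubState B S.len} {l : V → Label B} {t : ℕ}

lemma merged (t : ℕ) : I.Merged (merge I.rest I.special I.label0 t ∘ I.label0) t where
  labelling := labelling0.merge t
  inactive v hv := merge_special (by
    by_contra h
    exact hv (act_iff_label0.2 h)) t
  comp a b h v w hw := congrArg (merge I.rest I.special I.label0 t) (label0_comp h hw)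

lemma Merged.act (hl : I.Merged l t) {v : V} (hv : l v ∉ I.special) : I.Act v := by
  by_contra h
  have := hl.inactive v h
  rw [this] at hv
  exact h (act_iff_label0.2 hv)

lemma Merged.end_eq (hl : I.Merged l t) {a b : V} (h : Ends I.x I.y a b) : l a = ⊤ := by
  rw [hl.inactive a (not_act_end h), label0_end h]

lemma Tracks.special (hst : I.Tracks st l) {a b : V} (h : Ends I.x I.y a b) :
    specialLabels (I.inp a) (st a) = I.special := by
  have : heavyLabel B (I.inp a) = heavyCompLabel B I.H I.C a b :=
    heavyLabel_localInput I.isPath I.ind h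
  rw [specialLabels, this, hst.summary a b h, special_eq h]

lemma Tracks.down (hst : I.Tracks st l) {a b v : V} (h : Ends I.x I.y a b)
    (hv : Active B I.H I.C a b v) :
    I.down st v = (![lab B (I.N.ident a), lab B (I.N.ident b), heavyCompLabel B I.H I.C a b,
      heavyCompLabel B I.H I.C b a, l v, (st a).query (l v), (st a).val (l v)], 0) := by
  have h1 : heavyLabel B (I.inp a) = heavyCompLabel B I.H I.C a b :=
    heavyLabel_localInput I.isPath I.ind h
  have h2 : otherID (I.inp a) = I.N.ident b := otherID_localInput I.isPath I.ind.ne h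
  rw [down_eq st h hv, downMsg, h1, h2, hst.summary a b h, hst.tab a b h v hv.1]
  rfl

lemma exists_ancestor_iff {a b w : V} (k : Label B) :
    (∃ ai ∈ (publicInfo I.H I.C w).ancestors,
      (lab B ai.ancestor.id = lab B (I.N.ident a) ∨ lab B ai.ancestor.id = lab B (I.N.ident b)) ∧
        lab B ai.compID = k) ↔
      (w ∈ I.N.below a ∧ lab B (I.N.compID a w) = k) ∨
      (w ∈ I.N.below b ∧ lab B (I.N.compID b w) = k) := by
  have inj : ∀ {u v}, lab B (I.N.ident u) = lab B (I.N.ident v) ↔ u = v := fun {u v} =>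
    ⟨fun h => I.N.ident_injective (lab_inj (I.ident_lt u) (I.ident_lt v) h), fun h => by rw [h]⟩
  constructor
  · rintro ⟨ai, hai, h1, h2⟩
    obtain ⟨z, hz, rfl⟩ := List.mem_map.1 hai
    rw [mem_dropLast_rootPath] at hz
    have hzw : w ∈ I.N.below z := ⟨hz.1, hz.2.symm⟩
    rcases h1 with h1 | h1
    · obtain rfl : z = a := inj.1 h1
      exact Or.inl ⟨hzw, h2⟩
    · obtain rfl : z = b := inj.1 h1
      exact Or.inr ⟨hzw, h2⟩
  · rintro (⟨h1, h2⟩ | ⟨h1, h2⟩)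
    · exact ⟨_, List.mem_map_of_mem (mem_dropLast_rootPath.2 ⟨h1.1, Ne.symm h1.2⟩), Or.inl rfl, h2⟩
    · exact ⟨_, List.mem_map_of_mem (mem_dropLast_rootPath.2 ⟨h1.1, Ne.symm h1.2⟩), Or.inr rfl, h2⟩

/-- Active neighbours announce their current label. A silent one still has its initial, special
label, and its public information on its ancestors tells which: the component-ID matches a heavy
label, or the label is `0`. -/
lemma neighbourLabel_eq (hst : I.Tracks st l) (hl : I.Merged l t) {a b : V}
    (h : Ends I.x I.y a b) {w : V} {rcv : ℕ → Option (Msg B S.len)}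
    (hr : rcv (I.N.ident w) = I.down? st w) :
    neighbourLabel (lab B (I.N.ident a)) (lab B (I.N.ident b)) (heavyCompLabel B I.H I.C a b)
      (heavyCompLabel B I.H I.C b a) rcv (publicInfo I.H I.C w) = l w := by
  classical
  have inj : ∀ {u v}, lab B (I.N.ident u) = lab B (I.N.ident v) ↔ u = v := fun {u v} =>
    ⟨fun h => I.N.ident_injective (lab_inj (I.ident_lt u) (I.ident_lt v) h), fun h => by rw [h]⟩
  have hid : (publicInfo I.H I.C w).me.id = I.N.ident w := rfl
  unfold neighbourLabel
  rw [hid]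
  by_cases hw : w = a ∨ w = b
  · rw [if_pos (hw.imp inj.2 inj.2)]
    rcases hw with rfl | rfl
    exacts [(hl.end_eq h).symm, (hl.end_eq h.symm).symm]
  rw [if_neg (fun hc => hw (hc.imp inj.1 inj.1)), hr]
  by_cases hact : I.Act w
  · obtain ⟨a', b', h', hw'⟩ := hact.ends
    rw [down?, if_pos hact, hst.down h' hw']
    rfl
  rw [down?, if_neg hact, hl.inactive w hact]
  simp only [Option.map_none, Option.getD_none, exists_ancestor_iff]
  have hsp : I.label0 w ∈ I.special := by
    by_contra hc; exact hact (act_iff_label0.2 hc)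
  have hne : ¬ (w = I.x ∨ w = I.y) := (ends_or h).not.2 hw
  have key : ∀ a b, Ends I.x I.y a b →
      ((w ∈ I.N.below a ∧ lab B (I.N.compID a w) = heavyCompLabel B I.H I.C a b) ∨
        (w ∈ I.N.below b ∧ lab B (I.N.compID b w) = heavyCompLabel B I.H I.C a b)) →
      heavyCompLabel B I.H I.C a b = I.label0 w := by
    rintro a b h (⟨h1, h2⟩ | ⟨h1, h2⟩)
    · rw [label0_sensitive h (sensitive_of_lab_eq h1 h2), h2]
    · exact absurd h2 (lab_ne_heavyCompLabel h.symm h1)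
  split_ifs with h1 h2
  · exact key a b h h1
  · exact key b a h.symm (Or.symm h2)
  · by_contra hc
    obtain ⟨a', b', h', hs⟩ := exists_sensitive (label0_ne_top.2 (not_or.1 hne)) (Ne.symm hc)
    have e := hsp
    rw [label0_sensitive h' hs, special_eq h'] at e
    have e' : lab B (I.N.compID a' w) = heavyCompLabel B I.H I.C a' b' := by
      rcases e with e | e | e | e
      · exact absurd e (lab_compID_ne_zero hs.1)
      · exact absurd e (lab_ne_top _ _)
      · exact e
      · exact absurd e (lab_ne_heavyCompLabel h' hs.1)
    have : (a' = a ∧ b' = b) ∨ (a' = b ∧ b' = a) := by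
      rcases h with ⟨rfl, rfl⟩ | ⟨rfl, rfl⟩
      · exact h'
      · exact Or.symm h'
    rcases this with ⟨rfl, rfl⟩ | ⟨rfl, rfl⟩
    · exact h1 (Or.inl ⟨hs.1, e'⟩)
    · exact h2 (Or.inr ⟨hs.1, e'⟩)

open Classical in
/-- The end of the path that is responsible for the component of `v`. -/
noncomputable def owner (I : Setting V S B K T) (v : V) : V :=
  if Active B I.H I.C I.x I.y v then I.x else I.y

lemma owner_eq {a b v : V} (h : Ends I.x I.y a b) (hv : Active B I.H I.C a b v) :
    I.owner v = a := by
  rcases h with ⟨rfl, rfl⟩ | ⟨rfl, rfl⟩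
  · rw [owner, if_pos hv]
  · rw [owner, if_neg (not_active_of_isAncestor (Or.inl ⟨rfl, rfl⟩) hv.1.1.1)]

open Classical in
lemma locals_fst (hst : I.Tracks st l) (hl : I.Merged l t) {v : V} (hv : I.Act v) :
    (I.locals st v).1 = ⨅ w, ⨅ _ : I.N.graph.Adj v w, if l w = l v then ⊤ else l w := by
  obtain ⟨a, b, h, hv⟩ := hv.ends
  have h2 := iInf_neighbours (I := I) (α := Label B) v
  simp only [locals, localPair, hst.down h hv, h2]
  refine iInf_congr fun w => iInf_congr fun hw => ?_
  have h3 := neighbourLabel_eq hst hl h (exchange_ident st hw.symm)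
  simp only [Msg.hubID, Msg.otherID, Msg.hubHeavy, Msg.otherHeavy, Msg.label]
  change (if neighbourLabel (lab B (I.N.ident a)) (lab B (I.N.ident b))
      (heavyCompLabel B I.H I.C a b) (heavyCompLabel B I.H I.C b a) (I.exchange st v)
      (publicInfo I.H I.C w) = l v then ⊤ else neighbourLabel (lab B (I.N.ident a))
      (lab B (I.N.ident b)) (heavyCompLabel B I.H I.C a b) (heavyCompLabel B I.H I.C b a)
      (I.exchange st v) (publicInfo I.H I.C w)) = _
  rw [h3]

open Classical in
lemma locals_snd (hst : I.Tracks st l) {a b v : V} (h : Ends I.x I.y a b)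
    (hv : Active B I.H I.C a b v) :
    (I.locals st v).2 = ⨅ w, ⨅ _ : I.N.graph.Adj v w,
      if I.Act w ∧ l w = (st a).query (l v) then (st (I.owner w)).val (l w) else ⊤ := by
  have h2 := iInf_neighbours (I := I) (α := Label B) v
  simp only [locals, localPair, h2]
  refine iInf_congr fun w => iInf_congr fun hw => ?_
  change ((I.exchange st v (I.N.ident w)).map _).getD ⊤ = _
  rw [exchange_ident st hw.symm, hst.down h hv, down?]
  by_cases hact : I.Act w
  · obtain ⟨a', b', h', hw'⟩ := hact.ends
    rw [if_pos hact, hst.down h' hw', owner_eq h' hw']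
    simp only [hact, true_and]
    rfl
  · rw [if_neg hact, if_neg (fun h => hact h.1)]
    rfl

-- The subtrees of the children partition the vertices below `a`, and activity and label are
-- constant on each of them. Minima of reports are thus minima over vertices; the condition on `π`
-- holds for both projections.
open Classical in
lemma reportInf_eq (hst : I.Tracks st l) {a b : V} (h : Ends I.x I.y a b)
    {π : Label B × Label B → Label B}
    (hπ : ∀ (s : Set V) (f : V → Label B × Label B), π (⨅ v ∈ s, f v) = ⨅ v ∈ s, π (f v))
    (g : Label B → Label B) (L : Label B) :
    reportInf (I.inp a) (st a) (I.ups st a) π g L =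
      ⨅ v, if Active B I.H I.C a b v ∧ g (l v) = L then π (I.locals st v) else ⊤ := by
  have hrep : reportInf (I.inp a) (st a) (I.ups st a) π g L = ⨅ c, ⨅ _ : I.N.IsChild a c,
      if Active B I.H I.C a b c ∧ g (l c) = L then ⨅ v ∈ I.N.subtree c, π (I.locals st v)
      else ⊤ := by
    rw [reportInf, iInf_children]
    refine iInf_congr fun c => iInf_congr fun hc => ?_
    have h1 : ActiveChild B (I.inp a) (childInfo I.H I.C S I.seed a c) ↔
      Active B I.H I.C a b c := activeChild_localInput I.isPath I.ind h hc
    by_cases hac : Active B I.H I.C a b c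
    · have h2 : (st a).tab (lab B (childInfo I.H I.C S I.seed a c).compID) = l c :=
        hst.tab a b h c hac.1
      rw [h2]
      have h3 : I.ups st a (childInfo I.H I.C S I.seed a c).me.id = I.up? st c :=
        ups_ident st hc
      rw [h3, up?, if_pos ((act_iff h c).2 (Or.inl hac))]
      simp only [h1, hac, true_and, Option.map_some, Option.getD_some, Msg.pair_up]
      rw [aggregate, hπ]
    · rw [if_neg (fun hh => hac (h1.1 hh.1)), if_neg (fun hh => hac hh.1)]
  rw [hrep]
  have hc : ∀ c v, I.N.IsChild a c → v ∈ I.N.subtree c → (Active B I.H I.C a b c ↔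
      Active B I.H I.C a b v) ∧ (Active B I.H I.C a b c → l v = l c) := by
    intro c v hc hv
    have hm := mem_comp_of_isAncestor hc.mem_below hv
    refine ⟨⟨fun h => h.congr hm, fun h => h.congr (mem_comp_symm hm)⟩, fun hac => ?_⟩
    rw [← hst.tab a b h v (hac.1.congr hm), ← hst.tab a b h c hac.1, compID_congr hm]
  apply le_antisymm
  · refine le_iInf fun v => ?_
    split_ifs with hv
    · obtain ⟨c, hch, hcv⟩ := mem_below_iff.1 hv.1.1.1
      have hac := (hc c v hch hcv).1.2 hv.1
      refine (iInf₂_le c hch).trans ?_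
      rw [if_pos ⟨hac, by rw [← (hc c v hch hcv).2 hac]; exact hv.2⟩]
      exact iInf₂_le v hcv
    · exact le_top
  · refine le_iInf₂ fun c hch => ?_
    split_ifs with hcc
    · refine le_iInf₂ fun v hv => (iInf_le _ v).trans ?_
      rw [if_pos ⟨(hc c v hch hv).1.1 hcc.1, by rw [(hc c v hch hv).2 hcc.1]; exact hcc.2⟩]
    · exact le_top

lemma fst_iInf (s : Set V) (f : V → Label B × Label B) :
    (⨅ v ∈ s, f v).1 = ⨅ v ∈ s, (f v).1 := by
  simp only [Prod.fst_iInf]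

lemma snd_iInf (s : Set V) (f : V → Label B × Label B) :
    (⨅ v ∈ s, f v).2 = ⨅ v ∈ s, (f v).2 := by
  simp only [Prod.snd_iInf]

/-! ### The pointers -/

variable (I) in
open Classical in
/-- The least other label next to the components of `a` with label `L`. -/
noncomputable def ownMin (l : V → Label B) (a b : V) (L : Label B) : Label B :=
  ⨅ v, if Active B I.H I.C a b v ∧ l v = L then
    ⨅ w, ⨅ _ : I.N.graph.Adj v w, if l w = L then ⊤ else l w else ⊤

lemma reportInf_fst (hst : I.Tracks st l) (hl : I.Merged l t) {a b : V} (h : Ends I.x I.y a b) :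
    reportInf (I.inp a) (st a) (I.ups st a) Prod.fst id = I.ownMin l a b := by
  funext L
  rw [reportInf_eq hst h fst_iInf, ownMin]
  refine iInf_congr fun v => ?_
  rw [id]
  by_cases hv : Active B I.H I.C a b v ∧ l v = L
  · rw [if_pos hv, if_pos hv, locals_fst hst hl ((act_iff h v).2 (Or.inl hv.1)), hv.2]
  · rw [if_neg hv, if_neg hv]

lemma ownMin_le {a b v w : V} {L : Label B} (hv : Active B I.H I.C a b v) (hL : l v = L)
    (hw : I.N.graph.Adj v w) (hne : l w ≠ L) : I.ownMin l a b L ≤ l w := by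
  classical
  refine (iInf_le _ v).trans ?_
  rw [if_pos ⟨hv, hL⟩]
  refine (iInf₂_le w hw).trans ?_
  rw [if_neg hne]

lemma le_ownMin {a b : V} {L M : Label B}
    (hM : ∀ v w, Active B I.H I.C a b v → l v = L → I.N.graph.Adj v w → l w ≠ L → M ≤ l w) :
    M ≤ I.ownMin l a b L := by
  classical
  refine le_iInf fun v => ?_
  split_ifs with hv
  · refine le_iInf₂ fun w hw => ?_
    split_ifs with hc
    · exact le_top
    · exact hM v w hv.1 hv.2 hw hc
  · exact le_top

lemma rest_adj {v w : V} (h : I.N.graph.Adj v w) (hl : I.Merged l t) (hv : l v ≠ ⊤)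
    (hw : l w ≠ ⊤) : I.rest.Adj v w := by
  have key : ∀ v, l v ≠ ⊤ → v ≠ I.x ∧ v ≠ I.y := by
    intro v hv
    constructor
    · rintro rfl; exact hv (hl.end_eq (Or.inl ⟨rfl, rfl⟩))
    · rintro rfl; exact hv (hl.end_eq (Or.inr ⟨rfl, rfl⟩))
  exact ⟨h, key v hv, key w hw⟩

lemma minOther_le_ownMin (hl : I.Merged l t) {a b : V} {L : Label B} (hL : L ≠ ⊤) :
    minOther I.rest l L ≤ I.ownMin l a b L := by
  refine le_ownMin fun v w _ hvL hw hne => ?_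
  by_cases hwt : l w = ⊤
  · rw [hwt]; exact le_top
  · subst hvL
    exact minOther_le (rest_adj hw hl hL hwt) hne

/-- All vertices of a nonspecial class are active, so each neighbouring label is seen from one of
the two sides. -/
lemma minOther_eq (hl : I.Merged l t) {a b : V} (h : Ends I.x I.y a b) {L : Label B}
    (hL : L ∉ I.special) :
    minOther I.rest l L = I.ownMin l a b L ⊓ I.ownMin l b a L := by
  have hLt : L ≠ ⊤ := fun e => hL (e ▸ top_mem_special)
  refine le_antisymm (le_inf (minOther_le_ownMin hl hLt) (minOther_le_ownMin hl hLt)) ?_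
  refine le_sInf ?_
  rintro M ⟨v, w, hvw, rfl, rfl, hne⟩
  rcases (act_iff h v).1 (hl.act hL) with hv | hv
  · exact inf_le_left.trans (ownMin_le hv rfl hvw.1 hne)
  · exact inf_le_right.trans (ownMin_le hv rfl hvw.1 hne)

/-- Consequently an edge between active vertices of different labels has one endpoint below each end
of the path. The bookkeeping of pointers rests on this. -/
lemma active_adj {a b v w : V} (hv : Active B I.H I.C a b v) (hw : Active B I.H I.C a b w)
    (h : I.N.graph.Adj v w) : w ∈ I.N.comp a v := mem_comp_of_adj hv.1.1 hw.1.1 h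

/-- The state after the first slot of a phase. -/
lemma reportInf_snd_inf (hst : I.Tracks st l) (hl : I.Merged l t)
    (hval : ∀ a b, Ends I.x I.y a b → (st a).val = I.ownMin l a b)
    (hq : ∀ a, (st a).query = id) {a b v : V} (h : Ends I.x I.y a b)
    (hv : Active B I.H I.C a b v) (hL : l v ∉ I.special) :
    (st a).val (l v) ⊓ reportInf (I.inp a) (st a) (I.ups st a) Prod.snd id (l v) =
      minOther I.rest l (l v) := by
  classical
  have hLt : l v ≠ ⊤ := fun e => hL (e ▸ top_mem_special)
  rw [reportInf_eq hst h snd_iInf, hval a b h]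
  apply le_antisymm
  · rw [minOther_eq hl h hL]
    refine le_inf inf_le_left ?_
    -- If the class has components on both sides, it is connected and so contains an edge crossing
    -- from one side to the other. Over this edge the minimum of the other side is heard.
    by_cases hex : ∃ v', Active B I.H I.C b a v' ∧ l v' = l v
    · obtain ⟨v', hv', hvv'⟩ := hex
      have hr := hl.labelling.connected v v' hvv'.symm hLt
      obtain ⟨u, u', hu, huu', hau, hau'⟩ := exists_boundary_adj
        (A := {u | Active B I.H I.C a b u}) hr hv (not_active_of_isAncestor h hv'.1.1.1)
      have hul : l u = l v := (label_eq_of_reachable hu).symm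
      have hul' : l u' = l v := huu'.2.symm.trans hul
      have hact : I.Act u' := hl.act (by rw [hul']; exact hL)
      have hbu' := ((act_iff h u').1 hact).resolve_left hau'
      refine inf_le_right.trans ((iInf_le _ u).trans ?_)
      rw [if_pos ⟨hau, hul⟩, locals_snd hst h hau]
      refine (iInf₂_le u' huu'.1.1).trans ?_
      rw [hq, if_pos ⟨hact, by rw [hul', hul]; rfl⟩, owner_eq h.symm hbu', hval b a h.symm, hul']
    · have : I.ownMin l b a (l v) = ⊤ := by
        rw [← top_le_iff]
        exact le_ownMin fun v' w hv' hvv' _ _ => absurd ⟨v', hv', hvv'⟩ hex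
      rw [this]; exact le_top
  · refine le_inf (minOther_le_ownMin hl hLt) (le_iInf fun u => ?_)
    split_ifs with hu
    · have hul : l u = l v := hu.2
      rw [locals_snd hst h hu.1]
      refine le_iInf₂ fun w hw => ?_
      split_ifs with hc
      · have hwl : l w = l v := by rw [hc.2, hq, ← hul]; rfl
        obtain ⟨a', b', h', hw'⟩ := hc.1.ends
        rw [owner_eq h' hw', hval a' b' h', hwl]
        exact minOther_le_ownMin hl hLt
      · exact le_top
    · exact le_top

lemma ownPointer_eq (hst : I.Tracks st l) (hl : I.Merged l t)
    (hval : ∀ a b, Ends I.x I.y a b → (st a).val = I.ownMin l a b)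
    (hq : ∀ a, (st a).query = id) {a b v : V} (h : Ends I.x I.y a b)
    (hv : Active B I.H I.C a b v) :
    ownPointer (I.inp a) (st a) (I.ups st a) (l v) = pointer I.rest I.special l (l v) := by
  unfold ownPointer pointer
  rw [hst.special h]
  by_cases hL : l v ∈ I.special
  · rw [if_pos hL, if_pos hL]
  · rw [if_neg hL, if_neg hL, reportInf_snd_inf hst hl hval hq h hv hL]

variable (I) in
/-- The labels whose pointers become known to `a`. -/
def known (l : V → Label B) (a b : V) : Set (Label B) :=
  I.special ∪ {L | ∃ v, Active B I.H I.C a b v ∧ (L = l v ∨ L = pointer I.rest I.special l (l v))}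

/-- The edge realising the pointer ends in a class without components of `a`. Were its start on the
side of `b` too, both endpoints would lie in one component and share a label. -/
lemma exists_own_edge (hl : I.Merged l t) {a b v : V} (h : Ends I.x I.y a b) {L : Label B}
    (hL : L ∉ I.special) (hv : Active B I.H I.C a b v)
    (hp : pointer I.rest I.special l (l v) = L) (hn : ∀ w, Active B I.H I.C a b w → l w ≠ L) :
    ∃ u w, Active B I.H I.C a b u ∧ l u = l v ∧ I.N.graph.Adj u w ∧ l w = L := by
  have hne : pointer I.rest I.special l (l v) ≠ l v := fun e => hn v hv (e.symm.trans hp)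
  obtain ⟨u, w, huw, hu, hw⟩ := exists_pointer hne
  have hvs : l v ∉ I.special := fun hs => hne (pointer_special hs)
  rw [hp] at hw
  refine ⟨u, w, ?_, hu, huw.1, hw⟩
  by_contra hua
  have hub := ((act_iff h u).1 (hl.act (by rw [hu]; exact hvs))).resolve_left hua
  have hwa := (act_iff h w).1 (hl.act (by rw [hw]; exact hL))
  have hwb := hwa.resolve_left fun hw' => hn w hw' hw
  have := hl.comp b a h.symm u w (active_adj hub hwb huw.1)
  rw [hw, hu, ← hp] at this
  exact hne this

/-- From a class with a component of `a` one step leads to a known label by definition. A nonspecial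
class without such a component lies on the side of `b`, so if its pointer moves, it leads to a
special label or across to a class with a component of `a`. -/
lemma known_closed (hl : I.Merged l t) {a b : V} (h : Ends I.x I.y a b) {L : Label B}
    (hL : L ∈ I.known l a b) : pointer I.rest I.special l L ∈ I.known l a b := by
  by_cases hs : L ∈ I.special
  · rw [pointer_special hs]; exact Or.inl hs
  by_cases hown : ∃ v, Active B I.H I.C a b v ∧ l v = L
  · obtain ⟨v, hv, rfl⟩ := hown
    exact Or.inr ⟨v, hv, Or.inr rfl⟩
  by_cases hp : pointer I.rest I.special l L = L
  · rw [hp]; exact hL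
  obtain ⟨u, w, huw, hu, hw⟩ := exists_pointer hp
  by_cases hws : l w ∈ I.special
  · rw [← hw]; exact Or.inl hws
  have hub := ((act_iff h u).1 (hl.act (by rw [hu]; exact hs))).resolve_left
    fun hu' => hown ⟨u, hu', hu⟩
  refine Or.inr ⟨w, ?_, Or.inl hw.symm⟩
  by_contra hwa
  have hwb := ((act_iff h w).1 (hl.act hws)).resolve_left hwa
  have := hl.comp b a h.symm u w (active_adj hub hwb huw.1)
  rw [hw, hu] at this
  exact hp this

/-- The state after the second slot of a phase. -/
lemma knownPointer_eq (hst : I.Tracks st l) (hl : I.Merged l t)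
    (hval : ∀ a b, Ends I.x I.y a b → ∀ v, Active B I.H I.C a b v →
      (st a).val (l v) = pointer I.rest I.special l (l v))
    (hq : ∀ a, (st a).query = (st a).val) {a b : V} (h : Ends I.x I.y a b) {L : Label B}
    (hL : L ∈ I.known l a b) :
    knownPointer (I.inp a) (st a) (I.ups st a) L = pointer I.rest I.special l L := by
  classical
  unfold knownPointer
  rw [hst.special h]
  by_cases hs : L ∈ I.special
  · rw [if_pos hs, pointer_special hs]
  rw [if_neg hs]
  have hex : (∃ ci ∈ (I.inp a).children, ActiveChild B (I.inp a) ci ∧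
      (st a).tab (lab B ci.compID) = L) ↔ ∃ v, Active B I.H I.C a b v ∧ l v = L := by
    have h0 := exists_mem_children (H := I.H) (C := I.C) (S := S) (seed := I.seed) (p := I.p)
      (v := a) (Q := fun ci => ActiveChild B (I.inp a) ci ∧ (st a).tab (lab B ci.compID) = L)
    refine h0.trans ?_
    have h1 : ∀ c, I.N.IsChild a c → (ActiveChild B (I.inp a) (childInfo I.H I.C S I.seed a c) ↔
      Active B I.H I.C a b c) := fun c hc => activeChild_localInput I.isPath I.ind h hc
    constructor
    · rintro ⟨c, hc, hca, hcl⟩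
      have hca := (h1 c hc).1 hca
      exact ⟨c, hca, by rw [← hcl]; exact (hst.tab a b h c hca.1).symm⟩
    · rintro ⟨v, hv, hvl⟩
      obtain ⟨c, hc, -, hcv⟩ := exists_child_comp hv.1.1
      have hca := hv.congr (mem_comp_symm hcv)
      refine ⟨c, hc, (h1 c hc).2 hca, ?_⟩
      rw [← hvl, ← hst.tab a b h v hv.1, compID_congr hcv]
      rfl
  by_cases hown : ∃ v, Active B I.H I.C a b v ∧ l v = L
  · rw [if_pos (hex.2 hown)]
    obtain ⟨v, hv, rfl⟩ := hown
    exact hval a b h v hv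
  rw [if_neg (hex.not.2 hown)]
  obtain ⟨v, hv, hvL | hvL⟩ := hL.resolve_left hs
  · exact absurd ⟨v, hv, hvL.symm⟩ hown
  have hn : ∀ w, Active B I.H I.C a b w → l w ≠ L := fun w hw hwl => hown ⟨w, hw, hwl⟩
  have hterm : ∀ w, I.Act w → l w = L →
      (st (I.owner w)).val (l w) = pointer I.rest I.special l L := by
    intro w hw hwl
    obtain ⟨a', b', h', hw'⟩ := hw.ends
    rw [owner_eq h' hw', hval a' b' h' w hw', hwl]
  have hpt : pointer I.rest I.special l L ≠ ⊤ := by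
    intro e
    by_cases hp : pointer I.rest I.special l L = L
    · rw [hp] at e; exact hs (e ▸ top_mem_special)
    · obtain ⟨u, w, huw, -, hw⟩ := exists_pointer hp
      exact hl.labelling.isolated w u huw.symm (hw.trans e)
  have hrep : reportInf (I.inp a) (st a) (I.ups st a) Prod.snd (st a).val L =
      pointer I.rest I.special l L := by
    rw [reportInf_eq hst h snd_iInf]
    apply le_antisymm
    -- Some own vertex borders the class of `L` and hears its pointer. Every other answer comes from
    -- the same class and carries the same value.
    · obtain ⟨u, w, hu, hul, huw, hwl⟩ := exists_own_edge hl h hs hv hvL.symm hn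
      refine (iInf_le _ u).trans ?_
      have huL : (st a).val (l u) = L := by rw [hul, hval a b h v hv, hvL]
      rw [if_pos ⟨hu, huL⟩, locals_snd hst h hu]
      refine (iInf₂_le w huw).trans ?_
      have hact : I.Act w := hl.act (by rw [hwl]; exact hs)
      rw [if_pos ⟨hact, by rw [hq, huL, hwl]⟩, hterm w hact hwl]
    · refine le_iInf fun u => ?_
      split_ifs with hu
      · rw [locals_snd hst h hu.1]
        refine le_iInf₂ fun w hw => ?_
        split_ifs with hc
        · rw [hterm w hc.1 (by rw [hc.2, hq, hu.2])]
        · exact le_top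
      · exact le_top
  rw [hrep, if_neg hpt]

/-! ### The course of the phases -/

variable (I) in
/-- The labels after `t` phases. -/
noncomputable def labels (t : ℕ) : V → Label B := merge I.rest I.special I.label0 t ∘ I.label0

lemma labels_succ (t : ℕ) (v : V) : I.labels (t + 1) v =
    eventualRep (pointer I.rest I.special (I.labels t)) (I.labels t v) := rfl

lemma step_summary (s : ℕ) (a : V) : (I.step st s a).summary =
    summaryMsg (I.inp (I.other a)) (st (I.other a)) := by
  unfold step updateHub
  split_ifs <;> rfl

lemma step_heard (s : ℕ) (a : V) : (I.step st s a).heard = I.exchange st a := by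
  unfold step updateHub
  split_ifs <;> rfl

lemma step_summary_zero (s : ℕ) {a b : V} (h : Ends I.x I.y a b) :
    (I.step st s a).summary.1 0 = heavyCompLabel B I.H I.C b a := by
  rw [step_summary, other_eq h]
  exact heavyLabel_localInput I.isPath I.ind h.symm

lemma hub_summary (s : ℕ) {a b : V} (h : Ends I.x I.y a b) :
    (I.hub (s + 1) a).summary.1 0 = heavyCompLabel B I.H I.C b a := step_summary_zero s h

lemma tracks_of_tab_eq (hst : I.Tracks st l) {s : ℕ} (h : ∀ a, (I.step st s a).tab = (st a).tab) :
    I.Tracks (I.step st s) l where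
  summary _ _ hab := step_summary_zero s hab
  tab a b hab v hv := by rw [h]; exact hst.tab a b hab v hv

/-- The tables are constant during the first two slots, which gather `ownMin` and then the pointers
of own classes. After the third slot the pointers are right on `known`, a closed set containing the
own labels, so the local merging agrees with the global one. -/
lemma tracks_phase {t : ℕ} (ht : t < T) (hst : I.Tracks (I.hub (3 * t + 1)) (I.labels t)) :
    I.Tracks (I.hub (3 * (t + 1) + 1)) (I.labels (t + 1)) := by
  have hl : I.Merged (I.labels t) t := merged t
  set s1 := I.hub (3 * t + 1) with hs1
  have e2 : ∀ a, I.hub (3 * t + 2) a = ⟨(s1 a).tab, id,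
      reportInf (I.inp a) (s1 a) (I.ups s1 a) Prod.fst id, I.exchange s1 a,
      summaryMsg (I.inp (I.other a)) (s1 (I.other a))⟩ := by
    intro a
    change I.step s1 (3 * t + 1) a = _
    rw [step, updateHub, if_pos (by omega), if_pos (by omega)]
  have hst2 : I.Tracks (I.hub (3 * t + 2)) (I.labels t) :=
    tracks_of_tab_eq hst fun a => by
      change (I.hub (3 * t + 2) a).tab = _
      rw [e2]
  set s2 := I.hub (3 * t + 2) with hs2
  have hval2 : ∀ a b, Ends I.x I.y a b → (s2 a).val = I.ownMin (I.labels t) a b := by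
    intro a b h
    rw [e2]
    exact reportInf_fst hst hl h
  have hq2 : ∀ a, (s2 a).query = id := fun a => by rw [e2]
  have e3 : ∀ a, I.hub (3 * t + 3) a = ⟨(s2 a).tab, ownPointer (I.inp a) (s2 a) (I.ups s2 a),
      ownPointer (I.inp a) (s2 a) (I.ups s2 a), I.exchange s2 a,
      summaryMsg (I.inp (I.other a)) (s2 (I.other a))⟩ := by
    intro a
    change I.step s2 (3 * t + 2) a = _
    rw [step, updateHub, if_pos (by omega), if_neg (by omega), if_pos (by omega)]
  have hst3 : I.Tracks (I.hub (3 * t + 3)) (I.labels t) :=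
    tracks_of_tab_eq hst2 fun a => by
      change (I.hub (3 * t + 3) a).tab = _
      rw [e3]
  set s3 := I.hub (3 * t + 3) with hs3
  have hval3 : ∀ a b, Ends I.x I.y a b → ∀ v, Active B I.H I.C a b v →
      (s3 a).val (I.labels t v) = pointer I.rest I.special (I.labels t) (I.labels t v) := by
    intro a b h v hv
    rw [e3]
    exact ownPointer_eq hst2 hl hval2 hq2 h hv
  have hq3 : ∀ a, (s3 a).query = (s3 a).val := fun a => by rw [e3]
  have e4 : ∀ a, (I.hub (3 * (t + 1) + 1) a).tab =
      eventualRep (knownPointer (I.inp a) (s3 a) (I.ups s3 a)) ∘ (s3 a).tab := by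
    intro a
    change (I.step s3 (3 * t + 3) a).tab = _
    rw [step, updateHub, if_pos (by omega), if_neg (by omega), if_neg (by omega)]
  refine ⟨fun a b h => hub_summary _ h, fun a b h v hv => ?_⟩
  rw [e4, Function.comp_apply, hst3.tab a b h v hv, labels_succ]
  have key : ∀ L ∈ I.known (I.labels t) a b, knownPointer (I.inp a) (s3 a) (I.ups s3 a) L =
      pointer I.rest I.special (I.labels t) L := fun L hL =>
    knownPointer_eq hst3 hl hval3 hq3 h hL
  refine eventualRep_congr key (fun L hL => ?_) (D := I.known (I.labels t) a b) ?_
  · rw [key L hL]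
    exact known_closed hl h hL
  · by_cases hs : I.labels t v ∈ I.special
    · exact Or.inl hs
    · have := (act_iff h v).1 (hl.act hs)
      refine Or.inr ⟨v, this.resolve_right fun hb => ?_, Or.inl rfl⟩
      exact not_active_of_isAncestor h.symm hv.1.1 hb

lemma tracks_start : I.Tracks (I.hub 1) (I.labels 0) := by
  refine ⟨fun a b h => hub_summary _ h, fun a b h v hv => ?_⟩
  have : (I.hub 1 a).tab = id := by
    change (I.step (I.hub 0) 0 a).tab = id
    rw [step, updateHub, if_neg (by omega)]
    rfl
  rw [this]
  exact (label0_sensitive h hv).symm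

lemma tracks_phases : ∀ t ≤ T, I.Tracks (I.hub (3 * t + 1)) (I.labels t)
  | 0, _ => tracks_start
  | t + 1, ht => tracks_phase ht (tracks_phases t (by omega))

/-- After the last phase the ends know the final labels of their components and neighbours. -/
lemma tracks_end : I.Tracks (I.hub (3 * T + 1)) (I.labels T) ∧
    I.Tracks (I.hub (3 * T + 2)) (I.labels T) := by
  refine ⟨tracks_phases T le_rfl, tracks_of_tab_eq (tracks_phases T le_rfl) fun a => ?_⟩
  rw [step, updateHub, if_neg (by omega)]

end Setting

end CutPair

namespace CutPair

open RootedNetwork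

namespace Setting

variable {V : Type*} [Fintype V] {S : SketchScheme} {B K T : ℕ} (I : Setting V S B K T)

/-! ### Sketches of the classes -/

/-- The sketch of the edge between two vertices. -/
noncomputable def edgeSketch (v u : V) : Fin S.len → ZMod 2 :=
  S.edge I.seed s(I.H.ext v, I.H.ext u)

open Classical in
/-- The sketch of the edges leaving `A` in the graph without `x` and `y`. -/
noncomputable def cutSketch (A : Set V) : Fin S.len → ZMod 2 :=
  ∑ v with v ∈ A, ∑ u with I.rest.Adj v u, I.edgeSketch v u

variable {I} {l : V → Label B} {t : ℕ}

lemma edgeSketch_comm (v u : V) : I.edgeSketch v u = I.edgeSketch u v := by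
  rw [edgeSketch, edgeSketch, Sym2.eq_swap]

lemma add_self_sketch {m : ℕ} (f : Fin m → ZMod 2) : f + f = 0 := by
  funext i; exact CharTwo.add_self_eq_zero _

lemma cutSketch_union {A A' : Set V} (h : Disjoint A A') :
    I.cutSketch (A ∪ A') = I.cutSketch A + I.cutSketch A' := by
  classical
  unfold cutSketch
  rw [← Finset.sum_union]
  · refine Finset.sum_congr ?_ fun _ _ => rfl
    ext v; simp
  · rw [Finset.disjoint_left]
    intro v hv hv'
    simp only [Finset.mem_filter, Finset.mem_univ, true_and] at hv hv'
    exact Set.disjoint_left.1 h hv hv'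

open Classical in
lemma cutSketch_eq (A : Set V) : I.cutSketch A =
    ∑ e : V × V with I.rest.Adj e.1 e.2 ∧ e.1 ∈ A ∧ e.2 ∉ A, I.edgeSketch e.1 e.2 := by
  have h1 : I.cutSketch A =
      ∑ e : V × V with I.rest.Adj e.1 e.2 ∧ e.1 ∈ A, I.edgeSketch e.1 e.2 := by
    rw [cutSketch, Finset.sum_sigma']
    refine Finset.sum_bij' (fun e _ => (e.1, e.2)) (fun e _ => ⟨e.1, e.2⟩) ?_ ?_ ?_ ?_ ?_
    all_goals simp +contextual
  -- Inner edges are counted once in each direction and cancel in characteristic two.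
  have h2 : ∑ e : V × V with I.rest.Adj e.1 e.2 ∧ e.1 ∈ A ∧ e.2 ∈ A, I.edgeSketch e.1 e.2 = 0 := by
    refine Finset.sum_involution (fun e _ => (e.2, e.1)) ?_ ?_ ?_ ?_
    · intro e _
      rw [edgeSketch_comm e.2 e.1, add_self_sketch]
    · intro e he _ h
      simp only [Finset.mem_filter, Finset.mem_univ, true_and] at he
      exact he.1.ne (congrArg Prod.fst h).symm
    · intro e he
      simp only [Finset.mem_filter, Finset.mem_univ, true_and] at he ⊢
      exact ⟨he.1.symm, he.2.2, he.2.1⟩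
    · intro e _; rfl
  rw [h1, ← Finset.sum_filter_add_sum_filter_not _ (fun e : V × V => e.2 ∈ A),
    Finset.filter_filter, Finset.filter_filter]
  simp only [and_assoc]
  rw [h2, zero_add]

lemma finsum_mem_setOf {α M : Type*} [Fintype α] [AddCommMonoid M] (P : α → Prop)
    [DecidablePred P] (f : α → M) : ∑ᶠ a ∈ {a | P a}, f a = ∑ a with P a, f a := by
  rw [← finsum_mem_coe_finset]
  simp

-- A component is a disjoint union of child subtrees, so the subtree sketches held by `a` add up to
-- the vertex sketches of its part of the class, silent heavy component included.
open Classical in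
lemma childSketch_eq {st : V → HubState B S.len} (hst : I.Tracks st l) {a b : V}
    (h : Ends I.x I.y a b) (hl : I.Merged l t) (U : Label B) :
    ∑ᶠ ci ∈ {ci ∈ (I.inp a).children | SensitiveChild (I.inp a) ci ∧
      (st a).tab (lab B ci.compID) = U}, ci.sketch =
      ∑ v with Sensitive I.C a b v ∧ l v = U, S.vertex I.H I.seed v := by
  have h1 : {ci ∈ (I.inp a).children | SensitiveChild (I.inp a) ci ∧
      (st a).tab (lab B ci.compID) = U} = childInfo I.H I.C S I.seed a ''
        {c | I.N.IsChild a c ∧ Sensitive I.C a b c ∧ l c = U} := by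
    ext ci
    constructor
    · rintro ⟨⟨c, hc, rfl⟩, h2, h3⟩
      have h2 := (sensitiveChild_localInput I.isPath I.ind h hc).1 h2
      exact ⟨c, ⟨hc, h2, by rw [← hst.tab a b h c h2]; exact h3⟩, rfl⟩
    · rintro ⟨c, ⟨hc, h2, h3⟩, rfl⟩
      exact ⟨⟨c, hc, rfl⟩, (sensitiveChild_localInput I.isPath I.ind h hc).2 h2,
        by rw [← h3, ← hst.tab a b h c h2]; rfl⟩
  have hinj : Set.InjOn (childInfo I.H I.C S I.seed a)
      {c | I.N.IsChild a c ∧ Sensitive I.C a b c ∧ l c = U} := fun c _ c' _ hcc =>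
    I.N.ident_injective (congrArg (fun ci => ci.me.id) hcc)
  rw [h1, finsum_mem_image hinj, finsum_mem_setOf]
  change ∑ c with I.N.IsChild a c ∧ Sensitive I.C a b c ∧ l c = U,
    (∑ v with v ∈ I.N.subtree c, S.vertex I.H I.seed v) = _
  rw [← Finset.sum_biUnion]
  · refine Finset.sum_congr ?_ fun _ _ => rfl
    ext v
    simp only [Finset.mem_biUnion, Finset.mem_filter, Finset.mem_univ, true_and]
    constructor
    · rintro ⟨c, ⟨hc, hs, hcU⟩, hv⟩
      have hm := mem_comp_of_isAncestor hs.1 hv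
      exact ⟨hs.congr hm, (hl.comp a b h c v hm).trans hcU⟩
    · rintro ⟨hs, hvU⟩
      obtain ⟨c, hc, hcv, hm⟩ := exists_child_comp hs.1
      exact ⟨c, ⟨hc, hs.congr (mem_comp_symm hm), (hl.comp a b h c v hm).symm.trans hvU⟩, hcv⟩
  · intro c hc c' hc' hne
    rw [Function.onFun, Finset.disjoint_left]
    intro v hv hv'
    simp only [Finset.coe_filter, Finset.mem_univ, true_and, Set.mem_ofPred_eq,
      Finset.mem_filter] at hc hc' hv hv'
    exact hne (child_unique hc.1 hc'.1 hv hv')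

open Classical in
lemma neighbourSketch_eq {st st' : V → HubState B S.len} (hst : I.Tracks st l)
    (hst' : I.Tracks st' l) {a b : V}
    (h : Ends I.x I.y a b) (hl : I.Merged l t) (hh : (st' a).heard = I.exchange st a)
    (U : Label B) :
    ∑ᶠ q ∈ {q ∈ (I.inp a).neighbours | neighbourLabel (lab B (I.inp a).self.me.id)
      (lab B (otherID (I.inp a))) (heavyLabel B (I.inp a)) ((st' a).summary.1 0) (st' a).heard q
        = U}, S.edge (I.inp a).seed s((I.inp a).self.me, q.me) =
      ∑ v with I.N.graph.Adj a v ∧ l v = U, I.edgeSketch a v := by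
  have e1 : heavyLabel B (I.inp a) = heavyCompLabel B I.H I.C a b :=
    heavyLabel_localInput I.isPath I.ind h
  have e2 : otherID (I.inp a) = I.N.ident b := otherID_localInput I.isPath I.ind.ne h
  rw [e1, e2, hst'.summary a b h, hh]
  have key : ∀ w, I.N.graph.Adj a w → neighbourLabel (lab B (I.inp a).self.me.id)
      (lab B (I.N.ident b)) (heavyCompLabel B I.H I.C a b) (heavyCompLabel B I.H I.C b a)
      (I.exchange st a) (publicInfo I.H I.C w) = l w := fun w hw =>
    neighbourLabel_eq hst hl h (exchange_ident st hw.symm)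
  have h1 : {q ∈ (I.inp a).neighbours | neighbourLabel (lab B (I.inp a).self.me.id)
      (lab B (I.N.ident b)) (heavyCompLabel B I.H I.C a b) (heavyCompLabel B I.H I.C b a)
      (I.exchange st a) q = U} = publicInfo I.H I.C '' {w | I.N.graph.Adj a w ∧ l w = U} := by
    ext q
    constructor
    · rintro ⟨⟨w, hw, rfl⟩, h2⟩
      exact ⟨w, ⟨hw, (key w hw).symm.trans h2⟩, rfl⟩
    · rintro ⟨w, ⟨hw, h2⟩, rfl⟩
      exact ⟨⟨w, hw, rfl⟩, (key w hw).trans h2⟩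
  have hinj : Set.InjOn (publicInfo I.H I.C) {w | I.N.graph.Adj a w ∧ l w = U} :=
    fun c _ c' _ hcc => I.N.ident_injective (congrArg (fun ci => ci.me.id) hcc)
  rw [h1, finsum_mem_image hinj, finsum_mem_setOf]
  rfl

-- The sketch of `v` also contains its edges to the two ends; adding them a second time removes
-- them.
open Classical in
lemma vertex_add_ends {a b v : V} (h : Ends I.x I.y a b) (hv : v ≠ a ∧ v ≠ b) :
    S.vertex I.H I.seed v + (if I.N.graph.Adj a v then I.edgeSketch a v else 0) +
      (if I.N.graph.Adj b v then I.edgeSketch b v else 0) =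
      ∑ u with I.rest.Adj v u, I.edgeSketch v u := by
  have hab := (h.independent I.ind).ne
  have h1 : S.vertex I.H I.seed v =
      ∑ u, if I.N.graph.Adj v u then I.edgeSketch v u else 0 := by
    rw [← Finset.sum_filter]
    rfl
  have hrest : ∀ u, I.rest.Adj v u ↔ I.N.graph.Adj v u ∧ u ≠ a ∧ u ≠ b := by
    intro u
    have e1 := (ends_or (v := v) h)
    have e2 := (ends_or (v := u) h)
    change I.N.graph.Adj v u ∧ (v ≠ I.x ∧ v ≠ I.y) ∧ (u ≠ I.x ∧ u ≠ I.y) ↔ _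
    rw [← not_or, ← not_or, e1, e2, not_or, not_or]
    tauto
  have h2 : ∑ u with I.rest.Adj v u, I.edgeSketch v u =
      ∑ u, if I.rest.Adj v u then I.edgeSketch v u else 0 := Finset.sum_filter _ _
  have h3 : (if I.N.graph.Adj a v then I.edgeSketch a v else 0) =
      ∑ u, if u = a then (if I.N.graph.Adj v u then I.edgeSketch v u else 0) else 0 := by
    rw [Finset.sum_ite_eq' Finset.univ a, if_pos (Finset.mem_univ _)]
    simp only [edgeSketch_comm a v, I.N.graph.adj_comm a v]
  have h4 : (if I.N.graph.Adj b v then I.edgeSketch b v else 0) =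
      ∑ u, if u = b then (if I.N.graph.Adj v u then I.edgeSketch v u else 0) else 0 := by
    rw [Finset.sum_ite_eq' Finset.univ b, if_pos (Finset.mem_univ _)]
    simp only [edgeSketch_comm b v, I.N.graph.adj_comm b v]
  rw [h1, h2, h3, h4, ← Finset.sum_add_distrib, ← Finset.sum_add_distrib]
  refine Finset.sum_congr rfl fun u _ => ?_
  by_cases hadj : I.N.graph.Adj v u
  · by_cases hua : u = a
    · have hub : u ≠ b := hua ▸ hab
      rw [if_pos hadj, if_pos hua, if_neg hub, if_neg (fun hr => ((hrest u).1 hr).2.1 hua),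
        add_zero, add_self_sketch]
    · by_cases hub : u = b
      · rw [if_pos hadj, if_neg hua, if_pos hub, if_neg (fun hr => ((hrest u).1 hr).2.2 hub),
          add_zero, add_self_sketch]
      · rw [if_pos hadj, if_neg hua, if_neg hub, if_pos ((hrest u).2 ⟨hadj, hua, hub⟩),
          add_zero, add_zero]
  · rw [if_neg hadj, if_neg (fun hr => hadj ((hrest u).1 hr).1)]
    simp

lemma Merged.sensitive (hl : I.Merged l t) {v : V} (h : l v ≠ ⊤) (h0 : l v ≠ 0) :
    ∃ a b, Ends I.x I.y a b ∧ Sensitive I.C a b v := by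
  by_cases hv : I.Act v
  · obtain ⟨a, b, hab, hv⟩ := hv.ends
    exact ⟨a, b, hab, hv.1⟩
  · rw [hl.inactive v hv] at h h0
    exact exists_sensitive h h0

/-- The two ends together know the sketch of the cut of a class. -/
lemma classSketch_add {st st' : V → HubState B S.len} (hst : I.Tracks st l)
    (hst' : I.Tracks st' l) (hh : ∀ a, (st' a).heard = I.exchange st a)
    {a b : V} (h : Ends I.x I.y a b) (hl : I.Merged l t) {U : Label B} (hU : U ≠ 0)
    (hU' : U ≠ ⊤) :
    classSketch (I.inp a) (st' a) U + classSketch (I.inp b) (st' b) U =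
      I.cutSketch {v | l v = U} := by
  classical
  rw [classSketch, if_neg hU, classSketch, if_neg hU, childSketch_eq hst' h hl,
    childSketch_eq hst' h.symm hl, neighbourSketch_eq hst hst' h hl (hh a),
    neighbourSketch_eq hst hst' h.symm hl (hh b)]
  -- A class other than those of `0` and `⊤` consists of sensitive vertices, each below exactly one
  -- of the ends.
  have hsum : ∑ v with l v = U, S.vertex I.H I.seed v =
      ∑ v with Sensitive I.C a b v ∧ l v = U, S.vertex I.H I.seed v +
      ∑ v with Sensitive I.C b a v ∧ l v = U, S.vertex I.H I.seed v := by
    rw [← Finset.sum_union]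
    · refine Finset.sum_congr ?_ fun _ _ => rfl
      ext v
      simp only [Finset.mem_filter, Finset.mem_univ, true_and, Finset.mem_union]
      constructor
      · intro hv
        obtain ⟨a', b', h', hs⟩ := hl.sensitive (hv ▸ hU') (hv ▸ hU)
        rcases h with ⟨rfl, rfl⟩ | ⟨rfl, rfl⟩ <;> rcases h' with ⟨rfl, rfl⟩ | ⟨rfl, rfl⟩
        exacts [Or.inl ⟨hs, hv⟩, Or.inr ⟨hs, hv⟩, Or.inr ⟨hs, hv⟩, Or.inl ⟨hs, hv⟩]
      · rintro (hv | hv) <;> exact hv.2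
    · rw [Finset.disjoint_left]
      intro v hv hv'
      simp only [Finset.mem_filter, Finset.mem_univ, true_and] at hv hv'
      exact not_sensitive h hv'.1.1.1 hv.1
  have hnb : ∀ a, ∑ v with I.N.graph.Adj a v ∧ l v = U, I.edgeSketch a v =
      ∑ v with l v = U, if I.N.graph.Adj a v then I.edgeSketch a v else 0 := by
    intro a
    rw [← Finset.sum_filter, Finset.filter_filter]
    simp only [and_comm]
  rw [hnb a, hnb b, add_add_add_comm, ← hsum, ← add_assoc, ← Finset.sum_add_distrib,
    ← Finset.sum_add_distrib, cutSketch]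
  refine Finset.sum_congr (by ext v; simp) fun v hv => ?_
  simp only [Finset.mem_filter, Finset.mem_univ, true_and] at hv
  refine vertex_add_ends h ⟨?_, ?_⟩
  · rintro rfl
    exact hU' (hv.symm.trans (hl.end_eq h))
  · rintro rfl
    exact hU' (hv.symm.trans (hl.end_eq h.symm))

/-! ### The decision -/

variable (I) in
/-- The cut sketches that the ends test vanish only if the cuts are empty. -/
def Faithful (A : Set V) : Prop := Leaves I.rest A → I.cutSketch A ≠ 0

lemma leaves_of_cutSketch_ne {A : Set V} (h : I.cutSketch A ≠ 0) : Leaves I.rest A := by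
  classical
  rw [cutSketch_eq] at h
  obtain ⟨e, he, -⟩ := Finset.exists_ne_zero_of_sum_ne_zero h
  simp only [Finset.mem_filter, Finset.mem_univ, true_and] at he
  exact ⟨_, _, he⟩

lemma Faithful.iff {A : Set V} (h : I.Faithful A) : I.cutSketch A ≠ 0 ↔ Leaves I.rest A :=
  ⟨leaves_of_cutSketch_ne, h⟩

open Classical in
lemma summaryMsg_flag {st : V → HubState B S.len} (hst : I.Tracks st l) {a b : V}
    (h : Ends I.x I.y a b) : (summaryMsg (I.inp a) (st a)).1 1 = 0 ↔
      ∀ v, Active B I.H I.C a b v → l v ∈ I.special := by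
  change (if _ then (⊤ : Label B) else 0) = 0 ↔ _
  rw [hst.special h]
  have h0 := exists_mem_children (H := I.H) (C := I.C) (S := S) (seed := I.seed) (p := I.p)
    (v := a) (Q := fun ci => ActiveChild B (I.inp a) ci ∧
      (st a).tab (lab B ci.compID) ∉ I.special)
  have h1 : ∀ c, I.N.IsChild a c → (ActiveChild B (I.inp a) (childInfo I.H I.C S I.seed a c) ↔
    Active B I.H I.C a b c) := fun c hc => activeChild_localInput I.isPath I.ind h hc
  have h2 : (∃ ci ∈ (I.inp a).children, ActiveChild B (I.inp a) ci ∧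
      (st a).tab (lab B ci.compID) ∉ I.special) ↔
      ∃ v, Active B I.H I.C a b v ∧ l v ∉ I.special := by
    refine h0.trans ⟨?_, ?_⟩
    · rintro ⟨c, hc, hca, hcl⟩
      have hca := (h1 c hc).1 hca
      exact ⟨c, hca, by rw [← hst.tab a b h c hca.1]; exact hcl⟩
    · rintro ⟨v, hv, hvl⟩
      obtain ⟨c, hc, -, hcv⟩ := exists_child_comp hv.1.1
      have hca := hv.congr (mem_comp_symm hcv)
      refine ⟨c, hc, (h1 c hc).2 hca, ?_⟩
      rw [← hst.tab a b h v hv.1, compID_congr hcv] at hvl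
      exact hvl
  by_cases hex : ∃ v, Active B I.H I.C a b v ∧ l v ∉ I.special
  · rw [if_pos (h2.2 hex)]
    refine ⟨fun h => absurd h.symm (zero_ne_top B), fun hall => ?_⟩
    obtain ⟨v, hv, hvl⟩ := hex
    exact absurd (hall v hv) hvl
  · rw [if_neg (h2.not.2 hex)]
    push Not at hex
    exact ⟨fun _ => hex, fun _ => rfl⟩

lemma decision_iff_leaves {st st' : V → HubState B S.len} (hst : I.Tracks st l)
    (hst' : I.Tracks st' l) (hh : ∀ a, (st' a).heard = I.exchange st a)
    {a b : V} (h : Ends I.x I.y a b) (hl : I.Merged l t)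
    (f1 : I.Faithful {v | l v = heavyCompLabel B I.H I.C a b})
    (f2 : I.Faithful {v | l v = heavyCompLabel B I.H I.C b a})
    (f12 : I.Faithful {v | l v = heavyCompLabel B I.H I.C a b ∨
      l v = heavyCompLabel B I.H I.C b a}) :
    decision (summaryMsg (I.inp a) (st' a)) (summaryMsg (I.inp b) (st' b)) = true ↔
      (∀ v, l v ∈ I.special) ∧
      (heavyCompLabel B I.H I.C a b ≠ 0 →
        Leaves I.rest {v | l v = heavyCompLabel B I.H I.C a b}) ∧
      (heavyCompLabel B I.H I.C b a ≠ 0 →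
        Leaves I.rest {v | l v = heavyCompLabel B I.H I.C b a}) ∧
      (heavyCompLabel B I.H I.C a b ≠ 0 → heavyCompLabel B I.H I.C b a ≠ 0 →
        Leaves I.rest {v | l v = heavyCompLabel B I.H I.C a b ∨
          l v = heavyCompLabel B I.H I.C b a}) := by
  have ea : heavyLabel B (I.inp a) = heavyCompLabel B I.H I.C a b :=
    heavyLabel_localInput I.isPath I.ind h
  have eb : heavyLabel B (I.inp b) = heavyCompLabel B I.H I.C b a :=
    heavyLabel_localInput I.isPath I.ind h.symm
  have m0 : (summaryMsg (I.inp a) (st' a)).1 0 = heavyCompLabel B I.H I.C a b := ea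
  have t0 : (summaryMsg (I.inp b) (st' b)).1 0 = heavyCompLabel B I.H I.C b a := eb
  have s1 : heavyCompLabel B I.H I.C a b ≠ 0 → (summaryMsg (I.inp a) (st' a)).2 0 +
      (summaryMsg (I.inp b) (st' b)).2 1 =
      I.cutSketch {v | l v = heavyCompLabel B I.H I.C a b} := by
    intro h0
    change classSketch (I.inp a) (st' a) (heavyLabel B (I.inp a)) +
      classSketch (I.inp b) (st' b) ((st' b).summary.1 0) = _
    rw [ea, hst'.summary b a h.symm]
    exact classSketch_add hst hst' hh h hl h0 heavyCompLabel_ne_top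
  have s2 : heavyCompLabel B I.H I.C b a ≠ 0 → (summaryMsg (I.inp a) (st' a)).2 1 +
      (summaryMsg (I.inp b) (st' b)).2 0 =
      I.cutSketch {v | l v = heavyCompLabel B I.H I.C b a} := by
    intro h0
    change classSketch (I.inp a) (st' a) ((st' a).summary.1 0) +
      classSketch (I.inp b) (st' b) (heavyLabel B (I.inp b)) = _
    rw [eb, hst'.summary a b h]
    exact classSketch_add hst hst' hh h hl h0 heavyCompLabel_ne_top
  have hall : (∀ v, l v ∈ I.special) ↔ (∀ v, Active B I.H I.C a b v → l v ∈ I.special) ∧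
      (∀ v, Active B I.H I.C b a v → l v ∈ I.special) := by
    refine ⟨fun h => ⟨fun v _ => h v, fun v _ => h v⟩, fun h' v => ?_⟩
    by_contra hv
    rcases (act_iff h v).1 (hl.act hv) with hv' | hv'
    exacts [hv (h'.1 v hv'), hv (h'.2 v hv')]
  have hdisj : heavyCompLabel B I.H I.C a b ≠ 0 →
      Disjoint {v | l v = heavyCompLabel B I.H I.C a b}
        {v | l v = heavyCompLabel B I.H I.C b a} := by
    intro h0
    rw [Set.disjoint_left]
    intro v hv hv'
    exact heavyCompLabel_ne h h0 ((hv : l v = _).symm.trans hv')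
  have hun : {v | l v = heavyCompLabel B I.H I.C a b ∨ l v = heavyCompLabel B I.H I.C b a} =
      {v | l v = heavyCompLabel B I.H I.C a b} ∪ {v | l v = heavyCompLabel B I.H I.C b a} := rfl
  rw [decision, decide_eq_true_iff, m0, t0, summaryMsg_flag hst' h,
    summaryMsg_flag hst' h.symm, hall, and_assoc]
  refine and_congr_right fun _ => and_congr_right fun _ => and_congr ?_ (and_congr ?_ ?_)
  · refine forall_congr' fun h0 => ?_
    rw [s1 h0, f1.iff]
  · refine forall_congr' fun h0 => ?_
    rw [s2 h0, f2.iff]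
  · refine forall_congr' fun h0 => forall_congr' fun h0' => ?_
    rw [s1 h0, s2 h0', ← cutSketch_union (hdisj h0), ← hun, f12.iff]

lemma reachable_root_iff_connected :
    (∀ v, v ≠ I.x ∧ v ≠ I.y → I.rest.Reachable I.N.root v) ↔
      (I.N.graph.induce ({I.x, I.y}ᶜ : Set V)).Connected := by
  have hmem : ∀ v, v ∈ ({I.x, I.y}ᶜ : Set V) ↔ v ≠ I.x ∧ v ≠ I.y := by
    intro v; simp
  have hroot : I.N.root ≠ I.x ∧ I.N.root ≠ I.y :=
    ⟨I.ind.ne_root.symm, I.ind.symm.ne_root.symm⟩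
  constructor
  · intro h
    rw [SimpleGraph.connected_iff_exists_forall_reachable]
    refine ⟨⟨I.N.root, (hmem _).2 hroot⟩, fun w => ?_⟩
    obtain ⟨q⟩ := h w.1 ((hmem _).1 w.2)
    have key : ∀ u v (q : I.rest.Walk u v) (hu : u ∈ ({I.x, I.y}ᶜ : Set V))
        (hv : v ∈ ({I.x, I.y}ᶜ : Set V)),
        (I.N.graph.induce ({I.x, I.y}ᶜ : Set V)).Reachable ⟨u, hu⟩ ⟨v, hv⟩ := by
      intro u v q
      induction q with
      | nil => intro _ _; exact .refl _
      | @cons u u' v hadj q ih =>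
        intro hu hv
        have hu' : u' ∈ ({I.x, I.y}ᶜ : Set V) := (hmem _).2 hadj.2.2
        refine SimpleGraph.Reachable.trans (SimpleGraph.Adj.reachable ?_) (ih hu' hv)
        exact hadj.1
    exact key _ _ q _ w.2
  · intro h v hv
    have h1 := h.preconnected ⟨I.N.root, (hmem _).2 hroot⟩ ⟨v, (hmem _).2 hv⟩
    let φ : I.N.graph.induce ({I.x, I.y}ᶜ : Set V) →g I.rest :=
      ⟨Subtype.val, fun {u w} huw => ⟨huw, (hmem _).1 u.2, (hmem _).1 w.2⟩⟩
    exact h1.map φ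

/-- The decision is correct if the tested sketches are faithful. -/
lemma decision_iff_connected (hT : Nat.card V ≤ 2 ^ T) {a b : V} (h : Ends I.x I.y a b)
    (f1 : I.Faithful {v | I.labels T v = heavyCompLabel B I.H I.C a b})
    (f2 : I.Faithful {v | I.labels T v = heavyCompLabel B I.H I.C b a})
    (f12 : I.Faithful {v | I.labels T v = heavyCompLabel B I.H I.C a b ∨
      I.labels T v = heavyCompLabel B I.H I.C b a}) :
    decision (summaryMsg (I.inp a) (I.hub (3 * T + 2) a))
      (summaryMsg (I.inp b) (I.hub (3 * T + 2) b)) = true ↔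
      (I.N.graph.induce ({I.x, I.y}ᶜ : Set V)).Connected := by
  have hl : I.Merged (I.labels T) T := merged T
  have hroot : I.labels T I.N.root = 0 := by
    change merge I.rest I.special I.label0 T (I.label0 I.N.root) = 0
    rw [label0_root, merge_special zero_mem_special]
  -- Without a sensitive heavy component the label is `0`, and the root bears it.
  have hex : ∀ a b, Ends I.x I.y a b → ∃ v, I.labels T v = heavyCompLabel B I.H I.C a b := by
    intro a b h
    by_cases h0 : heavyCompLabel B I.H I.C a b = 0
    · exact ⟨_, by rw [h0, hroot]⟩
    · obtain ⟨c, hc, he⟩ := heavyCompLabel_spec h0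
      refine ⟨c, ?_⟩
      change merge I.rest I.special I.label0 T (I.label0 c) = _
      rw [label0_sensitive h hc, ← he, merge_special (heavy_mem_special h)]
  have htop : ∀ v, I.labels T v ≠ ⊤ ↔ v ≠ I.x ∧ v ≠ I.y := by
    intro v
    rw [← label0_ne_top]
    refine ⟨fun hv h0 => hv ?_, fun hv => labelling0.merge_ne_top T hv⟩
    change merge I.rest I.special I.label0 T (I.label0 v) = ⊤
    rw [h0, merge_special top_mem_special]
  have := hl.labelling.reachable_iff (o := 0) (L₁ := heavyCompLabel B I.H I.C a b)
    (L₂ := heavyCompLabel B I.H I.C b a) hT ⟨I.x, hl.end_eq (Or.inl ⟨rfl, rfl⟩)⟩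
    zero_mem_special (zero_ne_top B)
    (fun L hL => by rw [special_eq h] at hL; exact hL)
    heavyCompLabel_ne_top heavyCompLabel_ne_top hroot (hex a b h) (hex b a h.symm)
  rw [decision_iff_leaves tracks_end.1 tracks_end.2 (fun a => step_heard _ a) h hl f1 f2 f12,
    ← this, ← reachable_root_iff_connected]
  exact forall_congr' fun v => by rw [htop]

end Setting

end CutPair

namespace CutPair

open RootedNetwork

/-! ### The fingerprint sketch -/

/-- A number that identifies an edge by the IDs of its endpoints. -/
def edgeCode : Sym2 ExtID → ℕ :=
  Sym2.lift ⟨fun a b => Nat.pair (min a.id b.id) (max a.id b.id), fun a b => by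
    simp only [min_comm, max_comm]⟩

lemma edgeCode_mk (a b : ExtID) : edgeCode s(a, b) = Nat.pair (min a.id b.id) (max a.id b.id) :=
  rfl

lemma edgeCode_lt {a b : ExtID} {B : ℕ} (ha : a.id < B) (hb : b.id < B) :
    edgeCode s(a, b) < B ^ 2 := by
  rw [edgeCode_mk]
  refine (Nat.pair_lt_max_add_one_sq _ _).trans_le (Nat.pow_le_pow_left ?_ 2)
  omega

open Polynomial in
/-- A scheme whose sketches of a nonempty edge set vanish for few seeds only: the edge of code `k`
is mapped to `α ^ k` for a random element `α` of the field with `2 ^ m` elements. -/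
lemma exists_fingerprint {m : ℕ} (hm : m ≠ 0) : ∃ S : SketchScheme, S.seedLen = m ∧ S.len = m ∧
    ∀ (E : Finset (Sym2 ExtID)) (M : ℕ), E.Nonempty → Set.InjOn edgeCode E →
      (∀ e ∈ E, edgeCode e < M) → {seed | ∑ e ∈ E, S.edge seed e = 0}.ncard ≤ M := by
  classical
  have hcard : Nat.card (Fin m → Bool) = Nat.card (GaloisField 2 m) := by
    rw [GaloisField.card 2 m hm]; simp
  let e₁ : (Fin m → Bool) ≃ GaloisField 2 m := (Finite.card_eq.1 hcard).some
  let e₂ : GaloisField 2 m ≃ₗ[ZMod 2] (Fin m → ZMod 2) :=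
    (Module.finBasisOfFinrankEq (ZMod 2) (GaloisField 2 m) (GaloisField.finrank 2 hm)).equivFun
  refine ⟨⟨m, m, fun seed e => e₂ (e₁ seed ^ edgeCode e)⟩, rfl, rfl, fun E M hE hinj hM => ?_⟩
  set Q : (GaloisField 2 m)[X] := ∑ e ∈ E, X ^ edgeCode e with hQ
  have hQ0 : Q ≠ 0 := by
    obtain ⟨e₀, he₀⟩ := hE
    intro h
    -- Distinct edges have distinct codes, so no monomials cancel.
    have hc : Q.coeff (edgeCode e₀) = 1 := by
      rw [hQ, finsetSum_coeff, Finset.sum_eq_single e₀]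
      · rw [coeff_X_pow, if_pos rfl]
      · intro e he hne
        rw [coeff_X_pow, if_neg fun hc => hne (hinj he he₀ hc.symm)]
      · exact fun h => absurd he₀ h
    rw [h, coeff_zero] at hc
    exact zero_ne_one hc
  have hdeg : Q.natDegree ≤ M := by
    refine natDegree_sum_le_of_forall_le E _ fun e he => ?_
    rw [natDegree_X_pow]
    exact (hM e he).le
  calc _ ≤ (e₁ ⁻¹' (Q.roots.toFinset : Set (GaloisField 2 m))).ncard := by
        refine Set.ncard_le_ncard (fun seed hs => ?_) (Set.toFinite _)
        have hs' : ∑ e ∈ E, e₂ (e₁ seed ^ edgeCode e) = 0 := hs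
        rw [← map_sum, LinearEquiv.map_eq_zero_iff] at hs'
        simp only [Set.mem_preimage, Finset.mem_coe, Multiset.mem_toFinset, mem_roots hQ0,
          IsRoot.def]
        rw [hQ, eval_finsetSum]
        simpa using hs'
    _ = (Q.roots.toFinset : Set (GaloisField 2 m)).ncard := by
        refine Set.ncard_preimage_of_injective_subset_range e₁.injective ?_
        simp [e₁.surjective.range_eq]
    _ ≤ Q.roots.card := by
        rw [Set.ncard_coe_finset]
        exact Multiset.toFinset_card_le _
    _ ≤ M := (card_roots' Q).trans hdeg

namespace Setting

variable {V : Type*} [Fintype V] {S : SketchScheme} {B K T : ℕ} (I : Setting V S B K T)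

/-- The same setting with another seed. -/
def withSeed (seed : Fin S.seedLen → Bool) : Setting V S B K T := { I with seed := seed }

open Classical in
/-- The edges of the graph without `x` and `y` that leave `A`. -/
noncomputable def cutEdges (A : Set V) : Finset (Sym2 ExtID) :=
  (Finset.univ.filter fun e : V × V => I.rest.Adj e.1 e.2 ∧ e.1 ∈ A ∧ e.2 ∉ A).image
    fun e => s(I.H.ext e.1, I.H.ext e.2)

variable {I}

lemma mem_cutEdges {A : Set V} {e : Sym2 ExtID} : e ∈ I.cutEdges A ↔
    ∃ v u, I.rest.Adj v u ∧ v ∈ A ∧ u ∉ A ∧ s(I.H.ext v, I.H.ext u) = e := by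
  simp [cutEdges, and_assoc]

lemma cutSketch_eq_sum (A : Set V) : I.cutSketch A = ∑ e ∈ I.cutEdges A, S.edge I.seed e := by
  classical
  rw [cutSketch_eq, cutEdges, Finset.sum_image]
  · rfl
  · rintro ⟨v, u⟩ he ⟨v', u'⟩ he' h
    simp only [Finset.coe_filter, Finset.mem_univ, true_and, Set.mem_ofPred_eq] at he he'
    rcases Sym2.eq_iff.1 h with ⟨h1, h2⟩ | ⟨h1, h2⟩
    · exact Prod.ext (I.H.ext_injective h1) (I.H.ext_injective h2)
    · obtain rfl : v = u' := I.H.ext_injective h1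
      exact absurd he.2.1 he'.2.2

lemma edgeCode_injOn (A : Set V) : Set.InjOn edgeCode (I.cutEdges A : Set (Sym2 ExtID)) := by
  intro e he e' he' h
  obtain ⟨v, u, -, -, -, rfl⟩ := mem_cutEdges.1 he
  obtain ⟨v', u', -, -, -, rfl⟩ := mem_cutEdges.1 he'
  rw [edgeCode_mk, edgeCode_mk] at h
  have h1 := (Nat.pair_eq_pair.1 h)
  have inj : ∀ {v w}, (I.H.ext v).id = (I.H.ext w).id → v = w := fun h => I.N.ident_injective h
  have h2 : ((I.H.ext v).id = (I.H.ext v').id ∧ (I.H.ext u).id = (I.H.ext u').id) ∨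
      ((I.H.ext v).id = (I.H.ext u').id ∧ (I.H.ext u).id = (I.H.ext v').id) := by omega
  rcases h2 with ⟨h3, h4⟩ | ⟨h3, h4⟩
  · rw [inj h3, inj h4]
  · rw [inj h3, inj h4, Sym2.eq_swap]

/-- Few seeds are unfaithful on a given set. -/
lemma ncard_not_faithful (hS : ∀ (E : Finset (Sym2 ExtID)) (M : ℕ), E.Nonempty →
      Set.InjOn edgeCode E → (∀ e ∈ E, edgeCode e < M) →
      {seed | ∑ e ∈ E, S.edge seed e = 0}.ncard ≤ M) (A : Set V) :
    {seed | ¬ (I.withSeed seed).Faithful A}.ncard ≤ B ^ 2 := by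
  by_cases hA : Leaves I.rest A
  · have hne : (I.cutEdges A).Nonempty := by
      obtain ⟨v, u, h1, h2, h3⟩ := hA
      exact ⟨_, mem_cutEdges.2 ⟨v, u, h1, h2, h3, rfl⟩⟩
    refine (Set.ncard_le_ncard ?_ (Set.toFinite _)).trans
      (hS (I.cutEdges A) (B ^ 2) hne (edgeCode_injOn A) fun e he => ?_)
    · intro seed hs
      by_contra hns
      refine hs fun _ h0 => hns ?_
      rw [cutSketch_eq_sum] at h0
      exact h0
    · obtain ⟨v, u, -, -, -, rfl⟩ := mem_cutEdges.1 he
      exact edgeCode_lt (I.ident_lt v) (I.ident_lt u)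
  · have : {seed | ¬ (I.withSeed seed).Faithful A} = ∅ := by
      rw [Set.eq_empty_iff_forall_notMem]
      exact fun seed hs => hs fun h => absurd h hA
    rw [this, Set.ncard_empty]
    exact Nat.zero_le _

/-! ### Edges in use and congestion -/

lemma Act.mem_LDS {v : V} (h : I.Act v) : v ∈ LDS I.H I.C I.x I.y ∪ LDS I.H I.C I.y I.x := by
  rcases h with h | h
  exacts [Or.inl h.mem_LDS, Or.inr h.mem_LDS]

lemma act_of_down? {st : V → HubState B S.len} {v : V} (h : I.down? st v ≠ none) : I.Act v := by
  by_contra hv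
  exact h (by rw [down?, if_neg hv])

lemma act_of_up? {st : V → HubState B S.len} {v : V} (h : I.up? st v ≠ none) : I.Act v := by
  by_contra hv
  exact h (by rw [up?, if_neg hv])

lemma along_ne_none {st : V → HubState B S.len} {i : ℕ} {u v : V} (h : I.along st i u v ≠ none) :
    i < I.p.length ∧ ((u = I.p.getVert i ∧ v = I.p.getVert (i + 1)) ∨
      (u = I.p.getVert (I.p.length - i) ∧ v = I.p.getVert (I.p.length - i - 1))) := by
  unfold along at h
  split_ifs at h with h1 h2
  · exact ⟨h1.1, Or.inl h1.2⟩
  · exact ⟨h2.1, Or.inr h2.2⟩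
  · exact absurd rfl h

lemma getVert_edge {i : ℕ} (hi : i < I.p.length) :
    s(I.p.getVert i, I.p.getVert (i + 1)) ∈ I.p.edges :=
  (SimpleGraph.Walk.mk_mem_edges_iff_exists _).2 ⟨i, hi, rfl⟩

lemma content_edge {t : ℕ} {u v : V} (h : I.content t u v ≠ none) :
    s(u, v) ∈ I.p.edges ∨ u ∈ LDS I.H I.C I.x I.y ∪ LDS I.H I.C I.y I.x ∨
      v ∈ LDS I.H I.C I.x I.y ∪ LDS I.H I.C I.y I.x := by
  unfold content slot at h
  split_ifs at h with h1 h2 h3 h4 h5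
  · exact Or.inr (Or.inr (act_of_down? h).mem_LDS)
  · exact absurd rfl h
  · exact Or.inr (Or.inl (act_of_down? h).mem_LDS)
  · exact Or.inr (Or.inl (act_of_up? h).mem_LDS)
  · exact absurd rfl h
  · left
    obtain ⟨hi, ⟨rfl, rfl⟩ | ⟨rfl, rfl⟩⟩ := along_ne_none h
    · exact getVert_edge hi
    · have := I.getVert_edge (i := I.p.length -
        (t % slotLength K I.N.depth - pathRound I.N.depth) - 1) (by omega)
      rw [Nat.sub_add_cancel (by omega)] at this
      rwa [Sym2.eq_swap]

/-- Per slot a vertex can speak only once downwards, once in the exchange, once upwards, and once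
for each of the two messages passing along the path. These rounds do not depend on the states. -/
lemma exists_rounds (u : V) : ∃ Z : Finset ℕ, Z.card ≤ 5 ∧
    ∀ (st : V → HubState B S.len) (r : ℕ) (v : V), I.slot st r u v ≠ none → r ∈ Z := by
  classical
  obtain ⟨k, hk⟩ : ∃ k, u ∈ I.p.support → k ≤ I.p.length ∧ I.p.getVert k = u := by
    by_cases hu : u ∈ I.p.support
    · obtain ⟨k, h1, h2⟩ := exists_getVert hu
      exact ⟨k, fun _ => ⟨h1, h2⟩⟩
    · exact ⟨0, fun h => absurd h hu⟩
  refine ⟨{I.N.level u, I.N.depth + 1, 2 * I.N.depth + 2 - I.N.level u, pathRound I.N.depth + k,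
    pathRound I.N.depth + (I.p.length - k)}, Finset.card_le_five, fun st r v h => ?_⟩
  simp only [Finset.mem_insert, Finset.mem_singleton]
  unfold slot at h
  split_ifs at h with h1 h2 h3 h4 h5
  · exact Or.inl h2.1
  · exact absurd rfl h
  · exact Or.inr (Or.inl h3)
  · exact Or.inr (Or.inr (Or.inl h5.1))
  · exact absurd rfl h
  · obtain ⟨hi, h'⟩ := along_ne_none h
    have hu : u ∈ I.p.support := by
      rcases h' with ⟨rfl, -⟩ | ⟨rfl, -⟩ <;> exact I.p.getVert_mem_support _
    obtain ⟨hk1, hk2⟩ := hk hu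
    have inj : ∀ {m}, m ≤ I.p.length → u = I.p.getVert m → k = m := fun hm h =>
      I.isPath.getVert_injOn hk1 hm (hk2.trans h)
    rcases h' with ⟨h', -⟩ | ⟨h', -⟩
    · have := inj hi.le h'
      omega
    · have := inj (by omega) h'
      omega

/-- The number of messages sent over an edge in one direction. -/
lemma ncard_content_le (R : ℕ) (u v : V) :
    {t | t < R * slotLength K I.N.depth ∧ I.content t u v ≠ none}.ncard ≤ 5 * R := by
  classical
  obtain ⟨Z, hZ, hZ'⟩ := I.exists_rounds u
  have hL : 0 < slotLength K I.N.depth := by simp only [slotLength]; omega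
  calc _ ≤ ((((Finset.range R ×ˢ Z).image fun e => slotLength K I.N.depth * e.1 + e.2) :
        Finset ℕ) : Set ℕ).ncard := by
        refine Set.ncard_le_ncard ?_ (Finset.finite_toSet _)
        rintro t ⟨ht, hc⟩
        rw [Finset.mem_coe, Finset.mem_image]
        refine ⟨(t / slotLength K I.N.depth, t % slotLength K I.N.depth), ?_,
          Nat.div_add_mod _ _⟩
        rw [Finset.mem_product, Finset.mem_range]
        exact ⟨(Nat.div_lt_iff_lt_mul hL).2 ht, hZ' _ _ _ hc⟩
    _ ≤ (Finset.range R ×ˢ Z).card := by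
        rw [Set.ncard_coe_finset]
        exact Finset.card_image_le
    _ ≤ 5 * R := by
        rw [Finset.card_product, Finset.card_range, mul_comm]
        exact Nat.mul_le_mul_right _ hZ

/-- The output of the two ends. -/
lemma outputBit_content {t : ℕ} {a b : V} (h : Ends I.x I.y a b)
    (ht : (3 * T + 3) * slotLength K I.N.depth ≤ t) :
    outputBit (I.inp a) K T (received I.N I.content t a) =
      some (decision (summaryMsg (I.inp a) (I.hub (3 * T + 2) a))
        (summaryMsg (I.inp b) (I.hub (3 * T + 2) b))) := by
  have hle : (3 * T + 2) * slotLength K I.N.depth ≤ t :=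
    (Nat.mul_le_mul_right _ (by omega)).trans ht
  rw [outputBit, hubState_content h hle, hubState_content h ht]
  have : (I.hub (3 * T + 3) a).summary = _ := step_summary (3 * T + 2) a
  rw [this, other_eq h]

end Setting

/-! ### The theorem -/

/-- The algorithm with message encoding `enc`. -/
noncomputable def cutPairAlgorithm (S : SketchScheme) (B K T : ℕ) (enc : Msg B S.len → List Bool) :
    Algorithm (LocalInput S) :=
  ofSend enc (fun inp t h j => sendMsg inp K T h t j) fun inp h => outputBit inp K T h

lemma card_msg_le {n γ m k : ℕ} (hk : k = 7 * (γ * Nat.clog 2 n + 2) + 2 * m) :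
    Fintype.card (Msg (n ^ γ) m) ≤ 2 ^ k := by
  have h1 : n ^ γ + 2 ≤ 2 ^ (γ * Nat.clog 2 n + 2) := by
    have : n ^ γ ≤ 2 ^ (γ * Nat.clog 2 n) := by
      rw [mul_comm, pow_mul]
      exact Nat.pow_le_pow_left (Nat.le_pow_clog one_lt_two n) γ
    have h2 := Nat.one_le_two_pow (n := γ * Nat.clog 2 n)
    rw [pow_add]
    omega
  rw [hk, pow_add, pow_mul' 2 7, pow_mul' 2 2]
  simp only [Msg, Label, Fintype.card_prod, Fintype.card_pi, Fintype.card_fin, ZMod.card,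
    Finset.prod_const, Finset.card_univ]
  exact Nat.mul_le_mul (Nat.pow_le_pow_left h1 7) le_rfl

end CutPair

/-! ### Union bound over the seeds and the final constants. -/

namespace CutPair

open RootedNetwork

lemma RootedNetwork.Independent.three_le_card {V : Type*} [Fintype V] {N : RootedNetwork V}
    {x y : V} (h : N.Independent x y) : 3 ≤ Fintype.card V := by
  classical
  have h3 : ({N.root, x, y} : Finset V).card = 3 := by
    rw [Finset.card_eq_three]
    exact ⟨_, _, _, h.ne_root.symm, h.symm.ne_root.symm, h.ne, rfl⟩
  rw [← h3]
  exact Finset.card_le_univ _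

lemma RootedNetwork.Independent.depth_pos {V : Type*} [Fintype V] {N : RootedNetwork V}
    {x y : V} (h : N.Independent x y) : 1 ≤ N.depth := by
  refine le_trans ?_ (N.level_le_depth x)
  exact Nat.one_le_iff_ne_zero.2 fun h0 => h.ne_root (N.level_eq_zero.1 h0)

namespace Setting

variable {V : Type*} [Fintype V] {S : SketchScheme} {B K T : ℕ} (I : Setting V S B K T)

/-- Few seeds let one of the two ends err. -/
lemma ncard_knows_le (hT : Nat.card V ≤ 2 ^ T) (hS : ∀ (E : Finset (Sym2 ExtID)) (M : ℕ),
      E.Nonempty → Set.InjOn edgeCode E → (∀ e ∈ E, edgeCode e < M) →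
      {seed | ∑ e ∈ E, S.edge seed e = 0}.ncard ≤ M) {t : ℕ}
    (ht : (3 * T + 3) * slotLength K I.N.depth ≤ t) :
    {seed | ¬ ∀ z, z = I.x ∨ z = I.y → ∃ b, outputBit ((I.withSeed seed).inp z) K T
        (received I.N (I.withSeed seed).content t z) = some b ∧
        (b = true ↔ (I.N.graph.induce ({I.x, I.y}ᶜ)).Connected)}.ncard ≤ 3 * B ^ 2 := by
  -- Labels and regions do not depend on the seed. The three tested sets are therefore fixed in
  -- advance, and a union bound over them suffices.
  set A₁ : Set V := {v | I.labels T v = heavyCompLabel B I.H I.C I.x I.y} with hA₁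
  set A₂ : Set V := {v | I.labels T v = heavyCompLabel B I.H I.C I.y I.x} with hA₂
  set A₃ : Set V := {v | I.labels T v = heavyCompLabel B I.H I.C I.x I.y ∨
    I.labels T v = heavyCompLabel B I.H I.C I.y I.x} with hA₃
  have hA₃' : A₃ = {v | I.labels T v = heavyCompLabel B I.H I.C I.y I.x ∨
    I.labels T v = heavyCompLabel B I.H I.C I.x I.y} := Set.ext fun v => or_comm
  let bad (A : Set V) : Set (Fin S.seedLen → Bool) := {seed | ¬ (I.withSeed seed).Faithful A}
  calc _ ≤ (bad A₁ ∪ bad A₂ ∪ bad A₃).ncard := by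
        refine Set.ncard_le_ncard (fun seed hs => ?_) (Set.toFinite _)
        by_contra hb
        have hb' : ((I.withSeed seed).Faithful A₁ ∧ (I.withSeed seed).Faithful A₂) ∧
            (I.withSeed seed).Faithful A₃ := by
          simpa only [bad, Set.mem_union, Set.mem_ofPred_eq, not_or, not_not] using hb
        obtain ⟨⟨f₁, f₂⟩, f₃⟩ := hb'
        refine hs ?_
        rintro z (rfl | rfl)
        · have h : Ends (I.withSeed seed).x (I.withSeed seed).y I.x I.y := Or.inl ⟨rfl, rfl⟩
          exact ⟨_, outputBit_content h ht, decision_iff_connected hT h f₁ f₂ f₃⟩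
        · have h : Ends (I.withSeed seed).x (I.withSeed seed).y I.y I.x := Or.inr ⟨rfl, rfl⟩
          rw [hA₃'] at f₃
          exact ⟨_, outputBit_content h ht, decision_iff_connected hT h f₂ f₁ f₃⟩
    _ ≤ (bad A₁).ncard + (bad A₂).ncard + (bad A₃).ncard :=
        (Set.ncard_union_le _ _).trans (Nat.add_le_add_right (Set.ncard_union_le _ _) _)
    _ ≤ B ^ 2 + B ^ 2 + B ^ 2 := by
        gcongr <;> exact ncard_not_faithful hS _
    _ = 3 * B ^ 2 := by ring

end Setting

/-- An event whose complement is small has large probability. -/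
lemma one_sub_le_ncard_div {Ω : Type*} [Finite Ω] [Nonempty Ω] (G : Set Ω) {q : ℕ} (hq : 0 < q)
    (h : Gᶜ.ncard * q ≤ Nat.card Ω) : 1 - 1 / (q : ℝ) ≤ (G.ncard : ℝ) / (Nat.card Ω : ℝ) := by
  have hq' : (0 : ℝ) < q := by exact_mod_cast hq
  have hΩ : (0 : ℝ) < Nat.card Ω := by exact_mod_cast Nat.card_pos
  have h1 : (G.ncard : ℝ) + Gᶜ.ncard = Nat.card Ω := by exact_mod_cast Set.ncard_add_ncard_compl G
  have h2 : (Gᶜ.ncard : ℝ) * q ≤ Nat.card Ω := by exact_mod_cast h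
  rw [← h1] at h2 hΩ ⊢
  rw [one_sub_div hq'.ne', div_le_div_iff₀ hq' hΩ]
  nlinarith

/-- The factor `3` counts the tested cuts and is absorbed by `n ^ 2`; `(n ^ γ) ^ 2` bounds the edge
codes, and `n ^ c` is the inverse of the allowed error. -/
lemma three_mul_pow_le {n γ c : ℕ} (hn : 3 ≤ n) :
    3 * (n ^ γ) ^ 2 * n ^ c ≤ 2 ^ ((2 * γ + c + 2) * Nat.clog 2 n + 1) := by
  calc 3 * (n ^ γ) ^ 2 * n ^ c ≤ n ^ 2 * (n ^ γ) ^ 2 * n ^ c := by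
        gcongr
        nlinarith
    _ = n ^ (2 * γ + c + 2) := by ring
    _ ≤ (2 ^ Nat.clog 2 n) ^ (2 * γ + c + 2) :=
        Nat.pow_le_pow_left (Nat.le_pow_clog one_lt_two n) _
    _ = 2 ^ ((2 * γ + c + 2) * Nat.clog 2 n) := by rw [← pow_mul, mul_comm]
    _ ≤ _ := Nat.pow_le_pow_right two_pos (Nat.le_succ _)

end CutPair

open CutPair in
theorem mainTheorem3 :
    ∃ B : ℕ, ∀ K γ c : ℕ, ∃ (A : ℕ) (S : ℕ → CutPair.SketchScheme)
      (P : (n : ℕ) → CutPair.Algorithm (CutPair.LocalInput (S n))) (rounds : ℕ → ℕ → ℕ),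
      (∀ n, 3 ≤ n → (S n).seedLen ≤ A * Nat.clog 2 n ^ B ∧ (S n).len ≤ A * Nat.clog 2 n ^ B) ∧
      ∀ (V : Type*) [Fintype V] (n : ℕ), Fintype.card V = n →
      ∀ (N : CutPair.RootedNetwork V), (∀ v, N.ident v < n ^ γ) →
        (∀ v, (N.graph.induce ({v}ᶜ : Set V)).Connected) →
      ∀ (H : CutPair.HeavyLight N) (C : CutPair.ConnectivityTrees N) (x y : V),
        N.Independent x y →
      ∀ p : N.graph.Walk x y, p.IsPath → p.length ≤ K * N.graph.diam →
        -- the number of rounds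
        rounds n N.depth ≤ A * N.graph.diam * Nat.clog 2 n ^ B ∧
        -- message size, the edges in use, and congestion, for all outcomes of the randomness
        (∀ (seed : Fin (S n).seedLen → Bool) (coins : V → Fin (P n).coinLen → Bool) (u v : V),
          N.graph.Adj u v →
          (∀ t < rounds n N.depth, ∀ m,
            (P n).message N (CutPair.localInput H C (S n) seed p) coins t u v = some m →
              m.length ≤ A * Nat.clog 2 n ∧
              (s(u, v) ∈ p.edges ∨
                u ∈ CutPair.LDS H C x y ∪ CutPair.LDS H C y x ∨
                v ∈ CutPair.LDS H C x y ∪ CutPair.LDS H C y x)) ∧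
          (P n).messageCount N (CutPair.localInput H C (S n) seed p) coins
              (rounds n N.depth) u v +
            (P n).messageCount N (CutPair.localInput H C (S n) seed p) coins
              (rounds n N.depth) v u ≤ A * Nat.clog 2 n ^ B) ∧
        -- success with high probability over the random seed and the private coins
        1 - 1 / (n : ℝ) ^ c ≤
          ({ω : (Fin (S n).seedLen → Bool) × (V → Fin (P n).coinLen → Bool) |
              ∀ z, z = x ∨ z = y →
                CutPair.Knows (P n) N.graph x y
                  ((P n).stateAt N (CutPair.localInput H C (S n) ω.1 p) ω.2
                    (rounds n N.depth) z)}.ncard : ℝ) /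
          (Nat.card ((Fin (S n).seedLen → Bool) × (V → Fin (P n).coinLen → Bool)) : ℝ) := by
  refine ⟨1, fun K γ c => ?_⟩
  -- Large enough for an error of at most `n ^ (-c)`; the final `1` keeps the degree of the field
  -- extension positive.
  let m (n : ℕ) : ℕ := (2 * γ + c + 2) * Nat.clog 2 n + 1
  choose S hS₁ hS₂ hS using fun n => exists_fingerprint (m := m n) (Nat.succ_ne_zero _)
  let k (n : ℕ) : ℕ := 7 * (γ * Nat.clog 2 n + 2) + 2 * (S n).len
  choose enc henc henc' using fun n =>
    exists_encoding (Msg (n ^ γ) (S n).len) (card_msg_le (n := n) (γ := γ) (k := k n) rfl)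
  -- The summands serve, in turn, the seed and sketch lengths, the number of rounds, the congestion
  -- in both directions, and the message size.
  let A := (2 * γ + c + 3) + (12 * K + 36) + 60 + (7 * γ + 14 + 2 * (2 * γ + c + 3))
  refine ⟨A, S, fun n => cutPairAlgorithm (S n) (n ^ γ) K (Nat.clog 2 n) (enc n),
    fun n D => (3 * Nat.clog 2 n + 3) * slotLength K D, fun n hn => ?_, ?_⟩
  · have hT : 1 ≤ Nat.clog 2 n := Nat.clog_pos one_lt_two (by omega)
    have : m n ≤ A * Nat.clog 2 n ^ 1 := by
      simp only [m, A]
      nlinarith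
    exact ⟨(hS₁ n).trans_le this, (hS₂ n).trans_le this⟩
  intro V _ n hn N hid _ H C x y hind p hp hlen
  have hn3 : 3 ≤ n := hn ▸ hind.three_le_card
  have hT : 1 ≤ Nat.clog 2 n := Nat.clog_pos one_lt_two (by omega)
  have hD := hind.depth_pos
  have hlen' : p.length ≤ 2 * K * N.depth := by
    have := Nat.mul_le_mul_left K N.diam_le_depth
    rw [mul_comm 2 K, mul_assoc]
    exact hlen.trans this
  let I (seed : Fin (S n).seedLen → Bool) : Setting V (S n) (n ^ γ) K (Nat.clog 2 n) :=
    { N := N, H := H, C := C, seed := seed, x := x, y := y, ind := hind, p := p, isPath := hp,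
      ident_lt := hid, length_le := hlen' }
  have hsend : ∀ seed t u v, sendMsg ((I seed).inp u) K (Nat.clog 2 n)
      (received N (I seed).content t u) t (N.ident v) = (I seed).content t u v :=
    fun seed => (I seed).sendMsg_content
  have hmsg : ∀ seed coins t u v, N.graph.Adj u v →
      (cutPairAlgorithm (S n) (n ^ γ) K (Nat.clog 2 n) (enc n)).message N
        (localInput H C (S n) seed p) coins t u v = ((I seed).content t u v).map (enc n) :=
    fun seed coins t u v huv => 
      message_ofSend (henc n) _ _ _ (fun t u v _ => hsend seed t u v) _ huv
  have hstate : ∀ seed coins t v,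
      (cutPairAlgorithm (S n) (n ^ γ) K (Nat.clog 2 n) (enc n)).output
        ((cutPairAlgorithm (S n) (n ^ γ) K (Nat.clog 2 n) (enc n)).stateAt N
          (localInput H C (S n) seed p) coins t v) =
      outputBit ((I seed).inp v) K (Nat.clog 2 n) (received N (I seed).content t v) := by
    intro seed coins t v
    have := stateAt_ofSend (out := fun inp h => outputBit inp K (Nat.clog 2 n) h) (henc n) _ coins
      _ (fun t u v _ => hsend seed t u v) t v
    exact congrArg (fun st : LocalInput (S n) × ℕ × (ℕ → ℕ → Option (Msg (n ^ γ) (S n).len)) =>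
      outputBit st.1 K (Nat.clog 2 n) st.2.2) this
  have hcount : ∀ seed coins u v, N.graph.Adj u v →
      (cutPairAlgorithm (S n) (n ^ γ) K (Nat.clog 2 n) (enc n)).messageCount N
        (localInput H C (S n) seed p) coins
        ((3 * Nat.clog 2 n + 3) * slotLength K N.depth) u v ≤ 5 * (3 * Nat.clog 2 n + 3) := by
    intro seed coins u v huv
    refine le_trans (le_of_eq ?_) ((I seed).ncard_content_le (3 * Nat.clog 2 n + 3) u v)
    unfold Algorithm.messageCount
    congr 1
    ext t
    simp only [Set.mem_ofPred_eq, hmsg seed coins t u v huv, ne_eq, Option.map_eq_none_iff]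
    rfl
  beta_reduce
  refine ⟨?_, fun seed coins u v huv => ⟨fun t ht msg h => ?_, ?_⟩, ?_⟩
  · have hd := N.depth_le_diam
    calc (3 * Nat.clog 2 n + 3) * slotLength K N.depth
        ≤ (6 * Nat.clog 2 n) * ((2 * K + 6) * N.graph.diam) := by
          refine Nat.mul_le_mul (by omega) ?_
          simp only [slotLength]
          nlinarith [Nat.mul_le_mul_left K hd]
      _ = (12 * K + 36) * N.graph.diam * Nat.clog 2 n ^ 1 := by ring
      _ ≤ _ := by
          gcongr
          simp only [A]
          omega
  · rw [hmsg seed coins t u v huv, Option.map_eq_some_iff] at h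
    obtain ⟨μ, hμ, rfl⟩ := h
    refine ⟨?_, (I seed).content_edge (by rw [hμ]; exact Option.some_ne_none _)⟩
    rw [henc', show k n = 7 * (γ * Nat.clog 2 n + 2) + 2 * m n by rw [← hS₂ n]]
    simp only [m, A]
    nlinarith
  · have h1 := hcount seed coins u v huv
    have h2 := hcount seed coins v u huv.symm
    have h3 : 60 * Nat.clog 2 n ≤ A * Nat.clog 2 n ^ 1 := by
      rw [pow_one]
      refine Nat.mul_le_mul_right _ ?_
      simp only [A]
      omega
    omega
  -- The seed put in here is arbitrary, as the bound runs over all replacements of it.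
  · have hbad := (I fun _ => false).ncard_knows_le (by
      rw [Nat.card_eq_fintype_card, hn]
      exact Nat.le_pow_clog one_lt_two _) (hS n)
      (le_refl ((3 * Nat.clog 2 n + 3) * slotLength K N.depth))
    -- The algorithm tosses no private coins, so the probability space reduces to the seeds.
    have : IsEmpty (Fin (cutPairAlgorithm (S n) (n ^ γ) K (Nat.clog 2 n) (enc n)).coinLen) :=
      inferInstanceAs (IsEmpty (Fin 0))
    rw [← Nat.cast_pow]
    refine one_sub_le_ncard_div _ (by positivity) ?_
    have hc : Nat.card (V → Fin (cutPairAlgorithm (S n) (n ^ γ) K (Nat.clog 2 n) (enc n)).coinLen →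
      Bool) = 1 := Nat.card_unique
    rw [Nat.card_prod, hc, mul_one, Nat.card_fun, Nat.card_eq_fintype_card,
      Fintype.card_bool, Nat.card_fin]
    refine (Nat.mul_le_mul_right _ (le_trans ?_ hbad)).trans
      ((three_mul_pow_le hn3).trans_eq (congrArg (2 ^ ·) (hS₁ n).symm))
    refine Set.ncard_le_ncard_of_injOn Prod.fst ?_ ?_ (Set.toFinite _)
    · rintro ⟨seed, coins⟩ hω hk
      refine hω fun z hz => ?_
      obtain ⟨b, hb, hb'⟩ := hk z hz
      exact ⟨b, (hstate seed coins _ z).trans hb, hb'⟩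
    · rintro ⟨s₁, c₁⟩ - ⟨s₂, c₂⟩ - h
      exact Prod.ext h (Subsingleton.elim _ _)
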